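/- Let $G$ be a second countable locally compact Hausdorff groupoid with unit space $G^0$, range and source maps $r,s$, and fibres $G^u=r^{-1}(\{u\})$, equipped with a (continuous) left Haar system $\{\lambda^u\}_{u\in G^0}$: $\lambda^u$ is a Radon measure with support $G^u$, the function $u\mapsto\int f\,d\lambda^u$ is continuous for every $f\in C_c(G)$, and $\int f(xy)\,d\lambda^{s(x)}(y)=\int f(y)\,d\lambda^{r(x)}(y)$ for all $f\in C_c(G)$, $x\in G$. On $C_c(G)$ consider the convolution product $(f*g)(x)=\int f(t)\,g(t^{-1}x)\,d\lambda^{r(x)}(t)$ and the norm $\|f\|_{I,r}=\sup_{u\in G^0}\int |f|\,d\lambda^u$. Let $E^2$ be the Banach space of continuous sections $\xi=(\xi^u)_{u\in G^0}$, $\xi^u\in L^2(G^u,\lambda^u)$, of the left regular Hilbert bundle that vanish at infinity, with norm $\|\xi\|=\sup_u\|\xi^u\|_2$; here a section $\xi$ is continuous if for every $u_0\in G^0$ and $\varepsilon>0$ there is $f\in C_c(G)$ with $\|\xi^u-f|_{G^u}\|_2<\varepsilon$ for all $u$ in a neighbourhood of $u_0$. Each $f\in C_c(G)$ is regarded as the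 element $u\mapsto f|_{G^u}$ of $E^2$. Let $\mathfrak B(E^2)$ be the Banach algebra of bounded linear operators on $E^2$. For each $F\in C_c(G)$ the maps $f\mapsto F*f$ and $f\mapsto f*F$ on $C_c(G)$ extend uniquely to bounded linear operators $L_F$ and $R_F$ on $E^2$. Let $VN(G)=\{T\in\mathfrak B(E^2): TR_F=R_FT \text{ for all } F\in C_c(G)\}$. Then: (1) There is a sequence $\{F_n\}$ of nonnegative functions in $C_c(G)$ with $\sup_n\|F_n\|_{I,r}<\infty$, such that $\|F_n*f-f\|_{I,r}\to 0$ for all $f\in C_c(G)$ and $L_{F_n}\to I$ in the strong operator topology of $\mathfrak B(E^2)$. (2) The set $\mathfrak L=\{L_F: F\in C_c(G)\}$ is a subalgebra of $\mathfrak B(E^2)$, and $VN(G)$ is the closure of $\mathfrak L$ in $\mathfrak B(E^2)$ for the strong operator topology. -/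

import Mathlib

open MeasureTheory Filter Topology Set
open scoped CompactlySupported ENNReal ComplexOrder

/-- A topological groupoid with unit space `X` and space of arrows `G`. The product `x * y` is
meaningful exactly when `s x = r y`; as usual in Mathlib, `mul` is given a value everywhere, but all
the laws, and the continuity of the product, only concern composable pairs. -/
structure TopGroupoid (X G : Type*) [TopologicalSpace X] [TopologicalSpace G] where
  /-- range map -/
  r : G → X
  /-- source map -/
  s : G → X
  /-- the unit at a point of the unit space -/
  unit : X → G
  /-- the partial product, meaningful on composable pairs -/
  mul : G → G → G
  /-- inversion -/
  inv : G → G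
  r_unit : ∀ u, r (unit u) = u
  s_unit : ∀ u, s (unit u) = u
  r_mul : ∀ x y, s x = r y → r (mul x y) = r x
  s_mul : ∀ x y, s x = r y → s (mul x y) = s y
  mul_assoc : ∀ x y z, s x = r y → s y = r z → mul (mul x y) z = mul x (mul y z)
  unit_mul : ∀ x, mul (unit (r x)) x = x
  mul_unit : ∀ x, mul x (unit (s x)) = x
  r_inv : ∀ x, r (inv x) = s x
  s_inv : ∀ x, s (inv x) = r x
  mul_inv : ∀ x, mul x (inv x) = unit (r x)
  inv_mul : ∀ x, mul (inv x) x = unit (s x)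
  continuous_r : Continuous r
  continuous_s : Continuous s
  continuous_unit : Continuous unit
  continuous_inv : Continuous inv
  continuousOn_mul : ContinuousOn (fun p : G × G => mul p.1 p.2) {p | s p.1 = r p.2}

/-- A (continuous) left Haar system: a family of Radon measures `λ^u` on `G`, `u ∈ X`, where `λ^u`
has support `G^u = r⁻¹{u}`, which is continuous and left invariant. (On a second countable locally
compact Hausdorff space the Radon measures are the Borel measures that are finite on compacts, and
the complement of the support of a measure is a null set, so `λ^u` is a measure on `G^u`.) -/
structure HaarSystem {X G : Type*} [TopologicalSpace X] [TopologicalSpace G]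
    [MeasurableSpace G] (𝒢 : TopGroupoid X G) where
  /-- the measure `λ^u` -/
  measure : X → Measure G
  finite_on_compacts : ∀ u, IsFiniteMeasureOnCompacts (measure u)
  support_eq : ∀ u, (measure u).support = {x | 𝒢.r x = u}
  continuous_integral : ∀ f : C_c(G, ℂ), Continuous fun u => ∫ x, f x ∂(measure u)
  left_invariant : ∀ (f : C_c(G, ℂ)) (x : G),
    ∫ y, f (𝒢.mul x y) ∂(measure (𝒢.s x)) = ∫ y, f y ∂(measure (𝒢.r x))

set_option linter.unusedSectionVars false

namespace HaarSystem

section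

variable {X G : Type*} [TopologicalSpace X] [TopologicalSpace G] [MeasurableSpace G]
  {𝒢 : TopGroupoid X G} (Λ : HaarSystem 𝒢)

instance instFiniteOnCompacts (u : X) : IsFiniteMeasureOnCompacts (Λ.measure u) :=
  Λ.finite_on_compacts u

/-- The norm `‖f‖_{I,r} = sup_u ∫ |f| dλ^u` on `C_c(G)`. -/
noncomputable def normIr (f : C_c(G, ℂ)) : ℝ := ⨆ u, ∫ x, ‖f x‖ ∂(Λ.measure u)

/-- The function `f * g`, where `(f * g)(x) = ∫ f(t) g(t⁻¹x) dλ^{r(x)}(t)`. -/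
noncomputable def convFun (f g : G → ℂ) (x : G) : ℂ :=
  ∫ t, f t * g (𝒢.mul (𝒢.inv t) x) ∂(Λ.measure (𝒢.r x))

theorem _root_.TopGroupoid.t2Space_unit [T2Space G] (𝒢 : TopGroupoid X G) : T2Space X :=
  T2Space.of_injective_continuous (f := 𝒢.unit)
    (fun u v h => by rw [← 𝒢.r_unit u, h, 𝒢.r_unit]) 𝒢.continuous_unit

theorem _root_.TopGroupoid.mul_inv_mul (𝒢 : TopGroupoid X G) {t x : G} (h : 𝒢.r t = 𝒢.r x) :
    𝒢.mul t (𝒢.mul (𝒢.inv t) x) = x := by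
  rw [← 𝒢.mul_assoc t (𝒢.inv t) x (𝒢.r_inv t).symm ((𝒢.s_inv t).trans h), 𝒢.mul_inv, h,
    𝒢.unit_mul]

end

section

variable {X G : Type*} [TopologicalSpace X] [TopologicalSpace G] [T2Space G]
  [LocallyCompactSpace G] [SecondCountableTopology G] [MeasurableSpace G] [BorelSpace G]
  {𝒢 : TopGroupoid X G} (Λ : HaarSystem 𝒢)

theorem ae_mem_fiber (u : X) : ∀ᵐ x ∂(Λ.measure u), 𝒢.r x = u := by
  have := Measure.support_mem_ae (μ := Λ.measure u)
  rwa [Λ.support_eq u] at this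

theorem continuous_integral_real (f : G → ℝ) (hf : Continuous f) (hc : HasCompactSupport f) :
    Continuous fun u => ∫ x, f x ∂(Λ.measure u) := by
  have h := Λ.continuous_integral ⟨⟨fun x => (f x : ℂ), by fun_prop⟩,
    hc.comp_left (g := fun t : ℝ => (t : ℂ)) Complex.ofReal_zero⟩
  refine (Complex.continuous_re.comp h).congr fun u => ?_
  have h2 : ∫ x, (f x : ℂ) ∂(Λ.measure u) = ((∫ x, f x ∂(Λ.measure u) : ℝ) : ℂ) :=
    integral_ofReal
  exact congrArg Complex.re h2

/-- The supremum in the definition of the `(I,r)`-norm is finite. -/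
theorem bddAbove_normIr (f : C_c(G, ℂ)) :
    BddAbove (range fun u => ∫ x, ‖f x‖ ∂(Λ.measure u)) := by
  have := 𝒢.t2Space_unit
  have hs : HasCompactSupport fun u => ∫ x, ‖f x‖ ∂(Λ.measure u) := by
    refine HasCompactSupport.intro (f.hasCompactSupport.isCompact.image 𝒢.continuous_r)
      fun u hu => integral_eq_zero_of_ae ?_
    filter_upwards [Λ.ae_mem_fiber u] with x hx
    have : x ∉ tsupport f := fun h => hu ⟨x, h, hx⟩
    simp [image_eq_zero_of_notMem_tsupport this]
  obtain ⟨c, hc⟩ := hs.exists_bound_of_continuous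
    (Λ.continuous_integral_real _ (by fun_prop) f.hasCompactSupport.norm)
  refine ⟨c, ?_⟩
  rintro _ ⟨u, rfl⟩
  exact (le_abs_self _).trans (hc u)

/-- A parametrised integral over the fibres depends continuously on the parameter. -/
theorem continuous_integral_fiber (Φ : G × G → ℂ) (hΦ : Continuous Φ) (K : Set G)
    (hK : IsCompact K) (hsupp : ∀ x t, t ∉ K → Φ (x, t) = 0) :
    Continuous fun x => ∫ t, Φ (x, t) ∂(Λ.measure (𝒢.r x)) := by
  have hcs : ∀ x, HasCompactSupport fun t => Φ (x, t) := fun x =>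
    HasCompactSupport.intro hK fun t ht => hsupp x t ht
  have hct : ∀ x, Continuous fun t => Φ (x, t) := fun x => by fun_prop
  have hint : ∀ x u, Integrable (fun t => Φ (x, t)) (Λ.measure u) := fun x u =>
    (hct x).integrable_of_hasCompactSupport (hcs x)
  obtain ⟨ρ, hρ1, -, hρc, hρI⟩ := exists_continuous_one_zero_of_isCompact hK
    isClosed_empty (disjoint_empty K)
  have hρint : ∀ u, Integrable ρ (Λ.measure u) := fun u =>
    ρ.continuous.integrable_of_hasCompactSupport hρc
  have hM : Continuous fun x => ∫ t, ρ t ∂(Λ.measure (𝒢.r x)) :=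
    (Λ.continuous_integral_real ρ ρ.continuous hρc).comp 𝒢.continuous_r
  rw [continuous_iff_continuousAt]
  intro x₀
  have hA : Tendsto (fun x => ∫ t, Φ (x₀, t) ∂(Λ.measure (𝒢.r x))) (𝓝 x₀)
      (𝓝 (∫ t, Φ (x₀, t) ∂(Λ.measure (𝒢.r x₀)))) :=
    ((Λ.continuous_integral ⟨⟨_, hct x₀⟩, hcs x₀⟩).comp 𝒢.continuous_r).tendsto x₀
  have hB : Tendsto (fun x => ∫ t, (Φ (x, t) - Φ (x₀, t)) ∂(Λ.measure (𝒢.r x))) (𝓝 x₀) (𝓝 0) := by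
    rw [Metric.tendsto_nhds]
    intro ε hε
    set M := ∫ t, ρ t ∂(Λ.measure (𝒢.r x₀)) with hMdef
    have hM0 : 0 ≤ M := integral_nonneg fun t => (hρI t).1
    have hcurry : Tendsto (fun x => (ContinuousMap.curry ⟨Φ, hΦ⟩ : C(G, C(G, ℂ))) x) (𝓝 x₀)
        (𝓝 ((ContinuousMap.curry ⟨Φ, hΦ⟩ : C(G, C(G, ℂ))) x₀)) :=
      (ContinuousMap.continuous _).tendsto x₀
    have hunif := ContinuousMap.tendsto_iff_forall_isCompact_tendstoUniformlyOn.1 hcurry K hK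
    rw [Metric.tendstoUniformlyOn_iff] at hunif
    have hδ : 0 < ε / (2 * (M + 1)) := by positivity
    filter_upwards [hunif _ hδ, (hM.tendsto x₀).eventually (gt_mem_nhds (lt_add_one M))]
      with x hx hx'
    rw [dist_zero_right]
    have hle : ∀ t, ‖Φ (x, t) - Φ (x₀, t)‖ ≤ ε / (2 * (M + 1)) * ρ t := by
      intro t
      by_cases ht : t ∈ K
      · have h1 := hx t ht
        rw [dist_comm, dist_eq_norm] at h1
        have h2 : ρ t = 1 := hρ1 ht
        rw [h2, mul_one]
        exact h1.le
      · rw [hsupp x t ht, hsupp x₀ t ht, sub_zero, norm_zero]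
        exact mul_nonneg hδ.le (hρI t).1
    calc ‖∫ t, (Φ (x, t) - Φ (x₀, t)) ∂(Λ.measure (𝒢.r x))‖
        ≤ ∫ t, ε / (2 * (M + 1)) * ρ t ∂(Λ.measure (𝒢.r x)) :=
          norm_integral_le_of_norm_le ((hρint _).const_mul _) (Eventually.of_forall hle)
      _ = ε / (2 * (M + 1)) * ∫ t, ρ t ∂(Λ.measure (𝒢.r x)) := integral_const_mul _ _
      _ ≤ ε / (2 * (M + 1)) * (M + 1) := by gcongr
      _ = ε / 2 := by field_simp
      _ < ε := half_lt_self hε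
  have hAB := hA.add hB
  rw [add_zero] at hAB
  refine hAB.congr fun x => ?_
  rw [integral_sub (hint _ _) (hint _ _)]
  ring

theorem continuous_convFun (f g : C_c(G, ℂ)) : Continuous (Λ.convFun f g) := by
  have := 𝒢.t2Space_unit
  let C : Set (G × G) := {p | 𝒢.r p.1 = 𝒢.r p.2}
  have hC : IsClosed C := isClosed_eq (𝒢.continuous_r.comp continuous_fst)
    (𝒢.continuous_r.comp continuous_snd)
  have h1 : ContinuousOn (fun p : G × G => 𝒢.mul (𝒢.inv p.2) p.1) C := by
    refine 𝒢.continuousOn_mul.comp (f := fun p : G × G => (𝒢.inv p.2, p.1)) ?_ ?_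
    · exact ((𝒢.continuous_inv.comp continuous_snd).prodMk continuous_fst).continuousOn
    · intro p hp
      exact (𝒢.s_inv p.2).trans (Eq.symm hp)
  let ψ : C(C, ℂ) := ⟨fun p => g (𝒢.mul (𝒢.inv p.1.2) p.1.1),
    g.continuous.comp (continuousOn_iff_continuous_domRestrict.1 h1)⟩
  obtain ⟨Ψ, hΨ⟩ := ContinuousMap.exists_restrict_eq hC ψ
  have h2 := Λ.continuous_integral_fiber (fun p => f p.2 * Ψ p) (by fun_prop) (tsupport f)
    f.hasCompactSupport (fun x t ht => by simp [image_eq_zero_of_notMem_tsupport ht])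
  refine h2.congr fun x => integral_congr_ae ?_
  filter_upwards [Λ.ae_mem_fiber (𝒢.r x)] with t ht
  have : Ψ (x, t) = ψ ⟨(x, t), ht.symm⟩ := by rw [← hΨ]; rfl
  simp only [this]
  rfl

theorem hasCompactSupport_convFun (f g : C_c(G, ℂ)) : HasCompactSupport (Λ.convFun f g) := by
  have := 𝒢.t2Space_unit
  let P : Set (G × G) := (tsupport f ×ˢ tsupport g) ∩ {p | 𝒢.s p.1 = 𝒢.r p.2}
  have hP : IsCompact P := (f.hasCompactSupport.isCompact.prod g.hasCompactSupport).inter_right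
    (isClosed_eq (𝒢.continuous_s.comp continuous_fst) (𝒢.continuous_r.comp continuous_snd))
  refine HasCompactSupport.intro
    (hP.image_of_continuousOn (𝒢.continuousOn_mul.mono inter_subset_right)) fun x hx => ?_
  refine integral_eq_zero_of_ae ?_
  filter_upwards [Λ.ae_mem_fiber (𝒢.r x)] with t ht
  by_contra hne
  obtain ⟨hf, hg⟩ := mul_ne_zero_iff.1 hne
  refine hx ⟨(t, 𝒢.mul (𝒢.inv t) x), ⟨⟨subset_tsupport _ hf, subset_tsupport _ hg⟩, ?_⟩,
    𝒢.mul_inv_mul ht⟩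
  exact ((𝒢.r_mul _ _ ((𝒢.s_inv t).trans ht)).trans (𝒢.r_inv t)).symm

/-- Convolution on `C_c(G)`. -/
noncomputable def conv (f g : C_c(G, ℂ)) : C_c(G, ℂ) where
  toFun := Λ.convFun f g
  continuous_toFun := Λ.continuous_convFun f g
  hasCompactSupport' := Λ.hasCompactSupport_convFun f g

theorem integrable_conv (f g : C_c(G, ℂ)) (x : G) :
    Integrable (fun t => f t * g (𝒢.mul (𝒢.inv t) x)) (Λ.measure (𝒢.r x)) := by
  have := 𝒢.t2Space_unit
  obtain ⟨c, hc⟩ := g.hasCompactSupport.exists_bound_of_continuous g.continuous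
  have hcl : IsClosed {t | 𝒢.r t = 𝒢.r x} := isClosed_eq 𝒢.continuous_r continuous_const
  refine (f.continuous.integrable_of_hasCompactSupport f.hasCompactSupport).mul_bdd (c := c) ?_
    (Eventually.of_forall fun t => hc _)
  have h1 : ContinuousOn (fun t => 𝒢.mul (𝒢.inv t) x) {t | 𝒢.r t = 𝒢.r x} := by
    refine 𝒢.continuousOn_mul.comp (f := fun t => (𝒢.inv t, x)) ?_ ?_
    · exact (𝒢.continuous_inv.prodMk continuous_const).continuousOn
    · intro t ht
      exact (𝒢.s_inv t).trans ht
  have h2 := (g.continuous.comp_continuousOn h1).aestronglyMeasurable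
    (μ := Λ.measure (𝒢.r x)) hcl.measurableSet
  have h3 : (Λ.measure (𝒢.r x)).restrict {t | 𝒢.r t = 𝒢.r x} = Λ.measure (𝒢.r x) :=
    Measure.restrict_eq_self_of_ae_mem (Λ.ae_mem_fiber (𝒢.r x))
  rw [h3] at h2
  exact h2

/-- Convolution as a bilinear map. -/
noncomputable def convBilin : C_c(G, ℂ) →ₗ[ℂ] C_c(G, ℂ) →ₗ[ℂ] C_c(G, ℂ) :=
  LinearMap.mk₂ ℂ Λ.conv
    (fun f f' g => by
      ext x
      show Λ.convFun _ _ x = Λ.convFun _ _ x + Λ.convFun _ _ x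
      simp only [convFun]
      rw [← integral_add (Λ.integrable_conv f g x) (Λ.integrable_conv f' g x)]
      simp [add_mul])
    (fun c f g => by
      ext x
      show Λ.convFun _ _ x = c * Λ.convFun _ _ x
      simp only [convFun]
      rw [← integral_const_mul]
      simp [mul_assoc])
    (fun f g g' => by
      ext x
      show Λ.convFun _ _ x = Λ.convFun _ _ x + Λ.convFun _ _ x
      simp only [convFun]
      rw [← integral_add (Λ.integrable_conv f g x) (Λ.integrable_conv f g' x)]
      simp [mul_add])
    (fun c f g => by
      ext x
      show Λ.convFun _ _ x = c * Λ.convFun _ _ x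
      simp only [convFun]
      rw [← integral_const_mul]
      simp [mul_left_comm])

/-- The fibre `L²(G^u)` of the left regular Hilbert bundle. -/
abbrev L2 (u : X) : Type _ := Lp ℂ 2 (Λ.measure u)

/-- Restriction `f ↦ f^u = f|_{G^u}` of functions in `C_c(G)` to a fibre. -/
noncomputable def restr (u : X) : C_c(G, ℂ) →ₗ[ℂ] Λ.L2 u where
  toFun f := (f.continuous.memLp_of_hasCompactSupport f.hasCompactSupport).toLp f
  map_add' _ _ := rfl
  map_smul' _ _ := rfl

theorem norm_restr (u : X) (f : C_c(G, ℂ)) :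
    ‖Λ.restr u f‖ = √(∫ x, ‖f x‖ ^ 2 ∂(Λ.measure u)) := by
  have hf : MemLp f 2 (Λ.measure u) :=
    f.continuous.memLp_of_hasCompactSupport f.hasCompactSupport
  show ‖hf.toLp f‖ = _
  rw [Lp.norm_toLp, hf.eLpNorm_eq_integral_rpow_norm (by norm_num) (by norm_num),
    ENNReal.toReal_ofReal (by positivity), Real.sqrt_eq_rpow]
  norm_num

theorem continuous_norm_restr (f : C_c(G, ℂ)) : Continuous fun u => ‖Λ.restr u f‖ := by
  simp only [Λ.norm_restr]
  refine Real.continuous_sqrt.comp (Λ.continuous_integral_real _ (by fun_prop) ?_)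
  exact f.hasCompactSupport.comp_left (g := fun z : ℂ => ‖z‖ ^ 2) (by simp)

theorem hasCompactSupport_norm_restr (f : C_c(G, ℂ)) :
    HasCompactSupport fun u => ‖Λ.restr u f‖ := by
  have := 𝒢.t2Space_unit
  refine HasCompactSupport.intro (f.hasCompactSupport.isCompact.image 𝒢.continuous_r)
    fun u hu => ?_
  rw [Λ.norm_restr, integral_eq_zero_of_ae, Real.sqrt_zero]
  filter_upwards [Λ.ae_mem_fiber u] with x hx
  have : x ∉ tsupport f := fun h => hu ⟨x, h, hx⟩
  simp [image_eq_zero_of_notMem_tsupport this]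

/-- Continuous sections of the left regular Hilbert bundle: those that are locally uniformly
close to sections `u ↦ f^u` with `f ∈ C_c(G)`. -/
def IsContinuousSection (ξ : ∀ u, Λ.L2 u) : Prop :=
  ∀ u₀, ∀ ε > 0, ∃ f : C_c(G, ℂ), ∀ᶠ u in 𝓝 u₀, ‖ξ u - Λ.restr u f‖ < ε

/-- The space `E²` of continuous sections of the left regular Hilbert bundle that vanish at
infinity, with the norm `sup_u ‖ξ^u‖` that it inherits from the space of bounded sections. -/
noncomputable def E2 : Submodule ℂ (lp (fun u => Λ.L2 u) ∞) where
  carrier := {ξ | Λ.IsContinuousSection ξ ∧ Tendsto (fun u => ‖ξ u‖) (cocompact X) (𝓝 0)}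
  zero_mem' := ⟨fun u₀ ε hε => ⟨0, by simp [hε]⟩, by simpa using tendsto_const_nhds⟩
  add_mem' := by
    rintro ξ η ⟨h1, h2⟩ ⟨h3, h4⟩
    constructor
    · intro u₀ ε hε
      obtain ⟨f, hf⟩ := h1 u₀ (ε / 2) (half_pos hε)
      obtain ⟨g, hg⟩ := h3 u₀ (ε / 2) (half_pos hε)
      refine ⟨f + g, ?_⟩
      filter_upwards [hf, hg] with u hu hu'
      rw [map_add, lp.coeFn_add, Pi.add_apply, add_sub_add_comm]
      exact (norm_add_le _ _).trans_lt (by linarith)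
    · refine squeeze_zero (fun _ => norm_nonneg _) (fun u => ?_) (by simpa using h2.add h4)
      rw [lp.coeFn_add, Pi.add_apply]
      exact norm_add_le _ _
  smul_mem' := by
    rintro c ξ ⟨h1, h2⟩
    constructor
    · intro u₀ ε hε
      obtain ⟨f, hf⟩ := h1 u₀ (ε / (‖c‖ + 1)) (by positivity)
      refine ⟨c • f, ?_⟩
      filter_upwards [hf] with u hu
      rw [map_smul, lp.coeFn_smul, Pi.smul_apply, ← smul_sub, norm_smul]
      rw [lt_div_iff₀ (by positivity)] at hu
      nlinarith [norm_nonneg (ξ u - Λ.restr u f), norm_nonneg c]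
    · simpa [norm_smul] using h2.const_mul ‖c‖

theorem memlp_restr (f : C_c(G, ℂ)) : Memℓp (fun u => Λ.restr u f) ∞ := by
  obtain ⟨c, hc⟩ := (Λ.hasCompactSupport_norm_restr f).exists_bound_of_continuous
    (Λ.continuous_norm_restr f)
  refine memℓp_infty ⟨c, ?_⟩
  rintro _ ⟨u, rfl⟩
  simpa using hc u

theorem isClosed_E2 : IsClosed (Λ.E2 : Set (lp (fun u => Λ.L2 u) ∞)) := by
  rw [← isSeqClosed_iff_isClosed]
  intro ξ η hξ hη
  have hdist : ∀ ε > 0, ∃ n, ∀ u, ‖η u - ξ n u‖ < ε := by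
    intro ε hε
    obtain ⟨n, hn⟩ := (Metric.tendsto_atTop.1 hη ε hε)
    refine ⟨n, fun u => ?_⟩
    have h1 := hn n le_rfl
    rw [dist_comm, dist_eq_norm] at h1
    refine lt_of_le_of_lt ?_ h1
    have h2 := lp.norm_apply_le_norm ENNReal.top_ne_zero (η - ξ n) u
    rwa [lp.coeFn_sub, Pi.sub_apply] at h2
  constructor
  · intro u₀ ε hε
    obtain ⟨n, hn⟩ := hdist (ε / 2) (half_pos hε)
    obtain ⟨f, hf⟩ := (hξ n).1 u₀ (ε / 2) (half_pos hε)
    refine ⟨f, ?_⟩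
    filter_upwards [hf] with u hu
    have h1 := norm_sub_le_norm_sub_add_norm_sub (η u) (ξ n u) (Λ.restr u f)
    linarith [hn u]
  · rw [Metric.tendsto_nhds]
    intro ε hε
    obtain ⟨n, hn⟩ := hdist (ε / 2) (half_pos hε)
    filter_upwards [Metric.tendsto_nhds.1 (hξ n).2 (ε / 2) (half_pos hε)] with u hu
    rw [dist_zero_right, norm_norm] at hu ⊢
    have h1 := norm_le_norm_add_norm_sub' (η u) (ξ n u)
    linarith [hn u]

instance instCompleteE2 : CompleteSpace Λ.E2 := Λ.isClosed_E2.completeSpace_coe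

/-- The inclusion of `C_c(G)` in `E²`, `f ↦ (u ↦ f^u)`. -/
noncomputable def incl : C_c(G, ℂ) →ₗ[ℂ] Λ.E2 where
  toFun f := ⟨⟨fun u => Λ.restr u f, Λ.memlp_restr f⟩, by
    refine ⟨fun u₀ ε hε => ⟨f, by simp [hε]⟩, ?_⟩
    exact (Λ.hasCompactSupport_norm_restr f).is_zero_at_infty⟩
  map_add' f g := by
    apply Subtype.ext
    apply lp.ext
    funext u
    exact map_add (Λ.restr u) f g
  map_smul' c f := by
    apply Subtype.ext
    apply lp.ext
    funext u
    exact map_smul (Λ.restr u) c f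

/-- The left convolution operator `L_F` on `E²`: the bounded extension of `f ↦ F * f`. -/
noncomputable def L (F : C_c(G, ℂ)) : Λ.E2 →L[ℂ] Λ.E2 :=
  (Λ.incl ∘ₗ Λ.convBilin F).extendOfNorm Λ.incl

/-- The right convolution operator `R_F` on `E²`: the bounded extension of `f ↦ f * F`. -/
noncomputable def R (F : C_c(G, ℂ)) : Λ.E2 →L[ℂ] Λ.E2 :=
  (Λ.incl ∘ₗ Λ.convBilin.flip F).extendOfNorm Λ.incl

/-- `VN(G)`: the bounded operators on `E²` that commute with all right convolution operators. -/
def VN : Set (Λ.E2 →L[ℂ] Λ.E2) := {T | ∀ F : C_c(G, ℂ), T ∘L Λ.R F = Λ.R F ∘L T}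

end

end HaarSystem

/-- The closure of a set of bounded operators in the strong operator topology. -/
def sotClosure {E : Type*} [NormedAddCommGroup E] [NormedSpace ℂ E] (S : Set (E →L[ℂ] E)) :
    Set (E →L[ℂ] E) :=
  {T | ContinuousLinearMap.toPointwiseConvergenceCLM ℂ (RingHom.id ℂ) E E T ∈
    closure (ContinuousLinearMap.toPointwiseConvergenceCLM ℂ (RingHom.id ℂ) E E '' S)}

/-! For t with r(t) = u, left division by t carries λ^u to λ^{s(t)}, so a vector ζ of L²(G^{s(t)})
has a translate t·ζ in L²(G^u) of the same norm. Left convolution is then the vector-valued integral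
(L_F ξ)^u = ∫ F(t) t·ξ^{s(t)} dλ^u(t). Right convolution does not mix the fibres: it acts on each
L²(G^u) by an operator `rconv u F`, bounded by a Schur test, commuting with all translations, with
adjoint `rconv u` of F^*(x) = conj F(x⁻¹). Hence every L_F commutes with every R_f, and since VN(G)
is strongly closed, it contains the closure of 𝔏.

The approximate identity consists of functions supported ever closer to the unit space whose fibre
integrals are at most 1, and equal to 1 over larger and larger compact sets. It works because the
L¹-displacement of f under translation by t is continuous, vanishes at units, and is nonzero only if
one end of t lies over supp f.

The density of 𝔏 is the main point. Given T in VN(G), T L_{F_n} tends strongly to T, so T may be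
replaced by S = T L_F. This S satisfies (S f)^u = f right-convolved onto a fixed vector ζ
(`ev_comp_L`). A partition of unity on the unit space (`exists_norm_sub_le_of_fiberwise`) reduces
the approximation of S on finitely many sections η_j to one fibre u: the vector y = ((S η_j)^u)_j
must lie in the closed span of the vectors ((L_g η_j)^u)_j (`exists_norm_ev_L_sub_lt`).

Let P be the projection on that span, inside a finite sum of copies of L²(G^u). It commutes with the
isotropy group at u and fixes the translates t·η^{s(t)}. Two facts make it usable. Half of a
commutation theorem (`exists_rconv_tendsto`): an operator commuting with the isotropy group is,
together with its adjoint, a limit of right convolutions on a dense set; for this it is compressed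
to E Q E with E a right convolution, which has a kernel depending only on t⁻¹x and locally square
integrable in the appropriate sense. A Kaplansky-type argument (`exists_contractions_tendsto`):
applying z ↦ 2z/(1+z²), which fixes 0 and 1, turns such limits into bounded strong ones. So P is the
strong limit of bounded matrices Y_n of right convolutions.

The sections Y_n η − η are then bounded on the orbit of u and tend to 0 pointwise there. The
functionals ξ ↦ ⟨k_i, (Sξ)^u⟩ respect such dominated convergence (`tendsto_zero_of_dominated`),
because of the special form of S. As S commutes with the R's, ⟨k, Y_n y − y⟩ → 0, that is ⟨k, P y −
y⟩ = 0 for every k. For k orthogonal to the range of P this says ⟨k, y⟩ = 0. -/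

namespace TopGroupoid

/-! ### Algebra of left division in a groupoid. -/

variable {X G : Type*} [TopologicalSpace X] [TopologicalSpace G] [MeasurableSpace G]
  (𝒢 : TopGroupoid X G)

open Classical in
/-- Left division: `ldiv t x = t⁻¹ x` if `r t = r x`, and `x` otherwise. -/
noncomputable def ldiv (t x : G) : G := if 𝒢.r t = 𝒢.r x then 𝒢.mul (𝒢.inv t) x else x

theorem ldiv_eq {t x : G} (h : 𝒢.r t = 𝒢.r x) : 𝒢.ldiv t x = 𝒢.mul (𝒢.inv t) x := if_pos h

theorem r_ldiv {t x : G} (h : 𝒢.r t = 𝒢.r x) : 𝒢.r (𝒢.ldiv t x) = 𝒢.s t := by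
  rw [𝒢.ldiv_eq h, 𝒢.r_mul _ _ ((𝒢.s_inv t).trans h), 𝒢.r_inv]

theorem s_ldiv {t x : G} (h : 𝒢.r t = 𝒢.r x) : 𝒢.s (𝒢.ldiv t x) = 𝒢.s x := by
  rw [𝒢.ldiv_eq h, 𝒢.s_mul _ _ ((𝒢.s_inv t).trans h)]

theorem mul_ldiv {t x : G} (h : 𝒢.r t = 𝒢.r x) : 𝒢.mul t (𝒢.ldiv t x) = x := by
  rw [𝒢.ldiv_eq h, 𝒢.mul_inv_mul h]

theorem inv_mul_mul {t y : G} (h : 𝒢.s t = 𝒢.r y) : 𝒢.mul (𝒢.inv t) (𝒢.mul t y) = y := by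
  rw [← 𝒢.mul_assoc _ _ _ (𝒢.s_inv t) h, 𝒢.inv_mul, h, 𝒢.unit_mul]

theorem ldiv_mul {t y : G} (h : 𝒢.s t = 𝒢.r y) : 𝒢.ldiv t (𝒢.mul t y) = y := by
  rw [𝒢.ldiv_eq (𝒢.r_mul t y h).symm, 𝒢.inv_mul_mul h]

theorem mul_left_cancel {t y z : G} (hy : 𝒢.s t = 𝒢.r y) (hz : 𝒢.s t = 𝒢.r z)
    (h : 𝒢.mul t y = 𝒢.mul t z) : y = z := by
  rw [← 𝒢.ldiv_mul hy, h, 𝒢.ldiv_mul hz]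

theorem inv_inv (t : G) : 𝒢.inv (𝒢.inv t) = t := by
  refine 𝒢.mul_left_cancel (t := 𝒢.inv t) (𝒢.r_inv _).symm (𝒢.s_inv t) ?_
  rw [𝒢.mul_inv, 𝒢.inv_mul, 𝒢.r_inv]

theorem ldiv_unit (x : G) : 𝒢.ldiv (𝒢.unit (𝒢.r x)) x = x := by
  have h := 𝒢.mul_ldiv (t := 𝒢.unit (𝒢.r x)) (x := x) (𝒢.r_unit _)
  have h2 := 𝒢.unit_mul (𝒢.ldiv (𝒢.unit (𝒢.r x)) x)
  rw [𝒢.r_ldiv (𝒢.r_unit _), 𝒢.s_unit] at h2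
  rw [← h2, h]

theorem inv_ldiv {t x : G} (h : 𝒢.r t = 𝒢.r x) : 𝒢.inv (𝒢.ldiv t x) = 𝒢.ldiv x t := by
  have e1 : 𝒢.r (𝒢.ldiv t x) = 𝒢.s t := 𝒢.r_ldiv h
  have e2 : 𝒢.s (𝒢.ldiv t x) = 𝒢.s x := 𝒢.s_ldiv h
  refine 𝒢.mul_left_cancel (t := x) ?_ (𝒢.r_ldiv h.symm).symm ?_
  · rw [𝒢.r_inv, e2]
  · rw [𝒢.mul_ldiv h.symm]
    nth_rewrite 1 [← 𝒢.mul_ldiv h]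
    rw [𝒢.mul_assoc _ _ _ e1.symm (𝒢.r_inv _).symm, 𝒢.mul_inv, e1, 𝒢.mul_unit]

/-- `(z⁻¹t)⁻¹(z⁻¹x) = t⁻¹x`. -/
theorem ldiv_ldiv_ldiv {z t x : G} (ht : 𝒢.r z = 𝒢.r t) (hx : 𝒢.r z = 𝒢.r x) :
    𝒢.ldiv (𝒢.ldiv z t) (𝒢.ldiv z x) = 𝒢.ldiv t x := by
  have htx := ht.symm.trans hx
  have e : 𝒢.r (𝒢.ldiv z t) = 𝒢.r (𝒢.ldiv z x) := by rw [𝒢.r_ldiv ht, 𝒢.r_ldiv hx]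
  refine 𝒢.mul_left_cancel (t := t) ?_ (𝒢.r_ldiv htx).symm ?_
  · rw [𝒢.r_ldiv e, 𝒢.s_ldiv ht]
  · rw [𝒢.mul_ldiv htx]
    nth_rewrite 1 [← 𝒢.mul_ldiv ht]
    rw [𝒢.mul_assoc _ _ _ (𝒢.r_ldiv ht).symm (𝒢.r_ldiv e).symm, 𝒢.mul_ldiv e, 𝒢.mul_ldiv hx]

theorem ldiv_mul_mul {z t x : G} (ht : 𝒢.s z = 𝒢.r t) (hx : 𝒢.s z = 𝒢.r x) :
    𝒢.ldiv (𝒢.mul z t) (𝒢.mul z x) = 𝒢.ldiv t x := by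
  have h := 𝒢.ldiv_ldiv_ldiv (z := z) (t := 𝒢.mul z t) (x := 𝒢.mul z x)
    (𝒢.r_mul _ _ ht).symm (𝒢.r_mul _ _ hx).symm
  rw [𝒢.ldiv_mul ht, 𝒢.ldiv_mul hx] at h
  exact h.symm

/-- `(tz)⁻¹ x = z⁻¹ (t⁻¹ x)`. -/
theorem ldiv_mul_left {t z x : G} (hz : 𝒢.s t = 𝒢.r z) (hx : 𝒢.r t = 𝒢.r x) :
    𝒢.ldiv (𝒢.mul t z) x = 𝒢.ldiv z (𝒢.ldiv t x) := by
  rw [← 𝒢.ldiv_mul_mul hz (𝒢.r_ldiv hx).symm, 𝒢.mul_ldiv hx]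

/-! ### Topology and measurability of left division; the unit space as a closed subset. -/

section

variable [T2Space G]

theorem isClosed_fiberProd : IsClosed {p : G × G | 𝒢.r p.1 = 𝒢.r p.2} := by
  have := 𝒢.t2Space_unit
  exact isClosed_eq (𝒢.continuous_r.comp continuous_fst) (𝒢.continuous_r.comp continuous_snd)

theorem isClosed_fiber (u : X) : IsClosed {x : G | 𝒢.r x = u} := by
  have := 𝒢.t2Space_unit
  exact isClosed_eq 𝒢.continuous_r continuous_const

theorem continuousOn_ldiv :
    ContinuousOn (fun p : G × G => 𝒢.ldiv p.1 p.2) {p | 𝒢.r p.1 = 𝒢.r p.2} := by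
  have h1 : ContinuousOn (fun p : G × G => 𝒢.mul (𝒢.inv p.1) p.2) {p | 𝒢.r p.1 = 𝒢.r p.2} := by
    refine 𝒢.continuousOn_mul.comp (f := fun p : G × G => (𝒢.inv p.1, p.2)) ?_ ?_
    · exact ((𝒢.continuous_inv.comp continuous_fst).prodMk continuous_snd).continuousOn
    · intro p hp
      exact (𝒢.s_inv p.1).trans hp
  exact h1.congr fun p hp => 𝒢.ldiv_eq hp

/-- The default value x off the fibre product is chosen for this: division is continuous on a closed
set and a coordinate projection off it, so no measurability question depends on composability. -/
theorem measurable_ldiv [SecondCountableTopology G] [BorelSpace G] :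
    Measurable fun p : G × G => 𝒢.ldiv p.1 p.2 := by
  classical
  have h := (𝒢.continuousOn_ldiv).measurable_piecewise (g := Prod.snd)
    continuous_snd.continuousOn 𝒢.isClosed_fiberProd.measurableSet
  convert h using 1
  funext p
  by_cases hp : 𝒢.r p.1 = 𝒢.r p.2
  · rw [Set.piecewise_eq_of_mem _ _ _ (by exact hp)]
  · rw [Set.piecewise_eq_of_notMem _ _ _ (by exact hp), ldiv, if_neg hp]

/-- The compact set of products `t y` with `t ∈ A`, `y ∈ B`, `s t = r y`. -/
theorem isCompact_mul {A B : Set G} (hA : IsCompact A) (hB : IsCompact B) :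
    IsCompact ((fun p : G × G => 𝒢.mul p.1 p.2) '' ((A ×ˢ B) ∩ {p | 𝒢.s p.1 = 𝒢.r p.2})) := by
  have := 𝒢.t2Space_unit
  refine ((hA.prod hB).inter_right ?_).image_of_continuousOn
    (𝒢.continuousOn_mul.mono inter_subset_right)
  exact isClosed_eq (𝒢.continuous_s.comp continuous_fst) (𝒢.continuous_r.comp continuous_snd)

theorem mem_mul_of_ldiv_mem {A B : Set G} {t x : G} (ht : t ∈ A) (h : 𝒢.r t = 𝒢.r x)
    (hx : 𝒢.ldiv t x ∈ B) :
    x ∈ (fun p : G × G => 𝒢.mul p.1 p.2) '' ((A ×ˢ B) ∩ {p | 𝒢.s p.1 = 𝒢.r p.2}) :=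
  ⟨(t, 𝒢.ldiv t x), ⟨⟨ht, hx⟩, (𝒢.r_ldiv h).symm⟩, 𝒢.mul_ldiv h⟩

/-- The range map is a continuous left inverse of the unit map. Through this embedding X inherits
local compactness and second countability, which are assumed only for G. -/
theorem isClosedEmbedding_unit : IsClosedEmbedding 𝒢.unit :=
  (show Function.LeftInverse 𝒢.r 𝒢.unit from 𝒢.r_unit).isClosedEmbedding
    𝒢.continuous_r 𝒢.continuous_unit

theorem locallyCompactSpace_unit (𝒢 : TopGroupoid X G) [LocallyCompactSpace G] : LocallyCompactSpace X :=
  𝒢.isClosedEmbedding_unit.locallyCompactSpace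

theorem secondCountable_unit (𝒢 : TopGroupoid X G) [SecondCountableTopology G] : SecondCountableTopology X :=
  𝒢.isClosedEmbedding_unit.isEmbedding.secondCountableTopology

variable [LocallyCompactSpace G] [SecondCountableTopology G]

/-- Left translates of `f ∈ C_c(G)` by elements of a compact set extend jointly continuously, with
a common compact support. -/
theorem exists_extension (f : C_c(G, ℂ)) {W : Set G} (hW : IsCompact W) :
    ∃ (Ψ : C(G × G, ℂ)) (K : Set G), IsCompact K ∧ (∀ t x, x ∉ K → Ψ (t, x) = 0) ∧
      ∀ t ∈ W, ∀ x, 𝒢.r t = 𝒢.r x → Ψ (t, x) = f (𝒢.ldiv t x) := by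
  let C : Set (G × G) := {p | 𝒢.r p.1 = 𝒢.r p.2}
  have hC : IsClosed C := 𝒢.isClosed_fiberProd
  let ψ : C(C, ℂ) := ⟨fun p => f (𝒢.ldiv p.1.1 p.1.2),
    f.continuous.comp (continuousOn_iff_continuous_domRestrict.1 𝒢.continuousOn_ldiv)⟩
  -- Tietze extension from the closed fibre product; the cut-off ρ, equal to 1 on the compact set W
  -- · supp f, then gives a support that does not depend on t.
  obtain ⟨Ψ, hΨ⟩ := ContinuousMap.exists_restrict_eq hC ψ
  have hK := 𝒢.isCompact_mul hW f.hasCompactSupport.isCompact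
  obtain ⟨ρ, hρ1, -, hρc, -⟩ := exists_continuous_one_zero_of_isCompact hK
    isClosed_empty (disjoint_empty _)
  refine ⟨⟨fun p => (ρ p.2 : ℂ) * Ψ p, by fun_prop⟩, tsupport ρ, hρc, ?_, ?_⟩
  · intro t x hx
    simp [image_eq_zero_of_notMem_tsupport hx]
  · intro t ht x hx
    have h1 : Ψ (t, x) = f (𝒢.ldiv t x) := by
      have : Ψ (t, x) = ψ ⟨(t, x), hx⟩ := by rw [← hΨ]; rfl
      exact this
    simp only [ContinuousMap.coe_mk, h1]
    by_cases h0 : f (𝒢.ldiv t x) = 0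
    · rw [h0, mul_zero]
    · have : ρ x = 1 := hρ1 (𝒢.mem_mul_of_ldiv_mem ht hx (subset_tsupport _ h0))
      rw [this, Complex.ofReal_one, one_mul]

end

/-- Multiplication of `f ∈ C_c(G)` by the pullback along `r` of a function on the unit space. -/
noncomputable def mulC (φ : BoundedContinuousFunction X ℝ) (f : C_c(G, ℂ)) : C_c(G, ℂ) where
  toFun x := (φ (𝒢.r x) : ℂ) * f x
  continuous_toFun := by
    have := 𝒢.continuous_r
    fun_prop
  hasCompactSupport' := f.hasCompactSupport.mul_left

theorem mulC_apply (φ : BoundedContinuousFunction X ℝ) (f : C_c(G, ℂ)) (x : G) :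
    𝒢.mulC φ f x = (φ (𝒢.r x) : ℂ) * f x := rfl

end TopGroupoid

/-! ### Invariance of the Haar measures and the fibres L²(G^u). -/

namespace HaarSystem

variable {X G : Type*} [TopologicalSpace X] [TopologicalSpace G] [T2Space G]
  [LocallyCompactSpace G] [SecondCountableTopology G] [MeasurableSpace G] [BorelSpace G]
  {𝒢 : TopGroupoid X G} (Λ : HaarSystem 𝒢)

/-- Left invariance of the Haar system: left division by `t` maps `λ^{r t}` to `λ^{s t}`. -/
theorem measurePreserving_ldiv (t : G) {u : X} (ht : 𝒢.r t = u) :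
    MeasurePreserving (𝒢.ldiv t) (Λ.measure u) (Λ.measure (𝒢.s t)) := by
  subst ht
  have hm : Measurable (𝒢.ldiv t) := 𝒢.measurable_ldiv.comp measurable_prodMk_left
  refine ⟨hm, ?_⟩
  -- Equality of the measures is tested on C_c, which requires the image measure to be finite on
  -- compacts: almost every x with t⁻¹x in K lies in the compact set tK.
  have hfin : IsFiniteMeasureOnCompacts ((Λ.measure (𝒢.r t)).map (𝒢.ldiv t)) := by
    refine ⟨fun K hK => ?_⟩
    rw [Measure.map_apply hm hK.isClosed.measurableSet]
    refine lt_of_le_of_lt ?_ ((𝒢.isCompact_mul (isCompact_singleton (x := t)) hK).measure_lt_top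
      (μ := Λ.measure (𝒢.r t)))
    refine measure_mono_ae ?_
    filter_upwards [Λ.ae_mem_fiber (𝒢.r t)] with x hx hxK
    exact 𝒢.mem_mul_of_ldiv_mem (mem_singleton t) hx.symm hxK
  refine Measure.ext_of_integral_eq_on_compactlySupported fun f => ?_
  rw [integral_map hm.aemeasurable (f := f) (by exact f.continuous.aestronglyMeasurable)]
  have h := Λ.left_invariant ⟨⟨fun x => (f x : ℂ), by fun_prop⟩,
    f.hasCompactSupport.comp_left (g := fun t : ℝ => (t : ℂ)) Complex.ofReal_zero⟩ (𝒢.inv t)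
  rw [𝒢.s_inv, 𝒢.r_inv] at h
  have h2 : ∫ x, (f (𝒢.mul (𝒢.inv t) x) : ℂ) ∂(Λ.measure (𝒢.r t))
      = ∫ x, (f x : ℂ) ∂(Λ.measure (𝒢.s t)) := h
  rw [integral_complex_ofReal, integral_complex_ofReal, Complex.ofReal_inj] at h2
  rw [← h2]
  refine integral_congr_ae ?_
  filter_upwards [Λ.ae_mem_fiber (𝒢.r t)] with x hx
  rw [𝒢.ldiv_eq hx.symm]

theorem convFun_eq (f g : G → ℂ) {u : X} {x : G} (hx : 𝒢.r x = u) :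
    Λ.convFun f g x = ∫ t, f t * g (𝒢.ldiv t x) ∂(Λ.measure u) := by
  subst hx
  refine integral_congr_ae ?_
  filter_upwards [Λ.ae_mem_fiber (𝒢.r x)] with t ht
  rw [𝒢.ldiv_eq ht]

theorem conv_apply (f g : C_c(G, ℂ)) {u : X} {x : G} (hx : 𝒢.r x = u) :
    Λ.conv f g x = ∫ t, f t * g (𝒢.ldiv t x) ∂(Λ.measure u) := Λ.convFun_eq f g hx

theorem restr_coe (u : X) (f : C_c(G, ℂ)) : Λ.restr u f =ᵐ[Λ.measure u] f :=
  MemLp.coeFn_toLp (f.continuous.memLp_of_hasCompactSupport f.hasCompactSupport)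

theorem restr_eq_of_forall (u : X) {f g : C_c(G, ℂ)} (h : ∀ x, 𝒢.r x = u → f x = g x) :
    Λ.restr u f = Λ.restr u g := by
  refine Lp.ext ?_
  filter_upwards [Λ.restr_coe u f, Λ.restr_coe u g, Λ.ae_mem_fiber u] with x h1 h2 h3
  rw [h1, h2, h x h3]

theorem norm_restr_sq (u : X) (f : C_c(G, ℂ)) :
    ‖Λ.restr u f‖ ^ 2 = ∫ x, ‖f x‖ ^ 2 ∂(Λ.measure u) := by
  rw [norm_restr, Real.sq_sqrt (integral_nonneg fun x => by positivity)]

theorem denseRange_restr (u : X) : DenseRange (Λ.restr u) := by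
  intro ξ
  rw [Metric.mem_closure_range_iff]
  intro ε hε
  obtain ⟨g, hg1, hg2, hg3, -⟩ := (Lp.memLp ξ).exists_hasCompactSupport_eLpNorm_sub_le
    (by norm_num : (2 : ℝ≥0∞) ≠ ⊤) (ε := ENNReal.ofReal (ε / 2)) (by simpa using hε)
  refine ⟨⟨⟨g, hg3⟩, hg1⟩, ?_⟩
  rw [dist_eq_norm, Lp.norm_def]
  have : eLpNorm (⇑(ξ - Λ.restr u ⟨⟨g, hg3⟩, hg1⟩)) 2 (Λ.measure u)
      = eLpNorm (⇑ξ - g) 2 (Λ.measure u) := by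
    refine eLpNorm_congr_ae ?_
    filter_upwards [Lp.coeFn_sub ξ (Λ.restr u ⟨⟨g, hg3⟩, hg1⟩),
      Λ.restr_coe u ⟨⟨g, hg3⟩, hg1⟩] with x h1 h2
    rw [h1, Pi.sub_apply, h2]
    rfl
  rw [this]
  calc (eLpNorm (⇑ξ - g) 2 (Λ.measure u)).toReal ≤ (ENNReal.ofReal (ε / 2)).toReal :=
        ENNReal.toReal_mono ENNReal.ofReal_ne_top hg2
    _ = ε / 2 := ENNReal.toReal_ofReal (by positivity)
    _ < ε := half_lt_self hε

theorem inner_restr_restr (u : X) (f g : C_c(G, ℂ)) :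
    inner ℂ (Λ.restr u f) (Λ.restr u g)
      = ∫ x, (starRingEnd ℂ) (f x) * g x ∂(Λ.measure u) := by
  rw [L2.inner_def]
  refine integral_congr_ae ?_
  filter_upwards [Λ.restr_coe u f, Λ.restr_coe u g] with x h1 h2
  rw [h1, h2, RCLike.inner_apply, mul_comm]

instance secondCountableTopology_L2 (u : X) : SecondCountableTopology (Λ.L2 u) :=
  have : Fact ((2 : ℝ≥0∞) ≠ ⊤) := ⟨by simp⟩
  inferInstance

/-- Two functions in `C_c(G)` that agree in every fibre `L²(G^u)` are equal. -/
theorem eq_of_restr_eq {f g : C_c(G, ℂ)} (h : ∀ u, Λ.restr u f = Λ.restr u g) : f = g := by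
  ext x
  have h1 : f =ᵐ[Λ.measure (𝒢.r x)] g :=
    (Λ.restr_coe _ f).symm.trans ((Filter.EventuallyEq.of_eq (congrArg (fun ξ : Λ.L2 (𝒢.r x) => (ξ : G → ℂ)) (h (𝒢.r x)))).trans
      (Λ.restr_coe _ g))
  by_contra hne
  -- The open set where f and g differ would be a neighbourhood of a point of the support, yet null.
  have hx : x ∈ (Λ.measure (𝒢.r x)).support := by rw [Λ.support_eq]; rfl
  rw [Measure.mem_support_iff_forall] at hx
  have ho : IsOpen {y | f y ≠ g y} := isOpen_ne_fun f.continuous g.continuous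
  exact (hx _ (ho.mem_nhds hne)).ne' h1

/-! ### Sections -/

/-- Evaluation of a section at a point of the unit space. -/
noncomputable def ev (u : X) : Λ.E2 →L[ℂ] Λ.L2 u :=
  LinearMap.mkContinuous
    { toFun := fun ξ => (ξ : lp (fun u => Λ.L2 u) ∞) u
      map_add' := fun _ _ => rfl
      map_smul' := fun _ _ => rfl } 1 fun ξ => by
    rw [one_mul]
    exact lp.norm_apply_le_norm ENNReal.top_ne_zero (ξ : lp (fun u => Λ.L2 u) ∞) u

theorem norm_ev_le (u : X) (ξ : Λ.E2) : ‖Λ.ev u ξ‖ ≤ ‖ξ‖ :=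
  lp.norm_apply_le_norm ENNReal.top_ne_zero (ξ : lp (fun u => Λ.L2 u) ∞) u

theorem norm_le_of_forall_ev {ξ : Λ.E2} {C : ℝ} (hC : 0 ≤ C) (h : ∀ u, ‖Λ.ev u ξ‖ ≤ C) :
    ‖ξ‖ ≤ C :=
  lp.norm_le_of_forall_le (f := (ξ : lp (fun u => Λ.L2 u) ∞)) hC h

theorem ext_ev {ξ η : Λ.E2} (h : ∀ u, Λ.ev u ξ = Λ.ev u η) : ξ = η :=
  Subtype.ext (lp.ext (funext h))

theorem ev_incl (u : X) (f : C_c(G, ℂ)) : Λ.ev u (Λ.incl f) = Λ.restr u f := rfl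

theorem isContinuousSection_ev (ξ : Λ.E2) : Λ.IsContinuousSection fun u => Λ.ev u ξ := ξ.2.1

theorem tendsto_norm_ev (ξ : Λ.E2) : Tendsto (fun u => ‖Λ.ev u ξ‖) (cocompact X) (𝓝 0) := ξ.2.2

theorem continuous_norm_ev (ξ : Λ.E2) : Continuous fun u => ‖Λ.ev u ξ‖ := by
  rw [continuous_iff_continuousAt]
  intro u₀
  rw [ContinuousAt, Metric.tendsto_nhds]
  intro ε hε
  obtain ⟨f, hf⟩ := Λ.isContinuousSection_ev ξ u₀ (ε / 3) (by positivity)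
  filter_upwards [hf, Metric.tendsto_nhds.1 ((Λ.continuous_norm_restr f).tendsto u₀) (ε / 3)
    (by positivity)] with u h1 h2
  have h0 := hf.self_of_nhds
  rw [Real.dist_eq] at h2 ⊢
  have e1 := abs_norm_sub_norm_le (Λ.ev u ξ) (Λ.restr u f)
  have e0 := abs_norm_sub_norm_le (Λ.ev u₀ ξ) (Λ.restr u₀ f)
  rw [abs_le] at e1 e0
  rw [abs_lt] at h2 ⊢
  constructor <;> linarith [e1.1, e1.2, e0.1, e0.2, h2.1, h2.2]

/-- Multiplication of a section by a bounded continuous function on the unit space. -/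
noncomputable def mulE (φ : BoundedContinuousFunction X ℝ) (ξ : Λ.E2) : Λ.E2 := by
  have hb : ∀ u, ‖(φ u : ℂ) • Λ.ev u ξ‖ ≤ ‖φ‖ * ‖Λ.ev u ξ‖ := fun u => by
    rw [norm_smul, Complex.norm_real]
    exact mul_le_mul_of_nonneg_right (φ.norm_coe_le_norm u) (norm_nonneg _)
  refine ⟨⟨fun u => (φ u : ℂ) • Λ.ev u ξ, memℓp_infty ⟨‖φ‖ * ‖ξ‖, ?_⟩⟩, ?_, ?_⟩
  · rintro _ ⟨u, rfl⟩
    exact (hb u).trans (mul_le_mul_of_nonneg_left (Λ.norm_ev_le u ξ) (norm_nonneg _))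
  · intro u₀ ε hε
    obtain ⟨f, hf⟩ := Λ.isContinuousSection_ev ξ u₀ (ε / (2 * (‖φ‖ + 1))) (by positivity)
    -- Near u₀ the function φ is replaced by the constant φ(u₀); the error |φ(u) − φ(u₀)| ‖ξ^u‖
    -- tends to 0 as u tends to u₀.
    refine ⟨(φ u₀ : ℂ) • f, ?_⟩
    have hc : Tendsto (fun u => |φ u - φ u₀| * ‖Λ.ev u ξ‖) (𝓝 u₀) (𝓝 0) := by
      have h1 : Continuous fun u => |φ u - φ u₀| * ‖Λ.ev u ξ‖ :=
        ((φ.continuous.sub continuous_const).abs).mul (Λ.continuous_norm_ev ξ)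
      simpa using h1.tendsto u₀
    filter_upwards [hf, (hc.eventually (gt_mem_nhds (half_pos hε)))] with u h1 h2
    show ‖(φ u : ℂ) • Λ.ev u ξ - Λ.restr u ((φ u₀ : ℂ) • f)‖ < ε
    have : (φ u : ℂ) • Λ.ev u ξ - Λ.restr u ((φ u₀ : ℂ) • f)
        = ((φ u - φ u₀ : ℝ) : ℂ) • Λ.ev u ξ + (φ u₀ : ℂ) • (Λ.ev u ξ - Λ.restr u f) := by
      rw [map_smul, Complex.ofReal_sub, sub_smul, smul_sub]
      abel
    rw [this]
    refine (norm_add_le _ _).trans_lt ?_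
    rw [norm_smul, norm_smul, Complex.norm_real, Complex.norm_real, Real.norm_eq_abs]
    have h3 : ‖φ u₀‖ * ‖Λ.ev u ξ - Λ.restr u f‖ ≤ ε / 2 := by
      calc _ ≤ (‖φ‖ + 1) * (ε / (2 * (‖φ‖ + 1))) := by
            gcongr
            linarith [φ.norm_coe_le_norm u₀]
        _ = ε / 2 := by field_simp
    linarith
  · refine squeeze_zero (fun _ => norm_nonneg _) hb ?_
    simpa using (Λ.tendsto_norm_ev ξ).const_mul ‖φ‖

theorem ev_mulE (φ : BoundedContinuousFunction X ℝ) (ξ : Λ.E2) (u : X) :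
    Λ.ev u (Λ.mulE φ ξ) = (φ u : ℂ) • Λ.ev u ξ := rfl

theorem restr_mulC (φ : BoundedContinuousFunction X ℝ) (f : C_c(G, ℂ)) (u : X) :
    Λ.restr u (𝒢.mulC φ f) = (φ u : ℂ) • Λ.restr u f := by
  rw [← map_smul]
  refine Λ.restr_eq_of_forall u fun x hx => ?_
  rw [𝒢.mulC_apply, hx]
  rfl

theorem incl_mulC (φ : BoundedContinuousFunction X ℝ) (f : C_c(G, ℂ)) :
    Λ.incl (𝒢.mulC φ f) = Λ.mulE φ (Λ.incl f) :=
  Λ.ext_ev fun u => by rw [ev_incl, restr_mulC, ev_mulE, ev_incl]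

/-- A family of sections that is approximable fibrewise by members of a set of families that is
stable under sums and under multiplication by functions on the unit space, is approximable in the
norm of `E²`. -/
theorem exists_norm_sub_le_of_fiberwise {ι : Type*} [Finite ι] (M : AddSubmonoid (ι → Λ.E2))
    (hM : ∀ (φ : BoundedContinuousFunction X ℝ), ∀ a ∈ M, (fun j => Λ.mulE φ (a j)) ∈ M)
    (ζ : ι → Λ.E2)
    (h : ∀ u, ∀ ε > 0, ∃ a ∈ M, ∀ j, ‖Λ.ev u (a j) - Λ.ev u (ζ j)‖ < ε) {ε : ℝ} (hε : 0 < ε) :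
    ∃ a ∈ M, ∀ j, ‖a j - ζ j‖ ≤ ε := by
  have := 𝒢.t2Space_unit
  have := 𝒢.locallyCompactSpace_unit
  have hcp : ∃ C : Set X, IsCompact C ∧ ∀ u ∉ C, ∀ j, ‖Λ.ev u (ζ j)‖ < ε := by
    have : ∀ᶠ u in cocompact X, ∀ j, ‖Λ.ev u (ζ j)‖ < ε :=
      eventually_all.2 fun j => (Λ.tendsto_norm_ev (ζ j)).eventually (gt_mem_nhds hε)
    obtain ⟨C, hC, hC2⟩ := mem_cocompact.1 this
    exact ⟨C, hC, fun u hu => hC2 hu⟩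
  obtain ⟨C, hC, hC2⟩ := hcp
  choose a haM ha using fun u => h u ε hε
  -- An approximation that is good at v stays good near v, since norms of sections are continuous
  -- and there are finitely many indices.
  let U : X → Set X := fun v => {u | ∀ j, ‖Λ.ev u (a v j) - Λ.ev u (ζ j)‖ < ε}
  have hU : ∀ v, IsOpen (U v) := fun v => by
    have : U v = ⋂ j, {u | ‖Λ.ev u (a v j - ζ j)‖ < ε} := by
      ext u; simp [U]
    rw [this]
    exact isOpen_iInter_of_finite fun j =>
      isOpen_lt (Λ.continuous_norm_ev _) continuous_const
  obtain ⟨t, ht⟩ := hC.elim_finite_subcover U hU fun u _ => mem_iUnion.2 ⟨u, ha u⟩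
  let e := t.equivFin
  obtain ⟨f, hf1, hf2, hf3, hf4⟩ := exists_continuous_sum_one_of_isOpen_isCompact
    (s := fun i => U (e.symm i)) (fun i => hU _) hC (by
      intro u hu
      obtain ⟨v, hv, hv2⟩ := mem_iUnion₂.1 (ht hu)
      exact mem_iUnion.2 ⟨e ⟨v, hv⟩, by simpa using hv2⟩)
  have hfb : ∀ i u, ‖f i u‖ ≤ 1 := fun i u => by
    rw [Real.norm_of_nonneg (hf3 i u).1]
    exact (hf3 i u).2
  let F : Fin t.card → BoundedContinuousFunction X ℝ := fun i =>
    BoundedContinuousFunction.ofNormedAddCommGroup (f i) (f i).continuous 1 (hfb i)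
  let S : X → ℝ := fun u => ∑ i, f i u
  have hS0 : ∀ u, 0 ≤ S u := fun u => Finset.sum_nonneg fun i _ => (hf3 i u).1
  have hSc : Continuous S := continuous_finsetSum _ fun i _ => (f i).continuous
  have hmax : ∀ u, 0 < max (S u) 1 := fun u => lt_max_of_lt_right one_pos
  -- The bump functions sum to 1 on C, but their sum S may exceed 1 elsewhere. Dividing by max(S, 1)
  -- leaves C unchanged. The error at u is then at most (S ε + (max(S, 1) − S) ε) / max(S, 1) = ε,
  -- the second term being present only off C, where the sections ζ are themselves smaller than ε.
  let D : BoundedContinuousFunction X ℝ :=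
    BoundedContinuousFunction.ofNormedAddCommGroup (fun u => (max (S u) 1)⁻¹)
      ((hSc.max continuous_const).inv₀ fun u => (hmax u).ne') 1 fun u => by
        rw [Real.norm_of_nonneg (by positivity)]
        exact inv_le_one_of_one_le₀ (le_max_right _ _)
  refine ⟨fun j => Λ.mulE D (∑ i, Λ.mulE (F i) (a (e.symm i) j)), hM D _ ?_, fun j => ?_⟩
  · have : (fun j => ∑ i, Λ.mulE (F i) (a (e.symm i) j))
        = ∑ i, fun j => Λ.mulE (F i) (a (e.symm i) j) := by
      funext j; rw [Finset.sum_apply]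
    rw [this]
    exact sum_mem fun i _ => hM _ _ (haM _)
  · refine Λ.norm_le_of_forall_ev hε.le fun u => ?_
    have hterm : ∀ i, ‖((f i u : ℝ) : ℂ) • (Λ.ev u (a (e.symm i) j) - Λ.ev u (ζ j))‖
        ≤ f i u * ε := fun i => by
      rw [norm_smul, Complex.norm_real, Real.norm_of_nonneg (hf3 i u).1]
      by_cases hu : u ∈ U (e.symm i)
      · exact mul_le_mul_of_nonneg_left (hu j).le (hf3 i u).1
      · rw [image_eq_zero_of_notMem_tsupport fun h => hu (hf1 i h)]
        simp
    have hsum : ‖∑ i, ((f i u : ℝ) : ℂ) • (Λ.ev u (a (e.symm i) j) - Λ.ev u (ζ j))‖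
        ≤ S u * ε := by
      rw [Finset.sum_mul]
      exact norm_sum_le_of_le _ fun i _ => hterm i
    have hev : Λ.ev u (Λ.mulE D (∑ i, Λ.mulE (F i) (a (e.symm i) j)) - ζ j)
        = (((max (S u) 1)⁻¹ : ℝ) : ℂ) •
            (∑ i, ((f i u : ℝ) : ℂ) • (Λ.ev u (a (e.symm i) j) - Λ.ev u (ζ j))
              + ((S u - max (S u) 1 : ℝ) : ℂ) • Λ.ev u (ζ j)) := by
      have h1 : ((max (S u) 1 : ℝ) : ℂ) ≠ 0 := by exact_mod_cast (hmax u).ne'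
      rw [map_sub, ev_mulE, map_sum]
      simp only [ev_mulE, smul_sub, Finset.sum_sub_distrib, ← Finset.sum_smul]
      have h2 : (∑ i, ((f i u : ℝ) : ℂ)) = ((S u : ℝ) : ℂ) := by simp [S]
      rw [h2, Complex.ofReal_sub, sub_smul, Complex.ofReal_inv]
      have h3 : ∀ x : Λ.L2 u, x = ((max (S u) 1 : ℝ) : ℂ)⁻¹ • ((max (S u) 1 : ℝ) : ℂ) • x :=
        fun x => by rw [smul_smul, inv_mul_cancel₀ h1, one_smul]
      conv_lhs => rw [h3 (Λ.ev u (ζ j))]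
      show ((((max (S u) 1)⁻¹ : ℝ) : ℂ)) • (∑ i, ((f i u : ℝ) : ℂ) • Λ.ev u (a (e.symm i) j)) - _ = _
      rw [Complex.ofReal_inv, ← smul_sub]
      congr 1
      abel
    rw [hev, norm_smul, Complex.norm_real, Real.norm_of_nonneg (inv_nonneg.2 (hmax u).le),
      inv_mul_le_iff₀ (hmax u)]
    refine (norm_add_le _ _).trans ?_
    rw [norm_smul, Complex.norm_real, Real.norm_eq_abs, abs_sub_comm,
      abs_of_nonneg (sub_nonneg.2 (le_max_left _ _))]
    have h4 : (max (S u) 1 - S u) * ‖Λ.ev u (ζ j)‖ ≤ (max (S u) 1 - S u) * ε := by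
      by_cases hu : u ∈ C
      · have : S u = 1 := by simpa [S] using hf2 hu
        simp [this]
      · exact mul_le_mul_of_nonneg_left (hC2 u hu j).le (sub_nonneg.2 (le_max_left _ _))
    linarith

/-- C_c(G) is dense in every fibre and stable under multiplication by functions on the unit space,
so fibrewise approximation globalises; the family here has a single member. -/
theorem denseRange_incl : DenseRange Λ.incl := by
  intro ξ
  rw [Metric.mem_closure_range_iff]
  intro ε hε
  let M : AddSubmonoid (Unit → Λ.E2) :=
    { carrier := {a | ∃ f, a = fun _ => Λ.incl f}
      zero_mem' := ⟨0, by rw [map_zero]; rfl⟩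
      add_mem' := by
        rintro _ _ ⟨f, rfl⟩ ⟨g, rfl⟩
        exact ⟨f + g, by rw [map_add]; rfl⟩ }
  obtain ⟨_, ⟨f, rfl⟩, hf⟩ := Λ.exists_norm_sub_le_of_fiberwise M
    (by
      rintro φ _ ⟨f, rfl⟩
      exact ⟨𝒢.mulC φ f, by rw [Λ.incl_mulC]⟩) (fun _ => ξ)
    (fun u δ hδ => by
      obtain ⟨f, hf⟩ := Metric.mem_closure_range_iff.1 (Λ.denseRange_restr u (Λ.ev u ξ)) δ hδ
      refine ⟨_, ⟨f, rfl⟩, fun _ => ?_⟩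
      rw [dist_comm, dist_eq_norm] at hf
      exact hf) (half_pos hε)
  refine ⟨f, ?_⟩
  rw [dist_comm, dist_eq_norm]
  exact (hf ()).trans_lt (half_lt_self hε)

end HaarSystem

namespace HaarSystem

variable {X G : Type*} [TopologicalSpace X] [TopologicalSpace G] [T2Space G]
  [LocallyCompactSpace G] [SecondCountableTopology G] [MeasurableSpace G] [BorelSpace G]
  {𝒢 : TopGroupoid X G} (Λ : HaarSystem 𝒢)

/-! ### Left translations between the fibres -/

open Classical in
/-- Left translation `L²(G^v) → L²(G^u)` by `t`, if `r t = u` and `s t = v`. -/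
noncomputable def V (u v : X) (t : G) : Λ.L2 v →L[ℂ] Λ.L2 u :=
  if h : 𝒢.r t = u ∧ 𝒢.s t = v then
    (Lp.compMeasurePreservingₗᵢ ℂ (𝒢.ldiv t)
      (h.2 ▸ Λ.measurePreserving_ldiv t h.1 :
        MeasurePreserving (𝒢.ldiv t) (Λ.measure u) (Λ.measure v))).toContinuousLinearMap
  else 0

theorem norm_V_apply {u v : X} {t : G} (hr : 𝒢.r t = u) (hs : 𝒢.s t = v) (ξ : Λ.L2 v) :
    ‖Λ.V u v t ξ‖ = ‖ξ‖ := by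
  rw [V, dif_pos ⟨hr, hs⟩]
  exact LinearIsometry.norm_map _ ξ

theorem norm_V_apply_le (u v : X) (t : G) (ξ : Λ.L2 v) : ‖Λ.V u v t ξ‖ ≤ ‖ξ‖ := by
  by_cases h : 𝒢.r t = u ∧ 𝒢.s t = v
  · exact (Λ.norm_V_apply h.1 h.2 ξ).le
  · rw [V, dif_neg h]
    simp

theorem V_coe {u v : X} {t : G} (hr : 𝒢.r t = u) (hs : 𝒢.s t = v) (ξ : Λ.L2 v) :
    Λ.V u v t ξ =ᵐ[Λ.measure u] fun x => ξ (𝒢.ldiv t x) := by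
  rw [V, dif_pos ⟨hr, hs⟩]
  exact Lp.coeFn_compMeasurePreserving ξ _

theorem V_restr_coe {u v : X} {t : G} (hr : 𝒢.r t = u) (hs : 𝒢.s t = v) (f : C_c(G, ℂ)) :
    Λ.V u v t (Λ.restr v f) =ᵐ[Λ.measure u] fun x => f (𝒢.ldiv t x) := by
  subst hs
  exact (Λ.V_coe hr rfl _).trans
    ((Λ.measurePreserving_ldiv t hr).quasiMeasurePreserving.ae_eq_comp (Λ.restr_coe _ f))

theorem V_restr_eq {u v : X} {t : G} (hr : 𝒢.r t = u) (hs : 𝒢.s t = v) {f f' : C_c(G, ℂ)}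
    (h : ∀ x, 𝒢.r x = u → f' x = f (𝒢.ldiv t x)) :
    Λ.V u v t (Λ.restr v f) = Λ.restr u f' := by
  refine Lp.ext ?_
  filter_upwards [Λ.V_restr_coe hr hs f, Λ.restr_coe u f', Λ.ae_mem_fiber u] with x h1 h2 h3
  rw [h1, h2, h x h3]

theorem _root_.TopGroupoid.exists_translate (𝒢 : TopGroupoid X G) (f : C_c(G, ℂ)) (t : G) :
    ∃ f' : C_c(G, ℂ), ∀ x, 𝒢.r t = 𝒢.r x → f' x = f (𝒢.ldiv t x) := by
  obtain ⟨Ψ, K, hK, h0, h1⟩ := 𝒢.exists_extension f (isCompact_singleton (x := t))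
  exact ⟨⟨⟨fun x => Ψ (t, x), by fun_prop⟩, HasCompactSupport.intro hK fun x hx => h0 t x hx⟩,
    fun x hx => h1 t (mem_singleton t) x hx⟩

theorem V_V {u v w : X} {γ t : G} (hγr : 𝒢.r γ = u) (hγs : 𝒢.s γ = v) (hr : 𝒢.r t = v)
    (hs : 𝒢.s t = w) (ξ : Λ.L2 w) :
    Λ.V u v γ (Λ.V v w t ξ) = Λ.V u w (𝒢.mul γ t) ξ := by
  have hc : 𝒢.s γ = 𝒢.r t := hγs.trans hr.symm
  refine Lp.ext ?_
  have h1 : MeasurePreserving (𝒢.ldiv γ) (Λ.measure u) (Λ.measure v) :=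
    hγs ▸ Λ.measurePreserving_ldiv γ hγr
  filter_upwards [Λ.V_coe hγr hγs (Λ.V v w t ξ), Λ.V_coe (t := 𝒢.mul γ t) (u := u) (v := w)
    (by rw [𝒢.r_mul _ _ hc, hγr]) (by rw [𝒢.s_mul _ _ hc, hs]) ξ,
    h1.quasiMeasurePreserving.ae_eq_comp (Λ.V_coe hr hs ξ), Λ.ae_mem_fiber u] with x e1 e2 e3 e4
  rw [e1, e2]
  refine Eq.trans e3 ?_
  show ξ (𝒢.ldiv t (𝒢.ldiv γ x)) = _
  rw [𝒢.ldiv_mul_left hc (hγr.trans e4.symm)]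

theorem V_unit (u : X) (ξ : Λ.L2 u) : Λ.V u u (𝒢.unit u) ξ = ξ := by
  refine Lp.ext ?_
  filter_upwards [Λ.V_coe (𝒢.r_unit u) (𝒢.s_unit u) ξ, Λ.ae_mem_fiber u] with x h1 h2
  have h3 : 𝒢.ldiv (𝒢.unit u) x = x := by
    rw [← h2]
    exact 𝒢.ldiv_unit x
  rw [h1, h3]

/-- The translate `t · ξ^{s t}` in `L²(G^u)` of a section `ξ`, for `t ∈ G^u`. -/
noncomputable def trans (u : X) (t : G) : Λ.E2 →L[ℂ] Λ.L2 u :=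
  Λ.V u (𝒢.s t) t ∘L Λ.ev (𝒢.s t)

theorem trans_apply (u : X) (t : G) (ξ : Λ.E2) :
    Λ.trans u t ξ = Λ.V u (𝒢.s t) t (Λ.ev (𝒢.s t) ξ) := rfl

theorem norm_trans_apply_le (u : X) (t : G) (ξ : Λ.E2) : ‖Λ.trans u t ξ‖ ≤ ‖ξ‖ :=
  (Λ.norm_V_apply_le _ _ _ _).trans (Λ.norm_ev_le _ _)

theorem norm_trans_apply {u : X} {t : G} (ht : 𝒢.r t = u) (ξ : Λ.E2) :
    ‖Λ.trans u t ξ‖ = ‖Λ.ev (𝒢.s t) ξ‖ :=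
  Λ.norm_V_apply ht rfl _

theorem V_trans {u v : X} {γ t : G} (hγr : 𝒢.r γ = u) (hγs : 𝒢.s γ = v) (hr : 𝒢.r t = v)
    (ξ : Λ.E2) : Λ.V u v γ (Λ.trans v t ξ) = Λ.trans u (𝒢.mul γ t) ξ := by
  have hs : 𝒢.s (𝒢.mul γ t) = 𝒢.s t := 𝒢.s_mul _ _ (hγs.trans hr.symm)
  rw [trans_apply, trans_apply, Λ.V_V hγr hγs hr rfl, hs]

theorem inner_restr_trans {u : X} {t : G} (ht : 𝒢.r t = u) (k f : C_c(G, ℂ)) :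
    inner ℂ (Λ.restr u k) (Λ.trans u t (Λ.incl f))
      = ∫ x, (starRingEnd ℂ) (k x) * f (𝒢.ldiv t x) ∂(Λ.measure u) := by
  rw [L2.inner_def]
  refine integral_congr_ae ?_
  filter_upwards [Λ.restr_coe u k, Λ.V_restr_coe ht rfl f] with x h1 h2
  rw [h1, RCLike.inner_apply, mul_comm]
  congr 1

/-- For t in a compact neighbourhood of t₀ the translates are restrictions of one jointly continuous
kernel with a common compact support, so the norm of their difference is the root of an integral
depending continuously on t. -/
theorem continuousOn_trans_incl (u : X) (f : C_c(G, ℂ)) :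
    ContinuousOn (fun t => Λ.trans u t (Λ.incl f)) {t | 𝒢.r t = u} := by
  intro t₀ ht₀
  obtain ⟨W, hW, hWt⟩ := exists_compact_mem_nhds t₀
  obtain ⟨Ψ, K, hK, h0, h1⟩ := 𝒢.exists_extension f hW
  let Θ : G → C_c(G, ℂ) := fun t =>
    ⟨⟨fun x => Ψ (t, x), by fun_prop⟩, HasCompactSupport.intro hK fun x hx => h0 t x hx⟩
  have hΘ : ∀ t ∈ W, 𝒢.r t = u → Λ.trans u t (Λ.incl f) = Λ.restr u (Θ t) := fun t ht hr =>
    Λ.V_restr_eq hr rfl fun x hx => h1 t ht x (hr.trans hx.symm)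
  have hn : Continuous fun t => ‖Λ.restr u (Θ t) - Λ.restr u (Θ t₀)‖ := by
    have : (fun t => ‖Λ.restr u (Θ t) - Λ.restr u (Θ t₀)‖)
        = fun t => √(∫ x in K, ‖Ψ (t, x) - Ψ (t₀, x)‖ ^ 2 ∂(Λ.measure u)) := by
      funext t
      rw [← map_sub, norm_restr]
      congr 1
      symm
      refine setIntegral_eq_integral_of_forall_compl_eq_zero fun x hx => ?_
      rw [h0 t x hx, h0 t₀ x hx]
      simp
    rw [this]
    refine Real.continuous_sqrt.comp ?_
    exact continuous_parametric_integral_of_continuous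
      (f := fun t x => ‖Ψ (t, x) - Ψ (t₀, x)‖ ^ 2) (by fun_prop) hK
  rw [ContinuousWithinAt, tendsto_iff_norm_sub_tendsto_zero]
  have h2 := (hn.tendsto t₀).mono_left (nhdsWithin_le_nhds (s := {t | 𝒢.r t = u}))
  simp only [sub_self, norm_zero] at h2
  refine h2.congr' ?_
  filter_upwards [mem_nhdsWithin_of_mem_nhds hWt, self_mem_nhdsWithin] with t ht hr
  rw [hΘ t ht hr, hΘ t₀ (mem_of_mem_nhds hWt) ht₀]

theorem continuousOn_trans (u : X) (ξ : Λ.E2) :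
    ContinuousOn (fun t => Λ.trans u t ξ) {t | 𝒢.r t = u} := by
  refine continuousOn_of_uniform_approx_of_continuousOn fun U hU => ?_
  obtain ⟨ε, hε, hεU⟩ := Metric.mem_uniformity_dist.1 hU
  obtain ⟨f, hf⟩ := Metric.mem_closure_range_iff.1 (Λ.denseRange_incl ξ) ε hε
  refine ⟨_, Λ.continuousOn_trans_incl u f, fun t _ => hεU ?_⟩
  rw [dist_eq_norm, ← map_sub]
  rw [dist_eq_norm] at hf
  exact (Λ.norm_trans_apply_le _ _ _).trans_lt hf

theorem restrict_fiber (u : X) : (Λ.measure u).restrict {x | 𝒢.r x = u} = Λ.measure u :=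
  Measure.restrict_eq_self_of_ae_mem (Λ.ae_mem_fiber u)

theorem aestronglyMeasurable_trans (u : X) (ξ : Λ.E2) :
    AEStronglyMeasurable (fun t => Λ.trans u t ξ) (Λ.measure u) := by
  have h := (Λ.continuousOn_trans u ξ).aestronglyMeasurable (μ := Λ.measure u)
    (𝒢.isClosed_fiber u).measurableSet
  exact h.mono_measure (Λ.restrict_fiber u).ge

theorem integrable_smul_trans (u : X) (F : C_c(G, ℂ)) (ξ : Λ.E2) :
    Integrable (fun t => F t • Λ.trans u t ξ) (Λ.measure u) := by
  refine Integrable.mono' (g := fun t => ‖F t‖ * ‖ξ‖) ?_ ?_ ?_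
  · exact ((F.continuous.integrable_of_hasCompactSupport F.hasCompactSupport).norm).mul_const _
  · exact F.continuous.aestronglyMeasurable.smul (Λ.aestronglyMeasurable_trans u ξ)
  · refine Eventually.of_forall fun t => ?_
    rw [norm_smul]
    exact mul_le_mul_of_nonneg_left (Λ.norm_trans_apply_le _ _ _) (norm_nonneg _)

/-! ### Convolution as a vector-valued integral -/

theorem integrable_kernel (u : X) (a b : C_c(G, ℂ)) {g : G × G → ℂ} (hg : Measurable g) {c : ℝ}
    (hc : ∀ p, ‖g p‖ ≤ c) :
    Integrable (fun p : G × G => a p.1 * b p.2 * g p) ((Λ.measure u).prod (Λ.measure u)) :=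
  ((a.continuous.integrable_of_hasCompactSupport a.hasCompactSupport).mul_prod
    (b.continuous.integrable_of_hasCompactSupport b.hasCompactSupport)).mul_bdd
    hg.aestronglyMeasurable (Eventually.of_forall hc)

theorem integrable_kernel_ldiv (u : X) (a b g : C_c(G, ℂ)) :
    Integrable (fun p : G × G => a p.1 * b p.2 * g (𝒢.ldiv p.1 p.2))
      ((Λ.measure u).prod (Λ.measure u)) := by
  obtain ⟨c, hc⟩ := g.hasCompactSupport.exists_bound_of_continuous g.continuous
  exact Λ.integrable_kernel u a b (g.continuous.measurable.comp 𝒢.measurable_ldiv) fun p => hc _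

/-- Complex conjugation on `C_c(G)`. -/
noncomputable def _root_.CompactlySupportedContinuousMap.conj (f : C_c(G, ℂ)) : C_c(G, ℂ) where
  toFun x := (starRingEnd ℂ) (f x)
  continuous_toFun := by fun_prop
  hasCompactSupport' := f.hasCompactSupport.comp_left (map_zero _)

theorem inner_restr_conv (u : X) (k f g : C_c(G, ℂ)) :
    inner ℂ (Λ.restr u k) (Λ.restr u (Λ.conv f g))
      = ∫ t, ∫ x, f t * (starRingEnd ℂ) (k x) * g (𝒢.ldiv t x) ∂(Λ.measure u) ∂(Λ.measure u) := by
  rw [integral_integral_swap (Λ.integrable_kernel_ldiv u f k.conj g), inner_restr_restr]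
  refine integral_congr_ae ?_
  filter_upwards [Λ.ae_mem_fiber u] with x hx
  rw [Λ.conv_apply f g hx, ← integral_const_mul]
  congr 1
  funext t
  ring

theorem eq_of_inner_restr {u : X} {a b : Λ.L2 u}
    (h : ∀ k, inner ℂ (Λ.restr u k) a = inner ℂ (Λ.restr u k) b) : a = b := by
  refine ext_inner_left ℂ fun v => ?_
  exact congrFun ((Λ.denseRange_restr u).equalizer
    (show Continuous fun v : Λ.L2 u => inner ℂ v a by fun_prop)
    (show Continuous fun v : Λ.L2 u => inner ℂ v b by fun_prop) (funext h)) v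

/-- Tested against the dense set of vectors from C_c(G), this is Fubini. Boundedness of left
convolution, its extension to E² and associativity are all read off from this formula. -/
theorem restr_conv_eq_integral (u : X) (F f : C_c(G, ℂ)) :
    Λ.restr u (Λ.conv F f) = ∫ t, F t • Λ.trans u t (Λ.incl f) ∂(Λ.measure u) := by
  refine Λ.eq_of_inner_restr fun k => ?_
  rw [inner_restr_conv, ← integral_inner (Λ.integrable_smul_trans u F _)]
  refine integral_congr_ae ?_
  filter_upwards [Λ.ae_mem_fiber u] with t ht
  rw [inner_smul_right, Λ.inner_restr_trans ht, ← integral_const_mul]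
  simp only [mul_assoc]

theorem integral_norm_le_normIr (F : C_c(G, ℂ)) (u : X) :
    ∫ x, ‖F x‖ ∂(Λ.measure u) ≤ Λ.normIr F :=
  le_ciSup (Λ.bddAbove_normIr F) u

theorem normIr_nonneg (F : C_c(G, ℂ)) : 0 ≤ Λ.normIr F :=
  Real.iSup_nonneg fun _ => integral_nonneg fun _ => norm_nonneg _

theorem norm_integral_smul_trans_le (u : X) (F : C_c(G, ℂ)) (ξ : Λ.E2) :
    ‖∫ t, F t • Λ.trans u t ξ ∂(Λ.measure u)‖ ≤ Λ.normIr F * ‖ξ‖ := by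
  calc ‖∫ t, F t • Λ.trans u t ξ ∂(Λ.measure u)‖
      ≤ ∫ t, ‖F t‖ * ‖ξ‖ ∂(Λ.measure u) := by
        refine norm_integral_le_of_norm_le ?_ (Eventually.of_forall fun t => ?_)
        · exact ((F.continuous.integrable_of_hasCompactSupport
            F.hasCompactSupport).norm).mul_const _
        · rw [norm_smul]
          exact mul_le_mul_of_nonneg_left (Λ.norm_trans_apply_le _ _ _) (norm_nonneg _)
    _ = (∫ t, ‖F t‖ ∂(Λ.measure u)) * ‖ξ‖ := integral_mul_const _ _
    _ ≤ _ := mul_le_mul_of_nonneg_right (Λ.integral_norm_le_normIr F u) (norm_nonneg _)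

theorem norm_incl_conv_le (F f : C_c(G, ℂ)) :
    ‖Λ.incl (Λ.conv F f)‖ ≤ Λ.normIr F * ‖Λ.incl f‖ := by
  refine Λ.norm_le_of_forall_ev (mul_nonneg (Λ.normIr_nonneg F) (norm_nonneg _)) fun u => ?_
  rw [ev_incl, restr_conv_eq_integral]
  exact Λ.norm_integral_smul_trans_le u F _

theorem L_incl (F f : C_c(G, ℂ)) : Λ.L F (Λ.incl f) = Λ.incl (Λ.conv F f) :=
  LinearMap.extendOfNorm_eq (f := Λ.incl ∘ₗ Λ.convBilin F) Λ.denseRange_incl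
    ⟨_, Λ.norm_incl_conv_le F⟩ f

theorem norm_L_le (F : C_c(G, ℂ)) : ‖Λ.L F‖ ≤ Λ.normIr F :=
  LinearMap.opNorm_extendOfNorm_le (f := Λ.incl ∘ₗ Λ.convBilin F) Λ.denseRange_incl
    (Λ.normIr_nonneg F) (Λ.norm_incl_conv_le F)

theorem eq_of_incl {T S : Λ.E2 →L[ℂ] Λ.E2} (h : ∀ f, T (Λ.incl f) = S (Λ.incl f)) : T = S :=
  ContinuousLinearMap.ext fun ξ => congrFun
    (Λ.denseRange_incl.equalizer T.continuous S.continuous (funext h)) ξ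

/-- Both (L_F ξ)^u and ∫ F(t) t·ξ^{s(t)} dλ^u(t) are continuous in ξ, with norms controlled by
‖F‖_{I,r} ‖ξ‖, so their equality passes from C_c(G) to E². The scalar form lends itself to changes
of variable. -/
theorem inner_L (u : X) (k : Λ.L2 u) (F : C_c(G, ℂ)) (ξ : Λ.E2) :
    inner ℂ k (Λ.ev u (Λ.L F ξ)) = ∫ t, F t * inner ℂ k (Λ.trans u t ξ) ∂(Λ.measure u) := by
  have hev : Λ.ev u (Λ.L F ξ) = ∫ t, F t • Λ.trans u t ξ ∂(Λ.measure u) := by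
    have hint := fun ξ => Λ.integrable_smul_trans u F ξ
    let A : Λ.E2 →L[ℂ] Λ.L2 u := LinearMap.mkContinuous
      { toFun := fun ξ => ∫ t, F t • Λ.trans u t ξ ∂(Λ.measure u)
        map_add' := fun ξ η => by
          simp only [map_add, smul_add]
          exact integral_add (hint ξ) (hint η)
        map_smul' := fun c ξ => by
          simp only [map_smul, RingHom.id_apply]
          rw [← integral_smul]
          congr 1
          funext t
          rw [smul_comm] } (Λ.normIr F) fun ξ => Λ.norm_integral_smul_trans_le u F ξ
    refine congrFun (Λ.denseRange_incl.equalizer (Λ.ev u ∘L Λ.L F).continuous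
      A.continuous (funext fun f => ?_)) ξ
    show Λ.ev u (Λ.L F (Λ.incl f)) = ∫ t, F t • Λ.trans u t (Λ.incl f) ∂(Λ.measure u)
    rw [L_incl, ev_incl, restr_conv_eq_integral]
  rw [hev, ← integral_inner (Λ.integrable_smul_trans u F _)]
  simp only [inner_smul_right]

/-! ### Right convolution -/

/-- The involution `F^*(x) = conj F(x⁻¹)` on `C_c(G)`. -/
noncomputable def _root_.TopGroupoid.invol (𝒢 : TopGroupoid X G) (F : C_c(G, ℂ)) :
    C_c(G, ℂ) where
  toFun x := (starRingEnd ℂ) (F (𝒢.inv x))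
  continuous_toFun := by
    have := 𝒢.continuous_inv
    fun_prop
  hasCompactSupport' := by
    let e : G ≃ₜ G := ⟨⟨𝒢.inv, 𝒢.inv, 𝒢.inv_inv, 𝒢.inv_inv⟩, 𝒢.continuous_inv, 𝒢.continuous_inv⟩
    exact (F.hasCompactSupport.comp_homeomorph e).comp_left (g := starRingEnd ℂ) (map_zero _)

theorem invol_apply (F : C_c(G, ℂ)) (x : G) :
    𝒢.invol F x = (starRingEnd ℂ) (F (𝒢.inv x)) := rfl

theorem invol_ldiv (F : C_c(G, ℂ)) {t x : G} (h : 𝒢.r t = 𝒢.r x) :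
    𝒢.invol F (𝒢.ldiv t x) = (starRingEnd ℂ) (F (𝒢.ldiv x t)) := by
  rw [invol_apply, 𝒢.inv_ldiv h]

theorem invol_invol (F : C_c(G, ℂ)) : 𝒢.invol (𝒢.invol F) = F := by
  ext x
  rw [invol_apply, invol_apply, 𝒢.inv_inv, Complex.conj_conj]

theorem integral_norm_ldiv_le (F : C_c(G, ℂ)) {u : X} {t : G} (ht : 𝒢.r t = u) :
    ∫ x, ‖F (𝒢.ldiv t x)‖ ∂(Λ.measure u) ≤ Λ.normIr F := by
  have h := (Λ.measurePreserving_ldiv t ht).map_eq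
  have h2 : ∫ x, ‖F (𝒢.ldiv t x)‖ ∂(Λ.measure u) = ∫ y, ‖F y‖ ∂(Λ.measure (𝒢.s t)) := by
    rw [← h, integral_map (Λ.measurePreserving_ldiv t ht).aemeasurable
      (by exact (F.continuous.norm).aestronglyMeasurable)]
  rw [h2]
  exact Λ.integral_norm_le_normIr F _

/-- A bound for the norm of right convolution by `F`. -/
noncomputable def rBound (F : C_c(G, ℂ)) : ℝ := Λ.normIr F + Λ.normIr (𝒢.invol F) + 1

theorem rBound_pos (F : C_c(G, ℂ)) : 0 < Λ.rBound F := by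
  have := Λ.normIr_nonneg F
  have := Λ.normIr_nonneg (𝒢.invol F)
  unfold rBound
  positivity

theorem ae_prod_fiber (u : X) :
    ∀ᵐ p ∂((Λ.measure u).prod (Λ.measure u)), 𝒢.r p.1 = u ∧ 𝒢.r p.2 = u := by
  have h1 : ∀ᵐ p ∂((Λ.measure u).prod (Λ.measure u)), 𝒢.r p.1 = u :=
    Measure.quasiMeasurePreserving_fst.ae (Λ.ae_mem_fiber u)
  have h2 : ∀ᵐ p ∂((Λ.measure u).prod (Λ.measure u)), 𝒢.r p.2 = u :=
    Measure.quasiMeasurePreserving_snd.ae (Λ.ae_mem_fiber u)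
  filter_upwards [h1, h2] with p e1 e2 using ⟨e1, e2⟩

theorem integrable_ldiv (F : C_c(G, ℂ)) {u : X} {t : G} (ht : 𝒢.r t = u) :
    Integrable (fun x => F (𝒢.ldiv t x)) (Λ.measure u) :=
  (Λ.measurePreserving_ldiv t ht).integrable_comp_of_integrable
    (F.continuous.integrable_of_hasCompactSupport F.hasCompactSupport)

theorem integrable_schur (u : X) (F : C_c(G, ℂ)) {q χ : G → ℝ}
    (hq : Integrable q (Λ.measure u)) (hχ : Integrable χ (Λ.measure u)) :
    Integrable (fun p : G × G => q p.1 * χ p.2 * ‖F (𝒢.ldiv p.1 p.2)‖)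
      ((Λ.measure u).prod (Λ.measure u)) := by
  obtain ⟨c, hc⟩ := F.hasCompactSupport.exists_bound_of_continuous F.continuous
  exact (hq.mul_prod hχ).mul_bdd
    ((F.continuous.measurable.comp 𝒢.measurable_ldiv).norm).aestronglyMeasurable
    (Eventually.of_forall fun p => by rw [norm_norm]; exact hc _)

/-- Integrating in x first, left invariance turns ∫ |F(t⁻¹x)| dλ^u(x) into an integral of |F| over
the fibre at s(t), at most ‖F‖_{I,r}. The factor χ ≤ 1 is dropped at that stage; it is there to make
the integrand integrable on the product. -/
theorem integral_schur_le (u : X) (F : C_c(G, ℂ)) {q χ : G → ℝ}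
    (hq : Integrable q (Λ.measure u)) (hχ : Integrable χ (Λ.measure u)) (hq0 : ∀ x, 0 ≤ q x)
    (hχ0 : ∀ x, 0 ≤ χ x) (hχ1 : ∀ x, χ x ≤ 1) :
    ∫ p, q p.1 * χ p.2 * ‖F (𝒢.ldiv p.1 p.2)‖ ∂((Λ.measure u).prod (Λ.measure u))
      ≤ Λ.normIr F * ∫ x, q x ∂(Λ.measure u) := by
  have hi := Λ.integrable_schur u F hq hχ
  rw [integral_prod _ hi, ← integral_const_mul]
  refine integral_mono_ae hi.integral_prod_left (hq.const_mul _) ?_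
  filter_upwards [Λ.ae_mem_fiber u] with t ht
  calc ∫ x, q t * χ x * ‖F (𝒢.ldiv t x)‖ ∂(Λ.measure u)
      ≤ ∫ x, q t * ‖F (𝒢.ldiv t x)‖ ∂(Λ.measure u) := by
        refine integral_mono_of_nonneg (Eventually.of_forall fun x => ?_)
          ((Λ.integrable_ldiv F ht).norm.const_mul _) (Eventually.of_forall fun x => ?_)
        · exact mul_nonneg (mul_nonneg (hq0 t) (hχ0 x)) (norm_nonneg _)
        · exact mul_le_mul_of_nonneg_right (mul_le_of_le_one_right (hq0 t) (hχ1 x))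
            (norm_nonneg _)
    _ = q t * ∫ x, ‖F (𝒢.ldiv t x)‖ ∂(Λ.measure u) := integral_const_mul _ _
    _ ≤ q t * Λ.normIr F := mul_le_mul_of_nonneg_left (Λ.integral_norm_ldiv_le F ht) (hq0 t)
    _ = Λ.normIr F * q t := mul_comm _ _

/-- Since (t⁻¹x)⁻¹ = x⁻¹t, exchanging the variables replaces F by F^*. This is how the second Schur
bound comes to involve the (I,r)-norm of F^*. -/
theorem schur_swap (u : X) (F : C_c(G, ℂ)) (q χ : G → ℝ) :
    (fun p : G × G => χ p.1 * q p.2 * ‖F (𝒢.ldiv p.1 p.2)‖)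
      =ᵐ[(Λ.measure u).prod (Λ.measure u)]
      (fun p : G × G => q p.1 * χ p.2 * ‖𝒢.invol F (𝒢.ldiv p.1 p.2)‖) ∘ Prod.swap := by
  filter_upwards [Λ.ae_prod_fiber u] with p hp
  simp only [Function.comp_apply, Prod.fst_swap, Prod.snd_swap]
  rw [invol_ldiv F (hp.2.trans hp.1.symm), RCLike.norm_conj]
  ring

theorem integral_schur_left_le (u : X) (F : C_c(G, ℂ)) {q χ : G → ℝ}
    (hq : Integrable q (Λ.measure u)) (hχ : Integrable χ (Λ.measure u)) (hq0 : ∀ x, 0 ≤ q x)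
    (hχ0 : ∀ x, 0 ≤ χ x) (hχ1 : ∀ x, χ x ≤ 1) :
    ∫ p, χ p.1 * q p.2 * ‖F (𝒢.ldiv p.1 p.2)‖ ∂((Λ.measure u).prod (Λ.measure u))
      ≤ Λ.normIr (𝒢.invol F) * ∫ x, q x ∂(Λ.measure u) := by
  rw [integral_congr_ae (Λ.schur_swap u F q χ)]
  refine le_trans (le_of_eq ?_) (Λ.integral_schur_le u (𝒢.invol F) hq hχ hq0 hχ0 hχ1)
  exact integral_prod_swap
    (fun p : G × G => q p.1 * χ p.2 * ‖𝒢.invol F (𝒢.ldiv p.1 p.2)‖)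

theorem integrable_sq (u : X) (g : C_c(G, ℂ)) :
    Integrable (fun x => ‖g x‖ ^ 2) (Λ.measure u) :=
  Continuous.integrable_of_hasCompactSupport (by fun_prop)
    (g.hasCompactSupport.comp_left (g := fun z : ℂ => ‖z‖ ^ 2) (by simp))

/-- The Schur test for right convolution. -/
theorem norm_inner_restr_conv_le (u : X) (k f F : C_c(G, ℂ)) {a : ℝ} (ha : 0 < a) :
    ‖inner ℂ (Λ.restr u k) (Λ.restr u (Λ.conv f F))‖
      ≤ Λ.rBound F / 2 * (a * ‖Λ.restr u k‖ ^ 2 + a⁻¹ * ‖Λ.restr u f‖ ^ 2) := by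
  -- A cut-off equal to 1 on both supports: λ^u may be infinite, so |k|² ⊗ 1 has to be localised.
  obtain ⟨χ, hχ1, -, hχc, hχI⟩ := exists_continuous_one_zero_of_isCompact
    (f.hasCompactSupport.isCompact.union k.hasCompactSupport.isCompact)
    isClosed_empty (disjoint_empty _)
  have hχi : Integrable (fun x => χ x) (Λ.measure u) :=
    χ.continuous.integrable_of_hasCompactSupport hχc
  have i1 : Integrable (fun p : G × G => χ p.1 * ‖k p.2‖ ^ 2 * ‖F (𝒢.ldiv p.1 p.2)‖)
      ((Λ.measure u).prod (Λ.measure u)) := Λ.integrable_schur u F hχi (Λ.integrable_sq u k)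
  have i2 : Integrable (fun p : G × G => ‖f p.1‖ ^ 2 * χ p.2 * ‖F (𝒢.ldiv p.1 p.2)‖)
      ((Λ.measure u).prod (Λ.measure u)) := Λ.integrable_schur u F (Λ.integrable_sq u f) hχi
  have b1 := Λ.integral_schur_left_le u F (Λ.integrable_sq u k) hχi (fun x => by positivity)
    (fun x => (hχI x).1) (fun x => (hχI x).2)
  have b2 := Λ.integral_schur_le u F (Λ.integrable_sq u f) hχi (fun x => by positivity)
    (fun x => (hχI x).1) (fun x => (hχI x).2)
  rw [← norm_restr_sq] at b1 b2
  rw [inner_restr_conv, integral_integral (Λ.integrable_kernel_ldiv u f k.conj F)]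
  have hle : ∀ p : G × G, ‖f p.1 * k.conj p.2 * F (𝒢.ldiv p.1 p.2)‖
      ≤ a / 2 * (χ p.1 * ‖k p.2‖ ^ 2 * ‖F (𝒢.ldiv p.1 p.2)‖)
        + a⁻¹ / 2 * (‖f p.1‖ ^ 2 * χ p.2 * ‖F (𝒢.ldiv p.1 p.2)‖) := by
    intro p
    have hk : ‖k.conj p.2‖ = ‖k p.2‖ := RCLike.norm_conj _
    rw [norm_mul, norm_mul, hk]
    have hN := norm_nonneg (F (𝒢.ldiv p.1 p.2))
    by_cases h1 : f p.1 = 0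
    · rw [h1, norm_zero, zero_mul, zero_mul]
      have := (hχI p.1).1
      have := (hχI p.2).1
      positivity
    by_cases h2 : k p.2 = 0
    · rw [h2, norm_zero, mul_zero, zero_mul]
      have := (hχI p.1).1
      have := (hχI p.2).1
      positivity
    have e1 : χ p.1 = 1 := hχ1 (Or.inl (subset_tsupport _ h1))
    have e2 : χ p.2 = 1 := hχ1 (Or.inr (subset_tsupport _ h2))
    rw [e1, e2, one_mul, mul_one]
    -- The weighted arithmetic–geometric inequality replaces Cauchy–Schwarz; the weight a is chosen
    -- by the user of the estimate.
    have h3 : ‖f p.1‖ * ‖k p.2‖ ≤ a / 2 * ‖k p.2‖ ^ 2 + a⁻¹ / 2 * ‖f p.1‖ ^ 2 := by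
      have h4 : a / 2 * ‖k p.2‖ ^ 2 + a⁻¹ / 2 * ‖f p.1‖ ^ 2 - ‖f p.1‖ * ‖k p.2‖
          = a⁻¹ / 2 * (‖f p.1‖ - a * ‖k p.2‖) ^ 2 := by
        field_simp
        ring
      have : 0 ≤ a⁻¹ / 2 * (‖f p.1‖ - a * ‖k p.2‖) ^ 2 := by positivity
      linarith
    calc ‖f p.1‖ * ‖k p.2‖ * ‖F (𝒢.ldiv p.1 p.2)‖
        ≤ (a / 2 * ‖k p.2‖ ^ 2 + a⁻¹ / 2 * ‖f p.1‖ ^ 2) * ‖F (𝒢.ldiv p.1 p.2)‖ :=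
          mul_le_mul_of_nonneg_right h3 hN
      _ = _ := by ring
  refine (norm_integral_le_of_norm_le ((i1.const_mul (a / 2)).add (i2.const_mul (a⁻¹ / 2)))
    (Eventually.of_forall hle)).trans ?_
  have hadd := integral_add (i1.const_mul (a / 2)) (i2.const_mul (a⁻¹ / 2))
  rw [integral_const_mul, integral_const_mul] at hadd
  refine (le_of_eq hadd).trans ?_
  have c1 : Λ.normIr F ≤ Λ.rBound F := by
    have := Λ.normIr_nonneg (𝒢.invol F)
    unfold rBound
    linarith
  have c2 : Λ.normIr (𝒢.invol F) ≤ Λ.rBound F := by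
    have := Λ.normIr_nonneg F
    unfold rBound
    linarith
  have d1 := b1.trans (mul_le_mul_of_nonneg_right c2 (sq_nonneg ‖Λ.restr u k‖))
  have d2 := b2.trans (mul_le_mul_of_nonneg_right c1 (sq_nonneg ‖Λ.restr u f‖))
  have e1 := mul_le_mul_of_nonneg_left d1 (half_pos ha).le
  have e2 := mul_le_mul_of_nonneg_left d2 (half_pos (inv_pos.2 ha)).le
  refine (add_le_add e1 e2).trans (le_of_eq ?_)
  ring

theorem norm_restr_conv_le (u : X) (f F : C_c(G, ℂ)) :
    ‖Λ.restr u (Λ.conv f F)‖ ≤ Λ.rBound F * ‖Λ.restr u f‖ := by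
  have hC := Λ.rBound_pos F
  -- With k = f * F and a = 1/C, where C = `rBound F`, the estimate reads N² ≤ N²/2 + (C‖f‖)²/2, and
  -- half of N² is absorbed on the left. The summand 1 in `rBound` makes C invertible.
  have h := Λ.norm_inner_restr_conv_le u (Λ.conv f F) f F (inv_pos.2 hC)
  rw [inner_self_eq_norm_sq_to_K] at h
  set N := ‖Λ.restr u (Λ.conv f F)‖
  have hN : ‖((N : ℝ) : ℂ) ^ 2‖ = N ^ 2 := by
    rw [norm_pow, Complex.norm_real, Real.norm_of_nonneg (norm_nonneg _)]
  have h2 : N ^ 2 ≤ Λ.rBound F / 2 * ((Λ.rBound F)⁻¹ * N ^ 2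
      + (Λ.rBound F)⁻¹⁻¹ * ‖Λ.restr u f‖ ^ 2) := hN ▸ h
  have h3 : Λ.rBound F / 2 * ((Λ.rBound F)⁻¹ * N ^ 2 + (Λ.rBound F)⁻¹⁻¹ * ‖Λ.restr u f‖ ^ 2)
      = N ^ 2 / 2 + (Λ.rBound F * ‖Λ.restr u f‖) ^ 2 / 2 := by
    field_simp
  rw [h3] at h2
  exact le_of_sq_le_sq (by linarith) (by positivity)

/-- Right convolution by `F` on the fibre `L²(G^u)`. -/
noncomputable def rconv (u : X) (F : C_c(G, ℂ)) : Λ.L2 u →L[ℂ] Λ.L2 u :=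
  (Λ.restr u ∘ₗ Λ.convBilin.flip F).extendOfNorm (Λ.restr u)

theorem rconv_restr (u : X) (F f : C_c(G, ℂ)) :
    Λ.rconv u F (Λ.restr u f) = Λ.restr u (Λ.conv f F) :=
  LinearMap.extendOfNorm_eq (f := Λ.restr u ∘ₗ Λ.convBilin.flip F) (Λ.denseRange_restr u)
    ⟨_, fun f => Λ.norm_restr_conv_le u f F⟩ f

theorem norm_rconv_le (u : X) (F : C_c(G, ℂ)) : ‖Λ.rconv u F‖ ≤ Λ.rBound F :=
  LinearMap.opNorm_extendOfNorm_le (f := Λ.restr u ∘ₗ Λ.convBilin.flip F)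
    (Λ.denseRange_restr u) (Λ.rBound_pos F).le (fun f => Λ.norm_restr_conv_le u f F)

theorem norm_incl_conv_right_le (F f : C_c(G, ℂ)) :
    ‖Λ.incl (Λ.conv f F)‖ ≤ Λ.rBound F * ‖Λ.incl f‖ := by
  refine Λ.norm_le_of_forall_ev (mul_nonneg (Λ.rBound_pos F).le (norm_nonneg _)) fun u => ?_
  rw [ev_incl]
  exact (Λ.norm_restr_conv_le u f F).trans
    (mul_le_mul_of_nonneg_left (Λ.norm_ev_le u (Λ.incl f)) (Λ.rBound_pos F).le)

theorem R_incl (F f : C_c(G, ℂ)) : Λ.R F (Λ.incl f) = Λ.incl (Λ.conv f F) :=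
  LinearMap.extendOfNorm_eq (f := Λ.incl ∘ₗ Λ.convBilin.flip F) Λ.denseRange_incl
    ⟨_, Λ.norm_incl_conv_right_le F⟩ f

theorem ev_R (u : X) (F : C_c(G, ℂ)) (ξ : Λ.E2) :
    Λ.ev u (Λ.R F ξ) = Λ.rconv u F (Λ.ev u ξ) := by
  refine congrFun (Λ.denseRange_incl.equalizer (Λ.ev u ∘L Λ.R F).continuous
    (Λ.rconv u F ∘L Λ.ev u).continuous (funext fun f => ?_)) ξ
  show Λ.ev u (Λ.R F (Λ.incl f)) = Λ.rconv u F (Λ.ev u (Λ.incl f))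
  rw [R_incl, ev_incl, ev_incl, rconv_restr]

theorem clm_eq_of_restr {u : X} {E : Type*} [NormedAddCommGroup E] [NormedSpace ℂ E]
    {S T : Λ.L2 u →L[ℂ] E} (h : ∀ f, S (Λ.restr u f) = T (Λ.restr u f)) : S = T :=
  ContinuousLinearMap.ext fun ξ => congrFun
    ((Λ.denseRange_restr u).equalizer S.continuous T.continuous (funext h)) ξ

theorem inner_rconv_invol (u : X) (F k f : C_c(G, ℂ)) :
    inner ℂ (Λ.restr u (Λ.conv k (𝒢.invol F))) (Λ.restr u f)
      = inner ℂ (Λ.restr u k) (Λ.restr u (Λ.conv f F)) := by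
  rw [← inner_conj_symm, inner_restr_conv, inner_restr_conv,
    integral_integral_swap (f := fun t x => f t * (starRingEnd ℂ) (k x) * F (𝒢.ldiv t x))
      (Λ.integrable_kernel_ldiv u f k.conj F), ← integral_conj]
  refine integral_congr_ae ?_
  filter_upwards [Λ.ae_mem_fiber u] with t ht
  rw [← integral_conj]
  refine integral_congr_ae ?_
  filter_upwards [Λ.ae_mem_fiber u] with x hx
  rw [invol_ldiv F (ht.trans hx.symm)]
  simp only [map_mul, Complex.conj_conj]
  ring

theorem adjoint_rconv (u : X) (F : C_c(G, ℂ)) :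
    ContinuousLinearMap.adjoint (Λ.rconv u F) = Λ.rconv u (𝒢.invol F) := by
  refine Λ.clm_eq_of_restr fun f => Λ.eq_of_inner_restr fun k => ?_
  rw [ContinuousLinearMap.adjoint_inner_right, rconv_restr, rconv_restr]
  rw [← inner_rconv_invol, invol_invol]

/-- Right convolution commutes with left translation. -/
theorem rconv_V {u v : X} {t : G} (hr : 𝒢.r t = u) (hs : 𝒢.s t = v) (F : C_c(G, ℂ))
    (ξ : Λ.L2 v) : Λ.rconv u F (Λ.V u v t ξ) = Λ.V u v t (Λ.rconv v F ξ) := by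
  refine congrArg (fun T : Λ.L2 v →L[ℂ] Λ.L2 u => T ξ) (Λ.clm_eq_of_restr
    (S := Λ.rconv u F ∘L Λ.V u v t) (T := Λ.V u v t ∘L Λ.rconv v F) fun f => ?_)
  obtain ⟨f', hf'⟩ := 𝒢.exists_translate f t
  have e1 : Λ.V u v t (Λ.restr v f) = Λ.restr u f' :=
    Λ.V_restr_eq hr hs fun x hx => hf' x (hr.trans hx.symm)
  rw [ContinuousLinearMap.comp_apply, ContinuousLinearMap.comp_apply, e1, rconv_restr,
    rconv_restr]
  symm
  refine Λ.V_restr_eq hr hs fun x hx => ?_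
  have hrx : 𝒢.r t = 𝒢.r x := hr.trans hx.symm
  have hm : MeasurePreserving (𝒢.ldiv t) (Λ.measure u) (Λ.measure v) :=
    hs ▸ Λ.measurePreserving_ldiv t hr
  rw [Λ.conv_apply f' F hx, Λ.conv_apply f F ((𝒢.r_ldiv hrx).trans hs), ← hm.map_eq,
    integral_map hm.aemeasurable]
  · refine integral_congr_ae ?_
    filter_upwards [Λ.ae_mem_fiber u] with z hz
    have hrz : 𝒢.r t = 𝒢.r z := hr.trans hz.symm
    rw [hf' z hrz, 𝒢.ldiv_ldiv_ldiv hrz hrx]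
  · exact (f.continuous.measurable.mul (F.continuous.measurable.comp
      (𝒢.measurable_ldiv.comp measurable_prodMk_right))).aestronglyMeasurable

theorem trans_R {u : X} {t : G} (ht : 𝒢.r t = u) (F : C_c(G, ℂ)) (ξ : Λ.E2) :
    Λ.trans u t (Λ.R F ξ) = Λ.rconv u F (Λ.trans u t ξ) := by
  rw [trans_apply, trans_apply, ev_R, Λ.rconv_V ht rfl]

/-- Convolution on `C_c(G)` is associative. -/
theorem conv_assoc (F f g : C_c(G, ℂ)) :
    Λ.conv (Λ.conv F f) g = Λ.conv F (Λ.conv f g) := by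
  refine Λ.eq_of_restr_eq fun u => ?_
  -- F * f is an integral of translates of f; right convolution by g passes under the integral and
  -- commutes with the translations.
  rw [← rconv_restr, restr_conv_eq_integral, restr_conv_eq_integral,
    ← ContinuousLinearMap.integral_comp_comm _ (Λ.integrable_smul_trans u F _)]
  refine integral_congr_ae ?_
  filter_upwards [Λ.ae_mem_fiber u] with t ht
  rw [map_smul, ← R_incl, Λ.trans_R ht]

theorem L_comp_R (F f : C_c(G, ℂ)) : Λ.L F ∘L Λ.R f = Λ.R f ∘L Λ.L F := by
  refine Λ.eq_of_incl fun g => ?_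
  rw [ContinuousLinearMap.comp_apply, ContinuousLinearMap.comp_apply, R_incl, L_incl, L_incl,
    R_incl, conv_assoc]

theorem L_comp_L (F f : C_c(G, ℂ)) : Λ.L F ∘L Λ.L f = Λ.L (Λ.conv F f) := by
  refine Λ.eq_of_incl fun g => ?_
  rw [ContinuousLinearMap.comp_apply, L_incl, L_incl, L_incl, conv_assoc]

theorem L_add (F f : C_c(G, ℂ)) : Λ.L (F + f) = Λ.L F + Λ.L f := by
  refine Λ.eq_of_incl fun g => ?_
  rw [add_apply, L_incl, L_incl, L_incl, ← map_add]
  exact congrArg Λ.incl (congrArg (fun T => T g) (Λ.convBilin.map_add F f))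

theorem L_smul (c : ℂ) (F : C_c(G, ℂ)) : Λ.L (c • F) = c • Λ.L F := by
  refine Λ.eq_of_incl fun g => ?_
  rw [smul_apply, L_incl, L_incl, ← map_smul]
  exact congrArg Λ.incl (congrArg (fun T => T g) (Λ.convBilin.map_smul c F))

theorem L_zero : Λ.L 0 = 0 := by
  have h := Λ.L_add 0 0
  rw [add_zero] at h
  exact left_eq_add.1 h

theorem rconv_comp (u : X) (F f : C_c(G, ℂ)) :
    Λ.rconv u F ∘L Λ.rconv u f = Λ.rconv u (Λ.conv f F) := by
  refine Λ.clm_eq_of_restr fun g => ?_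
  rw [ContinuousLinearMap.comp_apply, rconv_restr, rconv_restr, rconv_restr, conv_assoc]

theorem rconv_add (u : X) (F f : C_c(G, ℂ)) :
    Λ.rconv u (F + f) = Λ.rconv u F + Λ.rconv u f := by
  refine Λ.clm_eq_of_restr fun g => ?_
  rw [add_apply, rconv_restr, rconv_restr, rconv_restr, ← map_add]
  exact congrArg (Λ.restr u) ((Λ.convBilin g).map_add F f)

theorem rconv_smul (u : X) (c : ℂ) (F : C_c(G, ℂ)) :
    Λ.rconv u (c • F) = c • Λ.rconv u F := by
  refine Λ.clm_eq_of_restr fun g => ?_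
  rw [smul_apply, rconv_restr, rconv_restr, ← map_smul]
  exact congrArg (Λ.restr u) ((Λ.convBilin g).map_smul c F)

end HaarSystem

namespace HaarSystem

variable {X G : Type*} [TopologicalSpace X] [TopologicalSpace G] [T2Space G]
  [LocallyCompactSpace G] [SecondCountableTopology G] [MeasurableSpace G] [BorelSpace G]
  {𝒢 : TopGroupoid X G} (Λ : HaarSystem 𝒢)

/-! ### Approximate identities -/

theorem integrable_coe (u : X) (f : C_c(G, ℂ)) : Integrable (fun x => f x) (Λ.measure u) :=
  f.continuous.integrable_of_hasCompactSupport f.hasCompactSupport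

/-- The `L¹`-distance between `f` and its left translate by `t`. -/
noncomputable def displacement (f : C_c(G, ℂ)) (t : G) : ℝ :=
  ∫ x, ‖f (𝒢.ldiv t x) - f x‖ ∂(Λ.measure (𝒢.r t))

theorem continuous_displacement (f : C_c(G, ℂ)) : Continuous (Λ.displacement f) := by
  rw [continuous_iff_continuousAt]
  intro t₀
  obtain ⟨W, hW, hWt⟩ := exists_compact_mem_nhds t₀
  obtain ⟨Ψ, K, hK, h0, h1⟩ := 𝒢.exists_extension f hW
  have hc := Λ.continuous_integral_fiber (fun p => ((‖Ψ p - f p.2‖ : ℝ) : ℂ)) (by fun_prop)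
    (K ∪ tsupport f) (hK.union f.hasCompactSupport) fun t x hx => by
      rw [h0 t x fun h => hx (Or.inl h),
        image_eq_zero_of_notMem_tsupport fun h => hx (Or.inr h)]
      simp
  refine ((Complex.continuous_re.comp hc).continuousAt (x := t₀)).congr ?_
  filter_upwards [hWt] with t ht
  rw [Function.comp_apply, integral_complex_ofReal, Complex.ofReal_re]
  refine integral_congr_ae ?_
  filter_upwards [Λ.ae_mem_fiber (𝒢.r t)] with x hx
  rw [h1 t ht x hx.symm]

theorem displacement_unit (f : C_c(G, ℂ)) (v : X) : Λ.displacement f (𝒢.unit v) = 0 := by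
  refine integral_eq_zero_of_ae ?_
  filter_upwards [Λ.ae_mem_fiber (𝒢.r (𝒢.unit v))] with x hx
  rw [𝒢.r_unit] at hx
  have : 𝒢.ldiv (𝒢.unit v) x = x := by
    rw [← hx]
    exact 𝒢.ldiv_unit x
  simp [this]

theorem displacement_ne_zero {f : C_c(G, ℂ)} {t : G} (h : Λ.displacement f t ≠ 0) :
    𝒢.r t ∈ 𝒢.r '' tsupport f ∨ 𝒢.s t ∈ 𝒢.r '' tsupport f := by
  by_contra! hcon
  refine h (integral_eq_zero_of_ae ?_)
  filter_upwards [Λ.ae_mem_fiber (𝒢.r t)] with x hx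
  have h1 : f x = 0 := by
    by_contra h1
    exact hcon.1 ⟨x, subset_tsupport _ h1, hx⟩
  have h2 : f (𝒢.ldiv t x) = 0 := by
    by_contra h2
    exact hcon.2 ⟨_, subset_tsupport _ h2, 𝒢.r_ldiv hx.symm⟩
  simp [h1, h2]

/-- A nonzero displacement forces r(t) or s(t) into the compact set r(supp f), and {displacement <
ε} is an open set containing the corresponding units, hence a δ-thickening of them. It is not known
which end lies over the support, so t must be close to both of its units. -/
theorem exists_displacement_lt {G : Type*} [MetricSpace G] [LocallyCompactSpace G]
    [SecondCountableTopology G] [MeasurableSpace G] [BorelSpace G] {𝒢 : TopGroupoid X G}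
    (Λ : HaarSystem 𝒢) (f : C_c(G, ℂ)) {ε : ℝ} (hε : 0 < ε) :
    ∃ δ > 0, ∀ t, dist t (𝒢.unit (𝒢.r t)) < δ → dist t (𝒢.unit (𝒢.s t)) < δ →
      Λ.displacement f t < ε := by
  have hK : IsCompact (𝒢.unit '' (𝒢.r '' tsupport f)) :=
    (f.hasCompactSupport.isCompact.image 𝒢.continuous_r).image 𝒢.continuous_unit
  obtain ⟨δ, hδ, hsub⟩ := hK.exists_thickening_subset_open
    (isOpen_lt (Λ.continuous_displacement f) (continuous_const (y := ε))) (by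
      rintro _ ⟨v, -, rfl⟩
      show Λ.displacement f (𝒢.unit v) < ε
      rwa [displacement_unit])
  refine ⟨δ, hδ, fun t h1 h2 => ?_⟩
  by_cases h : Λ.displacement f t = 0
  · rwa [h]
  · rcases Λ.displacement_ne_zero h with hr | hs
    · exact hsub (Metric.mem_thickening_iff.2 ⟨_, mem_image_of_mem _ hr, h1⟩)
    · exact hsub (Metric.mem_thickening_iff.2 ⟨_, mem_image_of_mem _ hs, h2⟩)

/-- A nonnegative function in `C_c(G)`, supported in a given neighbourhood of the unit space, whose
integrals over the fibres are at most `1`, with equality over a given compact set. -/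
theorem exists_normalized {U : Set G} (hU : IsOpen U) (hUu : ∀ v, 𝒢.unit v ∈ U) {K : Set X}
    (hK : IsCompact K) :
    ∃ (F : C_c(G, ℂ)) (φ : G → ℝ), (∀ x, F x = φ x) ∧ (∀ x, 0 ≤ φ x) ∧ (∀ x, φ x ≠ 0 → x ∈ U) ∧
      (∀ u, ∫ x, φ x ∂(Λ.measure u) ≤ 1) ∧ ∀ u ∈ K, ∫ x, φ x ∂(Λ.measure u) = 1 := by
  have := 𝒢.t2Space_unit
  obtain ⟨g, hg1, hg0, hgc, hgI⟩ := exists_continuous_one_zero_of_isCompact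
    (hK.image 𝒢.continuous_unit) hU.isClosed_compl (by
      rw [Set.disjoint_left]
      rintro _ ⟨v, -, rfl⟩ h
      exact h (hUu v))
  have hm := Λ.continuous_integral_real g g.continuous hgc
  set m : X → ℝ := fun u => ∫ x, g x ∂(Λ.measure u) with hmdef
  have hm0 : ∀ u ∈ K, 0 < m u := by
    intro u hu
    rw [hmdef]
    refine (integral_pos_iff_support_of_nonneg (fun x => (hgI x).1)
      (g.continuous.integrable_of_hasCompactSupport hgc)).2 ?_
    have hx : 𝒢.unit u ∈ (Λ.measure u).support := by
      rw [Λ.support_eq]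
      exact 𝒢.r_unit u
    rw [Measure.mem_support_iff_forall] at hx
    refine hx _ (g.continuous.isOpen_support.mem_nhds ?_)
    have : g (𝒢.unit u) = 1 := hg1 (mem_image_of_mem _ hu)
    rw [Function.mem_support, this]
    exact one_ne_zero
  -- The fibre integral m of g is continuous and positive on K, hence at least some c > 0 there.
  -- Division by max(m, c) normalises over K and causes no singularity elsewhere.
  obtain ⟨c, hc0, hc⟩ := hK.exists_forall_le' hm.continuousOn hm0
  have hD : ∀ u, 0 < max (m u) c := fun u => lt_max_of_lt_right hc0
  have hφc : Continuous fun x => g x / max (m (𝒢.r x)) c :=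
    g.continuous.div ((hm.comp 𝒢.continuous_r).max continuous_const) fun x => (hD _).ne'
  have hint : ∀ u, ∫ x, g x / max (m (𝒢.r x)) c ∂(Λ.measure u) = m u / max (m u) c := by
    intro u
    rw [hmdef, ← integral_div]
    refine integral_congr_ae ?_
    filter_upwards [Λ.ae_mem_fiber u] with x hx
    rw [hx]
  refine ⟨⟨⟨fun x => ((g x / max (m (𝒢.r x)) c : ℝ) : ℂ), by fun_prop⟩, ?_⟩,
    fun x => g x / max (m (𝒢.r x)) c, fun x => rfl, fun x => div_nonneg (hgI x).1 (hD _).le,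
    fun x hx => ?_, fun u => ?_, fun u hu => ?_⟩
  · refine HasCompactSupport.intro hgc fun x hx => ?_
    simp [image_eq_zero_of_notMem_tsupport hx]
  · by_contra hxU
    refine hx ?_
    show g x / _ = 0
    rw [hg0 hxU]
    simp
  · rw [hint, div_le_one (hD u)]
    exact le_max_left _ _
  · rw [hint, max_eq_left (hc u hu), div_self (hm0 u hu).ne']

section

variable {F f : C_c(G, ℂ)} {φ : G → ℝ}

/-- The term f(x) can be written as ∫ F(t) f(x) dλ^u(t): the integral of F is 1 over r(supp f), and
on all other fibres f vanishes. -/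
theorem conv_sub_apply (hF : ∀ x, F x = φ x)
    (h1 : ∀ u ∈ 𝒢.r '' tsupport f, ∫ x, φ x ∂(Λ.measure u) = 1) {u : X} {x : G}
    (hx : 𝒢.r x = u) :
    (Λ.conv F f - f) x = ∫ t, F t * (f (𝒢.ldiv t x) - f x) ∂(Λ.measure u) := by
  have hFi := Λ.integrable_coe u F
  have hi : Integrable (fun t => F t * f (𝒢.ldiv t x)) (Λ.measure u) := by
    obtain ⟨c, hc⟩ := f.hasCompactSupport.exists_bound_of_continuous f.continuous
    exact hFi.mul_bdd (f.continuous.measurable.comp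
      (𝒢.measurable_ldiv.comp measurable_prodMk_right)).aestronglyMeasurable
      (Eventually.of_forall fun t => hc _)
  simp only [mul_sub]
  rw [integral_sub hi (hFi.mul_const _), integral_mul_const]
  have h2 : (∫ t, F t ∂(Λ.measure u)) * f x = f x := by
    by_cases hfx : f x = 0
    · rw [hfx, mul_zero]
    · have h3 := h1 u ⟨x, subset_tsupport _ hfx, hx⟩
      simp only [hF]
      rw [integral_complex_ofReal, h3, Complex.ofReal_one, one_mul]
  rw [h2]
  exact congrArg (· - f x) (Λ.conv_apply F f hx)

theorem lintegral_enorm_le_one (hF : ∀ x, F x = φ x) (h0 : ∀ x, 0 ≤ φ x) {u : X}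
    (hle : ∫ x, φ x ∂(Λ.measure u) ≤ 1) : ∫⁻ t, ‖F t‖ₑ ∂(Λ.measure u) ≤ 1 := by
  rw [← ofReal_integral_norm_eq_lintegral_enorm (Λ.integrable_coe u F), ← ENNReal.ofReal_one]
  refine ENNReal.ofReal_le_ofReal (le_trans (le_of_eq ?_) hle)
  congr 1
  funext x
  rw [hF, Complex.norm_real, Real.norm_of_nonneg (h0 x)]

theorem lintegral_enorm_ldiv_sub {u : X} {t : G} (ht : 𝒢.r t = u) :
    ∫⁻ x, ‖f (𝒢.ldiv t x) - f x‖ₑ ∂(Λ.measure u) = ENNReal.ofReal (Λ.displacement f t) := by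
  subst ht
  exact (ofReal_integral_norm_eq_lintegral_enorm
    ((Λ.integrable_ldiv f rfl).sub (Λ.integrable_coe _ f))).symm

/-- After Tonelli the left side is at most the F-average of the displacements of f, and only points
t with φ(t) ≠ 0 contribute. -/
theorem integral_norm_conv_sub_le (hF : ∀ x, F x = φ x) (h0 : ∀ x, 0 ≤ φ x)
    (hle : ∀ u, ∫ x, φ x ∂(Λ.measure u) ≤ 1)
    (h1 : ∀ u ∈ 𝒢.r '' tsupport f, ∫ x, φ x ∂(Λ.measure u) = 1) {ε : ℝ} (hε : 0 ≤ ε)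
    (hd : ∀ t, φ t ≠ 0 → Λ.displacement f t ≤ ε) (u : X) :
    ∫ x, ‖(Λ.conv F f - f) x‖ ∂(Λ.measure u) ≤ ε := by
  have hmeas : Measurable fun p : G × G => ‖f (𝒢.ldiv p.2 p.1) - f p.1‖ₑ :=
    ((f.continuous.measurable.comp (𝒢.measurable_ldiv.comp measurable_swap)).sub
      (f.continuous.measurable.comp measurable_fst)).enorm
  have hFint := Λ.lintegral_enorm_le_one hF h0 (hle u)
  have key : ∫⁻ x, ‖(Λ.conv F f - f) x‖ₑ ∂(Λ.measure u) ≤ ENNReal.ofReal ε := by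
    calc ∫⁻ x, ‖(Λ.conv F f - f) x‖ₑ ∂(Λ.measure u)
        ≤ ∫⁻ x, ∫⁻ t, ‖F t‖ₑ * ‖f (𝒢.ldiv t x) - f x‖ₑ ∂(Λ.measure u) ∂(Λ.measure u) := by
          refine lintegral_mono_ae ?_
          filter_upwards [Λ.ae_mem_fiber u] with x hx
          rw [Λ.conv_sub_apply hF h1 hx]
          refine (enorm_integral_le_lintegral_enorm _).trans (le_of_eq ?_)
          simp only [enorm_mul]
      _ = ∫⁻ t, ∫⁻ x, ‖F t‖ₑ * ‖f (𝒢.ldiv t x) - f x‖ₑ ∂(Λ.measure u) ∂(Λ.measure u) := by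
          refine lintegral_lintegral_swap ?_
          exact ((F.continuous.measurable.comp measurable_snd).enorm.mul hmeas).aemeasurable
      _ ≤ ∫⁻ t, ‖F t‖ₑ * ENNReal.ofReal ε ∂(Λ.measure u) := by
          refine lintegral_mono_ae ?_
          filter_upwards [Λ.ae_mem_fiber u] with t ht
          have e : ∫⁻ x, ‖F t‖ₑ * ‖f (𝒢.ldiv t x) - f x‖ₑ ∂(Λ.measure u)
              = ‖F t‖ₑ * ENNReal.ofReal (Λ.displacement f t) :=
            (lintegral_const_mul' _ _ enorm_ne_top).trans
              (congrArg _ (Λ.lintegral_enorm_ldiv_sub ht))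
          rw [e]
          by_cases hφ : φ t = 0
          · simp [hF, hφ]
          · exact mul_le_mul' le_rfl (ENNReal.ofReal_le_ofReal (hd t hφ))
      _ = (∫⁻ t, ‖F t‖ₑ ∂(Λ.measure u)) * ENNReal.ofReal ε :=
          lintegral_mul_const _ F.continuous.measurable.enorm
      _ ≤ 1 * ENNReal.ofReal ε := mul_le_mul' hFint le_rfl
      _ = ENNReal.ofReal ε := one_mul _
  have hgi := Λ.integrable_coe u (Λ.conv F f - f)
  rw [← ofReal_integral_norm_eq_lintegral_enorm hgi] at key
  exact (ENNReal.ofReal_le_ofReal_iff hε).1 key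

theorem norm_conv_sub_apply_le (hF : ∀ x, F x = φ x) (h0 : ∀ x, 0 ≤ φ x)
    (hle : ∀ u, ∫ x, φ x ∂(Λ.measure u) ≤ 1)
    (h1 : ∀ u ∈ 𝒢.r '' tsupport f, ∫ x, φ x ∂(Λ.measure u) = 1) {c : ℝ} (hc : ∀ x, ‖f x‖ ≤ c)
    (x : G) : ‖(Λ.conv F f - f) x‖ ≤ 2 * c := by
  have hc0 : 0 ≤ c := (norm_nonneg _).trans (hc x)
  rw [Λ.conv_sub_apply hF h1 rfl]
  have hφi : Integrable φ (Λ.measure (𝒢.r x)) := by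
    have := (F.continuous.integrable_of_hasCompactSupport (μ := Λ.measure (𝒢.r x))
      F.hasCompactSupport).re
    refine this.congr (Eventually.of_forall fun t => ?_)
    simp [hF]
  calc ‖∫ t, F t * (f (𝒢.ldiv t x) - f x) ∂(Λ.measure (𝒢.r x))‖
      ≤ ∫ t, φ t * (2 * c) ∂(Λ.measure (𝒢.r x)) := by
        refine norm_integral_le_of_norm_le (hφi.mul_const _) (Eventually.of_forall fun t => ?_)
        rw [norm_mul, hF, Complex.norm_real, Real.norm_of_nonneg (h0 t)]
        refine mul_le_mul_of_nonneg_left ?_ (h0 t)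
        refine (norm_sub_le _ _).trans ?_
        linarith [hc (𝒢.ldiv t x), hc x]
    _ = (∫ t, φ t ∂(Λ.measure (𝒢.r x))) * (2 * c) := integral_mul_const _ _
    _ ≤ 1 * (2 * c) := mul_le_mul_of_nonneg_right (hle _) (by positivity)
    _ = 2 * c := one_mul _

end

/-- ‖g‖₂² ≤ ‖g‖_∞ ‖g‖₁. This upgrades (I,r)-convergence of the approximate identity to convergence
in E², as the functions F_n * f − f are uniformly bounded for large n. -/
theorem norm_restr_sq_le (u : X) {g : C_c(G, ℂ)} {c ε : ℝ} (hc : ∀ x, ‖g x‖ ≤ c)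
    (hc0 : 0 ≤ c) (hε : ∫ x, ‖g x‖ ∂(Λ.measure u) ≤ ε) : ‖Λ.restr u g‖ ^ 2 ≤ c * ε := by
  rw [norm_restr_sq]
  calc ∫ x, ‖g x‖ ^ 2 ∂(Λ.measure u) ≤ ∫ x, c * ‖g x‖ ∂(Λ.measure u) := by
        refine integral_mono (Λ.integrable_sq u g)
          ((g.continuous.integrable_of_hasCompactSupport g.hasCompactSupport).norm.const_mul c)
          fun x => ?_
        show ‖g x‖ ^ 2 ≤ c * ‖g x‖
        rw [sq]
        exact mul_le_mul_of_nonneg_right (hc x) (norm_nonneg _)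
    _ = c * ∫ x, ‖g x‖ ∂(Λ.measure u) := integral_const_mul _ _
    _ ≤ c * ε := mul_le_mul_of_nonneg_left hε hc0

/-- A nonnegative approximate identity, bounded in the `(I,r)`-norm. -/
theorem exists_approximate_identity :
    ∃ F : ℕ → C_c(G, ℂ), (∀ n, Λ.normIr (F n) ≤ 1) ∧ (∀ n x, 0 ≤ F n x) ∧
      (∀ f : C_c(G, ℂ), Tendsto (fun n => Λ.normIr (Λ.conv (F n) f - f)) atTop (𝓝 0)) ∧
      (∀ ξ : Λ.E2, Tendsto (fun n => Λ.L (F n) ξ) atTop (𝓝 ξ)) := by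
  have := 𝒢.t2Space_unit
  have := 𝒢.locallyCompactSpace_unit
  have := 𝒢.secondCountable_unit
  let : MetricSpace G := TopologicalSpace.metrizableSpaceMetric G
  let K := CompactExhaustion.choice X
  let U : ℕ → Set G := fun n =>
    {t | dist t (𝒢.unit (𝒢.r t)) < 1 / ((n : ℝ) + 1) ∧
      dist t (𝒢.unit (𝒢.s t)) < 1 / ((n : ℝ) + 1)}
  have hU : ∀ n, IsOpen (U n) := fun n => by
    have h1 := 𝒢.continuous_r
    have h2 := 𝒢.continuous_s
    have h3 := 𝒢.continuous_unit
    exact (isOpen_lt (continuous_id.dist (h3.comp h1)) continuous_const).inter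
      (isOpen_lt (continuous_id.dist (h3.comp h2)) continuous_const)
  have hUu : ∀ n v, 𝒢.unit v ∈ U n := fun n v => by
    have : (0 : ℝ) < 1 / ((n : ℝ) + 1) := by positivity
    simpa [U, 𝒢.r_unit, 𝒢.s_unit] using this
  choose F φ hF h0 hφU hle h1 using fun n => Λ.exists_normalized (hU n) (hUu n) (K.isCompact n)
  have hn1 : ∀ n, Λ.normIr (F n) ≤ 1 := fun n => by
    refine Real.iSup_le (fun u => ?_) zero_le_one
    refine le_trans (le_of_eq ?_) (hle n u)
    congr 1
    funext x
    rw [hF, Complex.norm_real, Real.norm_of_nonneg (h0 n x)]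
  have hev : ∀ f : C_c(G, ℂ), ∀ ε > 0, ∀ᶠ n in atTop,
      (∀ t, φ n t ≠ 0 → Λ.displacement f t ≤ ε) ∧
      ∀ u ∈ 𝒢.r '' tsupport f, ∫ x, φ n x ∂(Λ.measure u) = 1 := by
    intro f ε hε
    obtain ⟨δ, hδ, hδ2⟩ := Λ.exists_displacement_lt f hε
    obtain ⟨N, hN⟩ := K.exists_superset_of_isCompact
      (f.hasCompactSupport.isCompact.image 𝒢.continuous_r)
    obtain ⟨N', hN'⟩ := exists_nat_one_div_lt hδ
    filter_upwards [eventually_ge_atTop (max N N')] with n hn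
    refine ⟨fun t ht => ?_, fun u hu => h1 n u (K.subset (le_of_max_le_left hn) (hN hu))⟩
    have h2 : 1 / ((n : ℝ) + 1) ≤ 1 / ((N' : ℝ) + 1) := by
      have : (N' : ℝ) ≤ n := by exact_mod_cast le_of_max_le_right hn
      gcongr
    obtain ⟨h3, h4⟩ := hφU n t ht
    exact (hδ2 t (by linarith) (by linarith)).le
  have hL1 : ∀ f : C_c(G, ℂ), ∀ ε > 0, ∀ᶠ n in atTop,
      ∀ u, ∫ x, ‖(Λ.conv (F n) f - f) x‖ ∂(Λ.measure u) ≤ ε := by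
    intro f ε hε
    filter_upwards [hev f ε hε] with n hn
    exact Λ.integral_norm_conv_sub_le (hF n) (h0 n) (hle n) hn.2 hε.le hn.1
  have hincl : ∀ f : C_c(G, ℂ),
      Tendsto (fun n => Λ.L (F n) (Λ.incl f)) atTop (𝓝 (Λ.incl f)) := by
    intro f
    obtain ⟨c, hc⟩ := f.hasCompactSupport.exists_bound_of_continuous f.continuous
    have hc' : ∀ x, ‖f x‖ ≤ |c| := fun x => (hc x).trans (le_abs_self c)
    rw [Metric.tendsto_nhds]
    intro ε hε
    -- Chosen so that the sup bound 2|c| times this L¹ bound is at most (ε/2)²; the summand 1 covers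
    -- c = 0. In the next line the tolerance 1 is arbitrary, since only the normalisation of the
    -- fibre integrals is used.
    have hη : 0 < (ε / 2) ^ 2 / (2 * |c| + 1) := by positivity
    filter_upwards [hL1 f _ hη, hev f 1 one_pos] with n hn hn2
    rw [L_incl, dist_eq_norm, ← map_sub]
    refine lt_of_le_of_lt (Λ.norm_le_of_forall_ev (half_pos hε).le fun u => ?_) (half_lt_self hε)
    rw [ev_incl]
    refine le_of_sq_le_sq ?_ (half_pos hε).le
    refine (Λ.norm_restr_sq_le u
      (Λ.norm_conv_sub_apply_le (hF n) (h0 n) (hle n) hn2.2 hc') (by positivity) (hn u)).trans ?_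
    rw [mul_div_assoc', div_le_iff₀ (by positivity)]
    nlinarith [sq_nonneg (ε / 2), abs_nonneg c]
  refine ⟨F, hn1, fun n x => ?_, fun f => ?_, fun ξ => ?_⟩
  · rw [hF]
    exact Complex.zero_le_real.2 (h0 n x)
  · rw [Metric.tendsto_nhds]
    intro ε hε
    filter_upwards [hL1 f _ (half_pos hε)] with n hn
    rw [dist_zero_right, Real.norm_of_nonneg (Λ.normIr_nonneg _)]
    exact (Real.iSup_le hn (half_pos hε).le).trans_lt (half_lt_self hε)
  · rw [Metric.tendsto_nhds]
    intro ε hε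
    obtain ⟨f, hf⟩ := Metric.mem_closure_range_iff.1 (Λ.denseRange_incl ξ) (ε / 3) (by positivity)
    filter_upwards [Metric.tendsto_nhds.1 (hincl f) (ε / 3) (by positivity)] with n hn
    have e1 : dist (Λ.L (F n) ξ) (Λ.L (F n) (Λ.incl f)) ≤ dist ξ (Λ.incl f) := by
      rw [dist_eq_norm, dist_eq_norm, ← map_sub]
      exact (Λ.L (F n)).le_of_opNorm_le_of_le ((Λ.norm_L_le _).trans (hn1 n)) le_rfl
        |>.trans (one_mul _).le
    have e2 := dist_triangle4 (Λ.L (F n) ξ) (Λ.L (F n) (Λ.incl f)) (Λ.incl f) ξ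
    rw [dist_comm (Λ.incl f) ξ] at e2
    linarith

end HaarSystem

/-! ### Strong limits of bounded functional calculi -/

section StrongLimits

/-- Bounded sequences of operators converge strongly if they do on a dense set. -/
theorem ContinuousLinearMap.tendsto_of_denseRange {E E' ι : Type*} [NormedAddCommGroup E]
    [NormedSpace ℂ E] [NormedAddCommGroup E'] [NormedSpace ℂ E'] {T : ℕ → E →L[ℂ] E'}
    {T₀ : E →L[ℂ] E'} {C : ℝ} (hC : ∀ n, ‖T n‖ ≤ C) {e : ι → E} (he : DenseRange e)
    (h : ∀ i, Tendsto (fun n => T n (e i)) atTop (𝓝 (T₀ (e i)))) (x : E) :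
    Tendsto (fun n => T n x) atTop (𝓝 (T₀ x)) := by
  rw [Metric.tendsto_nhds]
  intro ε hε
  have hD : 0 < |C| + ‖T₀‖ + 1 := by positivity
  obtain ⟨i, hi⟩ := Metric.mem_closure_range_iff.1 (he x) (ε / 2 / (|C| + ‖T₀‖ + 1))
    (by positivity)
  rw [dist_eq_norm] at hi
  filter_upwards [Metric.tendsto_nhds.1 (h i) (ε / 2) (half_pos hε)] with n hn
  rw [dist_eq_norm] at hn ⊢
  have e1 : T n x - T₀ x = T n (x - e i) + (T n (e i) - T₀ (e i)) - T₀ (x - e i) := by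
    simp only [map_sub]
    abel
  have e2 : ‖T n (x - e i)‖ ≤ |C| * ‖x - e i‖ :=
    (T n).le_of_opNorm_le ((hC n).trans (le_abs_self C)) _
  have e3 : ‖T₀ (x - e i)‖ ≤ ‖T₀‖ * ‖x - e i‖ := T₀.le_opNorm _
  have e4 : (|C| + ‖T₀‖ + 1) * ‖x - e i‖ < ε / 2 := by
    rw [lt_div_iff₀ hD] at hi
    linarith
  rw [e1]
  have e5 := norm_sub_le (T n (x - e i) + (T n (e i) - T₀ (e i))) (T₀ (x - e i))
  have e6 := norm_add_le (T n (x - e i)) (T n (e i) - T₀ (e i))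
  nlinarith [norm_nonneg (x - e i)]

variable {H : Type*} [NormedAddCommGroup H] [InnerProductSpace ℂ H] [CompleteSpace H]

theorem IsSelfAdjoint.one_le_norm_add_of_mem_spectrum {A : H →L[ℂ] H} (hA : IsSelfAdjoint A) {w z : ℂ}
    (hw : w = Complex.I ∨ w = -Complex.I) (hz : z ∈ spectrum ℂ A) : 1 ≤ ‖z + w‖ := by
  have him : z.im = 0 := hA.im_eq_zero_of_mem_spectrum hz
  have h1 : |(z + w).im| = 1 := by
    rcases hw with rfl | rfl <;> simp [him]
  exact h1 ▸ Complex.abs_im_le_norm _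

/-- The resolvent of a self-adjoint operator at the points `± i`. -/
theorem IsSelfAdjoint.exists_resolvent {A : H →L[ℂ] H} (hA : IsSelfAdjoint A) {w : ℂ}
    (hw : w = Complex.I ∨ w = -Complex.I) :
    ‖cfc (fun z : ℂ => (z + w)⁻¹) A‖ ≤ 1 ∧
      cfc (fun z : ℂ => (z + w)⁻¹) A * (A + algebraMap ℂ _ w) = 1 ∧
      (A + algebraMap ℂ _ w) * cfc (fun z : ℂ => (z + w)⁻¹) A = 1 := by
  have hn : IsStarNormal A := hA.isStarNormal
  have hne : ∀ z ∈ spectrum ℂ A, z + w ≠ 0 := fun z hz => by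
    have := hA.one_le_norm_add_of_mem_spectrum hw hz
    intro h0
    rw [h0, norm_zero] at this
    linarith
  have hc : ContinuousOn (fun z : ℂ => (z + w)⁻¹) (spectrum ℂ A) :=
    ContinuousOn.inv₀ (by fun_prop) hne
  have hlin : cfc (fun z : ℂ => z + w) A = A + algebraMap ℂ _ w := by
    rw [cfc_add_const w (fun z => z) A (by fun_prop) hn, cfc_id' ℂ A]
  refine ⟨norm_cfc_le zero_le_one fun z hz => ?_, ?_, ?_⟩
  · rw [norm_inv]
    exact inv_le_one_of_one_le₀ (hA.one_le_norm_add_of_mem_spectrum hw hz)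
  · rw [← hlin, ← cfc_mul _ _ A hc (by fun_prop), ← cfc_one ℂ A]
    exact cfc_congr fun z hz => inv_mul_cancel₀ (hne z hz)
  · rw [← hlin, ← cfc_mul _ _ A (by fun_prop) hc, ← cfc_one ℂ A]
    exact cfc_congr fun z hz => mul_inv_cancel₀ (hne z hz)

/-- The function `2z / (1 + z²)`, written as `(z + i)⁻¹ + (z - i)⁻¹`. -/
noncomputable def resolventSum (z : ℂ) : ℂ := (z + Complex.I)⁻¹ + (z + -Complex.I)⁻¹

theorem resolventSum_zero : resolventSum 0 = 0 := by
  simp [resolventSum]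

theorem resolventSum_one : resolventSum 1 = 1 := by
  have h1 : (1 : ℂ) + Complex.I ≠ 0 := fun h => by simpa using congrArg Complex.re h
  have h2 : (1 : ℂ) + -Complex.I ≠ 0 := fun h => by simpa using congrArg Complex.re h
  rw [resolventSum, inv_add_inv h1 h2, div_eq_one_iff_eq (mul_ne_zero h1 h2)]
  have := Complex.I_sq
  linear_combination this

theorem norm_resolventSum_le {z : ℂ} (hz : z.im = 0) : ‖resolventSum z‖ ≤ 1 := by
  obtain ⟨x, rfl⟩ : ∃ x : ℝ, z = x := ⟨z.re, Complex.ext rfl (by simpa using hz)⟩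
  have h1 : (x : ℂ) + Complex.I ≠ 0 := fun h => by simpa using congrArg Complex.im h
  have h2 : (x : ℂ) + -Complex.I ≠ 0 := fun h => by simpa using congrArg Complex.im h
  have h3 : resolventSum x = ((2 * x / (x ^ 2 + 1) : ℝ) : ℂ) := by
    rw [resolventSum, inv_add_inv h1 h2]
    push_cast
    congr 1
    · ring
    · have := Complex.I_sq
      linear_combination -this
  rw [h3, Complex.norm_real, Real.norm_eq_abs, abs_div, abs_of_pos (by positivity : 0 < x ^ 2 + 1),
    div_le_one (by positivity), abs_le]
  constructor <;> nlinarith [sq_nonneg (x + 1), sq_nonneg (x - 1)]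

theorem continuousOn_resolventSum : ContinuousOn resolventSum {z | z.im = 0} := by
  refine ContinuousOn.add ?_ ?_ <;> refine ContinuousOn.inv₀ (by fun_prop) fun z hz h => ?_ <;>
    simpa [show z.im = 0 from hz] using congrArg Complex.im h

theorem IsSelfAdjoint.cfc_resolventSum {A : H →L[ℂ] H} (hA : IsSelfAdjoint A) :
    ContinuousOn resolventSum (spectrum ℂ A) ∧ cfc resolventSum A =
      cfc (fun z : ℂ => (z + Complex.I)⁻¹) A + cfc (fun z : ℂ => (z + -Complex.I)⁻¹) A := by
  have hc : ∀ w : ℂ, (w = Complex.I ∨ w = -Complex.I) →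
      ContinuousOn (fun z : ℂ => (z + w)⁻¹) (spectrum ℂ A) := fun w hw => by
    refine ContinuousOn.inv₀ (by fun_prop) fun z hz h0 => ?_
    have := hA.one_le_norm_add_of_mem_spectrum hw hz
    rw [h0, norm_zero] at this
    linarith
  exact ⟨(hc _ (Or.inl rfl)).add (hc _ (Or.inr rfl)),
    cfc_add A _ _ (hc _ (Or.inl rfl)) (hc _ (Or.inr rfl))⟩

/-- On the vectors (P + w)e_i, which are dense because P + w is onto, one has (A_n + w)⁻¹(P + w)e_i
− e_i = (A_n + w)⁻¹(P − A_n)e_i. The resolvents at ±i are contractions, so no bound on ‖A_n‖ is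
needed. -/
theorem tendsto_resolvent {A : ℕ → H →L[ℂ] H} {P : H →L[ℂ] H} (hA : ∀ n, IsSelfAdjoint (A n))
    (hP : IsSelfAdjoint P) {ι : Type*} {e : ι → H} (he : DenseRange e)
    (h : ∀ i, Tendsto (fun n => A n (e i)) atTop (𝓝 (P (e i)))) {w : ℂ}
    (hw : w = Complex.I ∨ w = -Complex.I) (x : H) :
    Tendsto (fun n => cfc (fun z : ℂ => (z + w)⁻¹) (A n) x) atTop
      (𝓝 (cfc (fun z : ℂ => (z + w)⁻¹) P x)) := by
  obtain ⟨-, hP1, hP2⟩ := hP.exists_resolvent hw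
  have hsurj : Function.Surjective (P + algebraMap ℂ (H →L[ℂ] H) w) := fun y =>
    ⟨cfc (fun z : ℂ => (z + w)⁻¹) P y, congrArg (fun T : H →L[ℂ] H => T y) hP2⟩
  have hdense : DenseRange fun i => (P + algebraMap ℂ (H →L[ℂ] H) w) (e i) :=
    hsurj.denseRange.comp he (ContinuousLinearMap.continuous _)
  refine ContinuousLinearMap.tendsto_of_denseRange (fun n => ((hA n).exists_resolvent hw).1)
    hdense (fun i => ?_) x
  have e1 : cfc (fun z : ℂ => (z + w)⁻¹) P ((P + algebraMap ℂ (H →L[ℂ] H) w) (e i)) = e i :=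
    congrArg (fun T : H →L[ℂ] H => T (e i)) hP1
  rw [e1, tendsto_iff_norm_sub_tendsto_zero]
  refine squeeze_zero (fun _ => norm_nonneg _) (fun n => ?_)
    (tendsto_iff_norm_sub_tendsto_zero.1 (h i))
  obtain ⟨hn, h1, -⟩ := (hA n).exists_resolvent hw
  have e2 : cfc (fun z : ℂ => (z + w)⁻¹) (A n) ((A n + algebraMap ℂ (H →L[ℂ] H) w) (e i)) = e i :=
    congrArg (fun T : H →L[ℂ] H => T (e i)) h1
  have e3 : cfc (fun z : ℂ => (z + w)⁻¹) (A n) ((P + algebraMap ℂ (H →L[ℂ] H) w) (e i)) - e i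
      = cfc (fun z : ℂ => (z + w)⁻¹) (A n) (P (e i) - A n (e i)) := by
    have e4 : P (e i) - A n (e i) = (P + algebraMap ℂ (H →L[ℂ] H) w) (e i) -
        (A n + algebraMap ℂ (H →L[ℂ] H) w) (e i) := by
      simp only [add_apply]
      abel
    rw [e4, map_sub, e2]
  rw [e3, norm_sub_rev (A n (e i))]
  exact (ContinuousLinearMap.le_of_opNorm_le _ hn _).trans (one_mul _).le

/-- If self-adjoint operators `A n` converge to a projection `P` on a dense set, then suitable
contractions in the closed star-algebras that they generate converge strongly to `P`. -/
theorem exists_contractions_tendsto {A : ℕ → H →L[ℂ] H} {P : H →L[ℂ] H}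
    (hA : ∀ n, IsSelfAdjoint (A n)) (hP : IsSelfAdjoint P) (hPP : IsIdempotentElem P)
    {ι : Type*} {e : ι → H} (he : DenseRange e)
    (h : ∀ i, Tendsto (fun n => A n (e i)) atTop (𝓝 (P (e i)))) :
    ∃ Y : ℕ → H →L[ℂ] H, (∀ n, Y n ∈ NonUnitalStarAlgebra.elemental ℂ (A n)) ∧
      (∀ n, ‖Y n‖ ≤ 1) ∧ ∀ x, Tendsto (fun n => Y n x) atTop (𝓝 (P x)) := by
  refine ⟨fun n => cfc resolventSum (A n), fun n => ?_, fun n => ?_, fun x => ?_⟩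
  -- Vanishing at 0 is what keeps the functional calculus inside the non-unital algebra generated by
  -- A_n.
  · have h0 : ContinuousOn resolventSum (quasispectrum ℂ (A n)) := by
      refine continuousOn_resolventSum.mono ?_
      rw [quasispectrum_eq_spectrum_union_zero]
      rintro z (hz | rfl)
      · exact (hA n).im_eq_zero_of_mem_spectrum hz
      · rfl
    show cfc resolventSum (A n) ∈ _
    rw [← cfcₙ_eq_cfc h0 resolventSum_zero]
    exact cfcₙ_mem_elemental _ _
  · exact norm_cfc_le zero_le_one fun z hz =>
      norm_resolventSum_le ((hA n).im_eq_zero_of_mem_spectrum hz)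
  -- The spectrum of a projection lies in {0, 1}, where the function agrees with the identity.
  · have hPeq : cfc resolventSum P = P := by
      have : IsStarNormal P := hP.isStarNormal
      conv_rhs => rw [← cfc_id ℂ P]
      refine cfc_congr fun z hz => ?_
      have hz2 : z = 0 ∨ z = 1 := IsIdempotentElem.spectrum_subset ℂ hPP hz
      rcases hz2 with rfl | rfl
      · exact resolventSum_zero
      · exact resolventSum_one
    have h1 := tendsto_resolvent hA hP he h (Or.inl rfl) x
    have h2 := tendsto_resolvent hA hP he h (Or.inr rfl) x
    have h3 := h1.add h2
    rw [← add_apply, ← hP.cfc_resolventSum.2, hPeq] at h3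
    refine h3.congr fun n => ?_
    rw [← add_apply, ← (hA n).cfc_resolventSum.2]

/-- A nondegenerate star-algebra of operators on a separable Hilbert space contains a bounded
sequence of self-adjoint operators that converges strongly to the identity. -/
theorem exists_selfAdjoint_tendsto_id [TopologicalSpace.SeparableSpace H] (𝒜 : NonUnitalStarSubalgebra ℂ (H →L[ℂ] H))
    (h𝒜 : ∀ x : H, ∀ ε > 0, ∃ b ∈ 𝒜, ∃ y, ‖b y - x‖ < ε) :
    ∃ e : ℕ → H →L[ℂ] H, (∀ n, e n ∈ 𝒜 ∧ IsSelfAdjoint (e n) ∧ ‖e n‖ ≤ 2) ∧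
      ∀ x, Tendsto (fun n => e n x) atTop (𝓝 x) := by
  let ℬ := 𝒜.topologicalClosure
  have : IsClosed (ℬ : Set (H →L[ℂ] H)) := 𝒜.isClosed_topologicalClosure
  let _ : PartialOrder ℬ := CStarAlgebra.spectralOrder ℬ
  have : StarOrderedRing ℬ := CStarAlgebra.spectralOrderedRing ℬ
  have hl := CStarAlgebra.increasingApproximateUnit ℬ
  have hne := hl.neBot
  have hconv : ∀ x : H, ∀ ε > 0, ∀ᶠ a : ℬ in CStarAlgebra.approximateUnit ℬ,
      ‖(a : H →L[ℂ] H) x - x‖ < ε := by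
    intro x ε hε
    obtain ⟨b, hb, y, hy⟩ := h𝒜 x (ε / 3) (by positivity)
    have h1 := hl.tendsto_mul_right ⟨b, 𝒜.le_topologicalClosure hb⟩
    have h2 : Tendsto (fun a : ℬ => ((a : H →L[ℂ] H) * b) y) (CStarAlgebra.approximateUnit ℬ)
        (𝓝 (b y)) :=
      ((ContinuousLinearMap.apply ℂ H y).continuous.comp continuous_subtype_val).continuousAt.tendsto.comp h1
    filter_upwards [hl.eventually_norm, Metric.tendsto_nhds.1 h2 (ε / 3) (by positivity)]
      with a ha1 ha2
    rw [dist_eq_norm] at ha2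
    -- Each of the three terms is below ε/3: the first because a approximates the unit, the other
    -- two because b y is close to x and a is a contraction.
    have e1 : (a : H →L[ℂ] H) x - x = (((a : H →L[ℂ] H) * b) y - b y) + (b y - x)
        - (a : H →L[ℂ] H) (b y - x) := by
      simp only [map_sub, mul_apply_eq_comp]
      abel
    have e2 : ‖(a : H →L[ℂ] H) (b y - x)‖ ≤ 1 * ‖b y - x‖ :=
      ContinuousLinearMap.le_of_opNorm_le _ ha1 _
    rw [e1]
    have e3 := norm_sub_le ((((a : H →L[ℂ] H) * b) y - b y) + (b y - x)) ((a : H →L[ℂ] H) (b y - x))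
    have e4 := norm_add_le (((a : H →L[ℂ] H) * b) y - b y) (b y - x)
    linarith
  obtain hH | hH := isEmpty_or_nonempty H
  · exact (hH.false 0).elim
  let d := TopologicalSpace.denseSeq H
  have key : ∀ n : ℕ, ∃ e ∈ 𝒜, IsSelfAdjoint e ∧ ‖e‖ < 2 ∧
      ∀ k ∈ Finset.range n, ‖e (d k) - d k‖ < 1 / ((n : ℝ) + 1) := by
    intro n
    have h1 := (Filter.eventually_all_finset (Finset.range n)).2
      fun k _ => hconv (d k) (1 / ((n : ℝ) + 1)) (by positivity)
    obtain ⟨a, ha, hsa, hna⟩ := (h1.and (hl.eventually_isSelfAdjoint.and hl.eventually_norm)).exists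
    -- The approximate unit lies only in the closure of 𝒜. Symmetrising T ↦ (T + T*)/2 is continuous
    -- and fixes a, so an element of 𝒜 near a can be made self-adjoint without leaving the open
    -- conditions satisfied by a.
    have hcont : Continuous fun T : H →L[ℂ] H => (2⁻¹ : ℂ) • (T + star T) := by fun_prop
    have hfix : (2⁻¹ : ℂ) • ((a : H →L[ℂ] H) + star (a : H →L[ℂ] H)) = a := by
      have h2 : star (a : H →L[ℂ] H) = a := congrArg Subtype.val hsa.star_eq
      rw [h2, ← two_smul ℂ (a : H →L[ℂ] H), smul_smul]
      norm_num
    have hopen : ∀ᶠ T in 𝓝 (a : H →L[ℂ] H), ‖T‖ < 2 ∧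
        ∀ k ∈ Finset.range n, ‖T (d k) - d k‖ < 1 / ((n : ℝ) + 1) := by
      refine (continuous_norm.continuousAt.eventually_lt continuousAt_const ?_).and
        ((Filter.eventually_all_finset _).2 fun k hk => ?_)
      · exact lt_of_le_of_lt hna one_lt_two
      · exact ContinuousAt.eventually_lt (by fun_prop) continuousAt_const (ha k hk)
    have htend := hcont.tendsto (a : H →L[ℂ] H)
    rw [hfix] at htend
    have hopen2 := htend.eventually hopen
    obtain ⟨T, hT, hTA⟩ := mem_closure_iff_nhds.1 a.2 _ hopen2
    refine ⟨_, SMulMemClass.smul_mem (2⁻¹ : ℂ) (add_mem hTA (star_mem hTA)), ?_, hT⟩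
    rw [isSelfAdjoint_iff, star_smul, star_add, star_star, add_comm]
    simp
  choose e he1 he2 he3 he4 using key
  refine ⟨e, fun n => ⟨he1 n, he2 n, (he3 n).le⟩, fun x => ?_⟩
  refine ContinuousLinearMap.tendsto_of_denseRange (T₀ := ContinuousLinearMap.id ℂ H)
    (fun n => (he3 n).le) (TopologicalSpace.denseRange_denseSeq H) (fun k => ?_) x
  rw [tendsto_iff_norm_sub_tendsto_zero]
  refine squeeze_zero' (Eventually.of_forall fun _ => norm_nonneg _) ?_
    tendsto_one_div_add_atTop_nhds_zero_nat
  filter_upwards [eventually_gt_atTop k] with n hn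
  exact (he4 n k (Finset.mem_range.2 hn)).le

/-! ### Matrices of operators -/

variable {K : Type*} [NormedAddCommGroup K] [InnerProductSpace ℂ K] [CompleteSpace K]
  {ι : Type*} [Fintype ι]

/-- The operators on an orthogonal sum whose matrix entries belong to a star-algebra. -/
def matrixSubalgebra (p : ι → K →L[ℂ] H) (hp : ∑ i, (p i).adjoint ∘L p i = 1)
    (𝒜 : NonUnitalStarSubalgebra ℂ (H →L[ℂ] H)) : NonUnitalStarSubalgebra ℂ (K →L[ℂ] K) where
  carrier := {T | ∀ i j, p i ∘L T ∘L (p j).adjoint ∈ 𝒜}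
  zero_mem' i j := by
    simp
  add_mem' {S T} hS hT i j := by
    have h : p i ∘L (S + T) ∘L (p j).adjoint
        = p i ∘L S ∘L (p j).adjoint + p i ∘L T ∘L (p j).adjoint := by
      ext x; simp
    rw [h]
    exact 𝒜.add_mem (hS i j) (hT i j)
  smul_mem' c T hT i j := by
    have h : p i ∘L (c • T) ∘L (p j).adjoint = c • (p i ∘L T ∘L (p j).adjoint) := by
      ext x; simp
    rw [h]
    exact SMulMemClass.smul_mem c (hT i j)
  mul_mem' {S T} hS hT i j := by
    have h : p i ∘L (S * T) ∘L (p j).adjoint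
        = ∑ k, (p i ∘L S ∘L (p k).adjoint) * (p k ∘L T ∘L (p j).adjoint) := by
      ext x
      have h1 := congrArg (fun A : K →L[ℂ] K => A (T ((p j).adjoint x))) hp
      simp only [sum_apply, ContinuousLinearMap.comp_apply] at h1
      simp only [sum_apply, ContinuousLinearMap.comp_apply, mul_apply_eq_comp]
      rw [← map_sum, ← map_sum, h1]
      rfl
    rw [h]
    exact sum_mem fun k _ => 𝒜.mul_mem (hS i k) (hT k j)
  star_mem' {T} hT i j := by
    have h : p i ∘L star T ∘L (p j).adjoint = star (p j ∘L T ∘L (p i).adjoint) := by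
      simp only [ContinuousLinearMap.star_eq_adjoint, ContinuousLinearMap.adjoint_comp,
        ContinuousLinearMap.adjoint_adjoint, ContinuousLinearMap.comp_assoc]
    rw [h]
    exact star_mem (hT j i)

/-- A projection on an orthogonal sum whose matrix entries, and their adjoints, are limits on a
dense set of sequences from a star-algebra is a strong limit of a bounded sequence of matrices over
that algebra. -/
theorem exists_matrix_tendsto [DecidableEq ι] (p : ι → K →L[ℂ] H)
    (hp : ∑ i, (p i).adjoint ∘L p i = 1)
    (hpo : ∀ i j, p i ∘L (p j).adjoint = if i = j then 1 else 0)
    (𝒜 : NonUnitalStarSubalgebra ℂ (H →L[ℂ] H)) {P : K →L[ℂ] K} (hP : IsSelfAdjoint P)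
    (hPP : IsIdempotentElem P) {α : Type*} {d : α → H} (hd : DenseRange d)
    (h : ∀ i j, ∃ a : ℕ → H →L[ℂ] H, (∀ n, a n ∈ 𝒜) ∧
      (∀ m, Tendsto (fun n => a n (d m)) atTop (𝓝 (p i (P ((p j).adjoint (d m)))))) ∧
      (∀ m, Tendsto (fun n => (a n).adjoint (d m)) atTop (𝓝 (p j (P ((p i).adjoint (d m))))))) :
    ∃ Y : ℕ → K →L[ℂ] K, (∀ n i j, p i ∘L Y n ∘L (p j).adjoint ∈ 𝒜) ∧ (∀ n, ‖Y n‖ ≤ 2) ∧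
      ∀ x, Tendsto (fun n => Y n x) atTop (𝓝 (P x)) := by
  choose a ha1 ha2 ha3 using h
  have hp' : ∀ x, ∑ i, (p i).adjoint (p i x) = x := fun x => by
    have h1 := congrArg (fun A : K →L[ℂ] K => A x) hp
    simp only [sum_apply, ContinuousLinearMap.comp_apply] at h1
    exact h1
  have hpo' : ∀ i j x, p i ((p j).adjoint x) = if i = j then x else 0 := fun i j x => by
    have h1 := congrArg (fun A : H →L[ℂ] H => A x) (hpo i j)
    simp only [ContinuousLinearMap.comp_apply] at h1
    rw [h1]
    split_ifs <;> rfl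
  let M : ℕ → K →L[ℂ] K := fun n => ∑ i, ∑ j, (p i).adjoint ∘L a i j n ∘L p j
  have hMA : ∀ n, M n ∈ matrixSubalgebra p hp 𝒜 := by
    intro n k l
    have h1 : p k ∘L M n ∘L (p l).adjoint = a k l n := by
      ext x
      simp only [M, sum_apply, ContinuousLinearMap.comp_apply, map_sum, hpo']
      rw [Finset.sum_eq_single k, Finset.sum_eq_single l]
      · simp
      · intro j _ hj
        simp [hj]
      · simp
      · intro i _ hi
        simp [hi.symm]
      · simp
    rw [h1]
    exact ha1 k l n
  have hMs : ∀ n x, star (M n) x = ∑ i, ∑ j, (p j).adjoint ((a i j n).adjoint (p i x)) := by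
    intro n x
    simp only [M, star_sum, ContinuousLinearMap.star_eq_adjoint, ContinuousLinearMap.adjoint_comp,
        ContinuousLinearMap.adjoint_adjoint, sum_apply,
        ContinuousLinearMap.comp_apply]
  -- Strong convergence is not inherited by adjoints, which is why the hypothesis contains both
  -- limits: they give M_n → P and M_n* → P on a dense set, hence the same for the self-adjoint
  -- averages.
  let A : ℕ → K →L[ℂ] K := fun n => (2⁻¹ : ℂ) • (M n + star (M n))
  have hA : ∀ n, IsSelfAdjoint (A n) := fun n => by
    rw [isSelfAdjoint_iff, star_smul, star_add, star_star, add_comm]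
    simp [A]
  have hAA : ∀ n, A n ∈ matrixSubalgebra p hp 𝒜 := fun n =>
    SMulMemClass.smul_mem (2⁻¹ : ℂ) (add_mem (hMA n) (star_mem (hMA n)))
  let e : (ι → α) → K := fun m => ∑ j, (p j).adjoint (d (m j))
  have he : DenseRange e := by
    have h1 : DenseRange (fun m : ι → α => fun j => d (m j)) := DenseRange.piMap fun _ => hd
    have h2 : Function.Surjective fun y : ι → H => ∑ j, (p j).adjoint (y j) :=
      fun x => ⟨fun j => p j x, hp' x⟩
    exact h2.denseRange.comp h1 (by fun_prop)
  have hpe : ∀ i m, p i (e m) = d (m i) := fun i m => by simp [e, hpo']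
  have hlim : ∀ m, Tendsto (fun n => A n (e m)) atTop (𝓝 (P (e m))) := by
    intro m
    have hPe : ∀ i, p i (P (e m)) = ∑ j, p i (P ((p j).adjoint (d (m j)))) := fun i => by
      simp [e]
    have h1 : Tendsto (fun n => M n (e m)) atTop (𝓝 (P (e m))) := by
      rw [← hp' (P (e m))]
      simp only [hPe, map_sum, M, sum_apply, ContinuousLinearMap.comp_apply, hpe]
      exact tendsto_finsetSum _ fun i _ => tendsto_finsetSum _ fun j _ =>
        ((p i).adjoint.continuous.tendsto _).comp (ha2 i j (m j))
    have h2 : Tendsto (fun n => star (M n) (e m)) atTop (𝓝 (P (e m))) := by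
      rw [← hp' (P (e m))]
      simp only [hPe, map_sum, hMs, hpe]
      rw [Finset.sum_comm]
      exact tendsto_finsetSum _ fun i _ => tendsto_finsetSum _ fun j _ =>
        ((p j).adjoint.continuous.tendsto _).comp (ha3 i j (m i))
    have h3 := (h1.add h2).const_smul (2⁻¹ : ℂ)
    rw [← two_smul ℂ (P (e m)), smul_smul, inv_mul_cancel₀ two_ne_zero, one_smul] at h3
    exact h3
  obtain ⟨Z, hZ1, hZ2, hZ3⟩ := exists_contractions_tendsto hA hP hPP he hlim
  have hZc : ∀ n, Z n ∈ closure (matrixSubalgebra p hp 𝒜 : Set (K →L[ℂ] K)) := fun n =>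
    NonUnitalStarAlgebra.elemental.le_of_mem
      (s := (matrixSubalgebra p hp 𝒜).topologicalClosure)
      (matrixSubalgebra p hp 𝒜).isClosed_topologicalClosure
      ((matrixSubalgebra p hp 𝒜).le_topologicalClosure (hAA n)) (hZ1 n)
  -- The contractions Z_n lie in the norm closure of the matrix algebra. Moving each into the
  -- algebra at cost 1/(n+1) ≤ 1 keeps the strong limit and explains the bound 2.
  have hpos : ∀ n : ℕ, (0 : ℝ) < 1 / ((n : ℝ) + 1) := fun n => by positivity
  choose Y hY1 hY2 using fun n => Metric.mem_closure_iff.1 (hZc n) _ (hpos n)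
  refine ⟨Y, hY1, fun n => ?_, fun x => ?_⟩
  · have h1 := hY2 n
    rw [dist_eq_norm] at h1
    have h2 : 1 / ((n : ℝ) + 1) ≤ 1 := by
      rw [div_le_one (by positivity)]
      linarith [Nat.cast_nonneg (α := ℝ) n]
    have h3 := norm_sub_norm_le (Y n) (Z n)
    rw [norm_sub_rev] at h3
    linarith [hZ2 n]
  · have h1 : Tendsto (fun n => Y n - Z n) atTop (𝓝 0) := by
      refine squeeze_zero_norm (fun n => ?_) tendsto_one_div_add_atTop_nhds_zero_nat
      rw [norm_sub_rev, ← dist_eq_norm]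
      exact (hY2 n).le
    have h2 := ((ContinuousLinearMap.apply ℂ K x).continuous.tendsto _).comp h1
    have h3 := h2.add (hZ3 x)
    rw [map_zero, zero_add] at h3
    refine h3.congr fun n => ?_
    simp

end StrongLimits

/-! ### Functions on `G` from invariant kernels -/

namespace TopGroupoid

variable {X G : Type*} [TopologicalSpace X] [TopologicalSpace G] [T2Space G]
  [LocallyCompactSpace G] [SecondCountableTopology G] [MeasurableSpace G] [BorelSpace G]
  (𝒢 : TopGroupoid X G)

/-- Closed subsets of G × G are σ-compact and division is continuous on B, so the image is a
countable union of compact sets. -/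
theorem measurableSet_image_ldiv {B : Set (G × G)} (hB : IsClosed B)
    (hr : ∀ p ∈ B, 𝒢.r p.1 = 𝒢.r p.2) :
    MeasurableSet ((fun p : G × G => 𝒢.ldiv p.1 p.2) '' B) := by
  obtain ⟨K, hK, hKB⟩ := (isSigmaCompact_univ.of_isClosed_subset hB
    (subset_univ B)).image_of_continuousOn (𝒢.continuousOn_ldiv.mono hr)
  rw [← hKB]
  exact MeasurableSet.iUnion fun n => (hK n).measurableSet

/-- The element γ = t' t⁻¹ belongs to the isotropy group at u and carries (t, x) to (t', x'). -/
theorem eq_of_ldiv_eq {κ : G × G → ℂ} {u : X}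
    (hinv : ∀ γ t x, 𝒢.r γ = u → 𝒢.s γ = u → 𝒢.r t = u → 𝒢.r x = u →
      κ (𝒢.mul γ t, 𝒢.mul γ x) = κ (t, x)) {t x t' x' : G} (ht : 𝒢.r t = u) (hx : 𝒢.r x = u)
    (ht' : 𝒢.r t' = u) (hx' : 𝒢.r x' = u) (h : 𝒢.ldiv t x = 𝒢.ldiv t' x') :
    κ (t, x) = κ (t', x') := by
  have hs : 𝒢.s t = 𝒢.s t' := by
    rw [← 𝒢.r_ldiv (ht.trans hx.symm), h, 𝒢.r_ldiv (ht'.trans hx'.symm)]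
  have hc : 𝒢.s t' = 𝒢.r (𝒢.inv t) := by rw [𝒢.r_inv, hs]
  have e0 : 𝒢.s (𝒢.mul t' (𝒢.inv t)) = u := by rw [𝒢.s_mul _ _ hc, 𝒢.s_inv, ht]
  have e1 : 𝒢.mul (𝒢.mul t' (𝒢.inv t)) t = t' := by
    rw [𝒢.mul_assoc _ _ _ hc (𝒢.s_inv t), 𝒢.inv_mul, hs, 𝒢.mul_unit]
  have e2 : 𝒢.mul (𝒢.mul t' (𝒢.inv t)) x = x' := by
    rw [𝒢.mul_assoc _ _ _ hc (by rw [𝒢.s_inv, ht, hx]), ← 𝒢.ldiv_eq (ht.trans hx.symm), h,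
      𝒢.mul_ldiv (ht'.trans hx'.symm)]
  rw [← hinv (𝒢.mul t' (𝒢.inv t)) t x (by rw [𝒢.r_mul _ _ hc, ht']) e0 ht hx, e1, e2]

/-- An invariant continuous kernel `κ` on a fibre has the form `κ (t, x) = F (t⁻¹ x)` with a Borel
function `F`. -/
theorem exists_measurable_kernel {κ : G × G → ℂ} {u : X}
    (hκ : ContinuousOn κ {p | 𝒢.r p.1 = u ∧ 𝒢.r p.2 = u})
    (hinv : ∀ γ t x, 𝒢.r γ = u → 𝒢.s γ = u → 𝒢.r t = u → 𝒢.r x = u →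
      κ (𝒢.mul γ t, 𝒢.mul γ x) = κ (t, x)) :
    ∃ F : G → ℂ, Measurable F ∧ (∀ t x, 𝒢.r t = u → 𝒢.r x = u → F (𝒢.ldiv t x) = κ (t, x)) ∧
      ∀ y, F y = 0 ∨ ∃ p : G × G, F y = κ p := by
  classical
  let W : Set (G × G) := {p | 𝒢.r p.1 = u ∧ 𝒢.r p.2 = u}
  have hW : IsClosed W := ((𝒢.isClosed_fiber u).preimage continuous_fst).inter
    ((𝒢.isClosed_fiber u).preimage continuous_snd)
  have hWr : ∀ p ∈ W, 𝒢.r p.1 = 𝒢.r p.2 := fun p hp => hp.1.trans hp.2.symm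
  let D : G × G → G := fun p => 𝒢.ldiv p.1 p.2
  let F : G → ℂ := fun y => if h : ∃ p ∈ W, D p = y then κ h.choose else 0
  have hF : ∀ p ∈ W, F (D p) = κ p := by
    intro p hp
    have h : ∃ q ∈ W, D q = D p := ⟨p, hp, rfl⟩
    have h1 := h.choose_spec
    show (if h : ∃ q ∈ W, D q = D p then κ h.choose else 0) = κ p
    rw [dif_pos h]
    exact 𝒢.eq_of_ldiv_eq hinv h1.1.1 h1.1.2 hp.1 hp.2 h1.2
  have hF0 : ∀ y, y ∉ D '' W → F y = 0 := fun y hy => dif_neg hy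
  refine ⟨F, measurable_of_isClosed fun C hC => ?_, fun t x ht hx => hF (t, x) ⟨ht, hx⟩,
    fun y => ?_⟩
  · have hB : IsClosed (W ∩ κ ⁻¹' C) := hκ.preimage_isClosed_of_isClosed hW hC
    have h1 : MeasurableSet (D '' (W ∩ κ ⁻¹' C)) :=
      𝒢.measurableSet_image_ldiv hB fun p hp => hWr p hp.1
    have h2 : MeasurableSet (D '' W) := 𝒢.measurableSet_image_ldiv hW hWr
    have h3 : F ⁻¹' C = D '' (W ∩ κ ⁻¹' C) ∪ ((D '' W)ᶜ ∩ {_y | (0 : ℂ) ∈ C}) := by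
      ext y
      by_cases hy : y ∈ D '' W
      · obtain ⟨p, hp, rfl⟩ := hy
        constructor
        · intro h
          exact Or.inl ⟨p, ⟨hp, by rw [mem_preimage, ← hF p hp]; exact h⟩, rfl⟩
        · rintro (⟨q, hq, hqp⟩ | h)
          · rw [mem_preimage, ← hqp, hF q hq.1]
            exact hq.2
          · exact absurd ⟨p, hp, rfl⟩ h.1
      · constructor
        · intro h
          rw [mem_preimage, hF0 y hy] at h
          exact Or.inr ⟨hy, h⟩
        · rintro (⟨q, hq, hqp⟩ | h)
          · exact absurd ⟨q, hq.1, hqp⟩ hy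
          · rw [mem_preimage, hF0 y hy]
            exact h.2
    rw [h3]
    exact h1.union (h2.compl.inter (MeasurableSet.const _))
  · by_cases hy : y ∈ D '' W
    · obtain ⟨p, hp, rfl⟩ := hy
      exact Or.inr ⟨p, hF p hp⟩
    · exact Or.inl (hF0 y hy)

end TopGroupoid

/-! ### Operators commuting with the isotropy group as limits of right convolutions. -/

namespace HaarSystem

variable {X G : Type*} [TopologicalSpace X] [TopologicalSpace G] [T2Space G]
  [LocallyCompactSpace G] [SecondCountableTopology G] [MeasurableSpace G] [BorelSpace G]
  {𝒢 : TopGroupoid X G} (Λ : HaarSystem 𝒢)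

theorem inner_V {u v : X} {t : G} (hr : 𝒢.r t = u) (hs : 𝒢.s t = v) (ξ η : Λ.L2 v) :
    inner ℂ (Λ.V u v t ξ) (Λ.V u v t η) = inner ℂ ξ η := by
  rw [V, dif_pos ⟨hr, hs⟩]
  exact LinearIsometry.inner_map_map _ _ _

/-- The star-algebra of right convolution operators on a fibre. -/
noncomputable def rconvAlgebra (u : X) : NonUnitalStarSubalgebra ℂ (Λ.L2 u →L[ℂ] Λ.L2 u) where
  carrier := range (Λ.rconv u)
  zero_mem' := ⟨0, by
    have h := Λ.rconv_smul u 0 0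
    rwa [zero_smul, zero_smul] at h⟩
  add_mem' := by
    rintro _ _ ⟨F, rfl⟩ ⟨f, rfl⟩
    exact ⟨F + f, Λ.rconv_add u F f⟩
  smul_mem' := by
    rintro c _ ⟨F, rfl⟩
    exact ⟨c • F, Λ.rconv_smul u c F⟩
  mul_mem' := by
    rintro _ _ ⟨F, rfl⟩ ⟨f, rfl⟩
    exact ⟨Λ.conv f F, (Λ.rconv_comp u F f).symm⟩
  star_mem' := by
    rintro _ ⟨F, rfl⟩
    exact ⟨𝒢.invol F, (Λ.adjoint_rconv u F).symm⟩

/-- Right convolution operators approximate the identity of a fibre. -/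
theorem exists_rconv_selfAdjoint_tendsto_id (u : X) :
    ∃ A : ℕ → C_c(G, ℂ), (∀ n, IsSelfAdjoint (Λ.rconv u (A n)) ∧ ‖Λ.rconv u (A n)‖ ≤ 2) ∧
      ∀ ξ, Tendsto (fun n => Λ.rconv u (A n) ξ) atTop (𝓝 ξ) := by
  obtain ⟨e, he1, he2⟩ := exists_selfAdjoint_tendsto_id (Λ.rconvAlgebra u) fun ξ ε hε => by
    obtain ⟨f, hf⟩ := Metric.mem_closure_range_iff.1 (Λ.denseRange_restr u ξ) (ε / 2) (by positivity)
    -- Nondegeneracy: F_n * f tends to f, and F_n * f is right convolution by f applied to the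
    -- vector F_n.
    obtain ⟨F, -, -, -, hF⟩ := Λ.exists_approximate_identity
    have h1 := ((Λ.ev u).continuous.tendsto _).comp (hF (Λ.incl f))
    obtain ⟨n, hn⟩ := (Metric.tendsto_nhds.1 h1 (ε / 2) (by positivity)).exists
    refine ⟨Λ.rconv u f, ⟨f, rfl⟩, Λ.restr u (F n), ?_⟩
    have h2 : Λ.ev u (Λ.L (F n) (Λ.incl f)) = Λ.rconv u f (Λ.restr u (F n)) := by
      rw [L_incl, ev_incl, rconv_restr]
    rw [Function.comp_apply, h2, ev_incl, dist_eq_norm] at hn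
    rw [dist_comm, dist_eq_norm] at hf
    have h3 := norm_sub_le_norm_sub_add_norm_sub (Λ.rconv u f (Λ.restr u (F n))) (Λ.restr u f) ξ
    linarith
  choose A hA using fun n => (he1 n).1
  refine ⟨A, fun n => ?_, fun ξ => ?_⟩
  · rw [hA]
    exact (he1 n).2
  · simp only [hA]
    exact he2 ξ

theorem inner_rconv_restr (u : X) (A f : C_c(G, ℂ)) (h : Λ.L2 u) :
    inner ℂ h (Λ.rconv u A (Λ.restr u f))
      = ∫ t, f t * inner ℂ h (Λ.trans u t (Λ.incl A)) ∂(Λ.measure u) := by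
  rw [← inner_L, L_incl, ev_incl, rconv_restr]

theorem enorm_restr (u : X) (f : C_c(G, ℂ)) : ‖Λ.restr u f‖ₑ = eLpNorm f 2 (Λ.measure u) :=
  Lp.enorm_toLp (f.continuous.memLp_of_hasCompactSupport f.hasCompactSupport)

/-- For h = f in C_c(G) the function has the same modulus as f * A^*, so its norm is controlled by
right convolution by A^*. Fatou's lemma extends the bound to every h. -/
theorem eLpNorm_inner_trans_le (u : X) (A : C_c(G, ℂ)) (h : Λ.L2 u) :
    eLpNorm (fun x => inner ℂ h (Λ.trans u x (Λ.incl A))) 2 (Λ.measure u)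
      ≤ ‖Λ.rconv u (𝒢.invol A)‖ₑ * ‖h‖ₑ := by
  have h1 : ∀ f : C_c(G, ℂ),
      eLpNorm (fun x => inner ℂ (Λ.restr u f) (Λ.trans u x (Λ.incl A))) 2 (Λ.measure u)
        ≤ ‖Λ.rconv u (𝒢.invol A)‖ₑ * ‖Λ.restr u f‖ₑ := by
    intro f
    have h2 : eLpNorm (fun x => inner ℂ (Λ.restr u f) (Λ.trans u x (Λ.incl A))) 2 (Λ.measure u)
        = eLpNorm (Λ.conv f (𝒢.invol A)) 2 (Λ.measure u) := by
      refine eLpNorm_congr_norm_ae ?_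
      filter_upwards [Λ.ae_mem_fiber u] with x hx
      rw [Λ.inner_restr_trans hx, Λ.conv_apply _ _ hx, ← RCLike.norm_conj, ← integral_conj]
      congr 1
      refine integral_congr_ae ?_
      filter_upwards [Λ.ae_mem_fiber u] with y hy
      rw [invol_ldiv A (hy.trans hx.symm), map_mul, Complex.conj_conj]
    rw [h2, ← enorm_restr, ← rconv_restr]
    exact ContinuousLinearMap.le_opENorm _ _
  obtain ⟨a, ha, hlim⟩ := mem_closure_iff_seq_limit.1 (Λ.denseRange_restr u h)
  choose f hf using ha
  have hmeas : ∀ k : Λ.L2 u, AEStronglyMeasurable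
      (fun x => inner ℂ k (Λ.trans u x (Λ.incl A))) (Λ.measure u) := fun k =>
    (innerSL ℂ k).continuous.comp_aestronglyMeasurable (Λ.aestronglyMeasurable_trans u _)
  refine (Lp.eLpNorm_lim_le_liminf_eLpNorm
    (f := fun n x => inner ℂ (Λ.restr u (f n)) (Λ.trans u x (Λ.incl A))) (fun n => hmeas _) _
    (Eventually.of_forall fun x => ?_)).trans ?_
  · simp only [hf]
    exact hlim.inner tendsto_const_nhds
  · have h3 : Tendsto (fun n => ‖Λ.rconv u (𝒢.invol A)‖ₑ * ‖Λ.restr u (f n)‖ₑ) atTop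
        (𝓝 (‖Λ.rconv u (𝒢.invol A)‖ₑ * ‖h‖ₑ)) := by
      simp only [hf]
      exact ENNReal.Tendsto.const_mul hlim.enorm (Or.inr enorm_ne_top)
    rw [← h3.liminf_eq]
    exact liminf_le_liminf (Eventually.of_forall fun n => h1 (f n))

/-- The kernel of the operator `E Q E`, where `E` is right convolution by `A`. -/
theorem inner_rconv_mul_rconv {u : X} {A : C_c(G, ℂ)} (hA : IsSelfAdjoint (Λ.rconv u A))
    (Q : Λ.L2 u →L[ℂ] Λ.L2 u) {F : G → ℂ} (hF : Measurable F) {c : ℝ} (hc : ∀ y, ‖F y‖ ≤ c)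
    (hFQ : ∀ t x, 𝒢.r t = u → 𝒢.r x = u → F (𝒢.ldiv t x)
      = inner ℂ (Λ.trans u x (Λ.incl A)) (Q (Λ.trans u t (Λ.incl A)))) (k f : C_c(G, ℂ)) :
    inner ℂ (Λ.restr u k) (Λ.rconv u A (Q (Λ.rconv u A (Λ.restr u f))))
      = ∫ p, f p.1 * k.conj p.2 * F (𝒢.ldiv p.1 p.2) ∂((Λ.measure u).prod (Λ.measure u)) := by
  rw [integral_prod _ (Λ.integrable_kernel u f k.conj
    (g := fun p => F (𝒢.ldiv p.1 p.2)) (hF.comp 𝒢.measurable_ldiv) fun p => hc _)]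
  have h1 : inner ℂ (Λ.restr u k) (Λ.rconv u A (Q (Λ.rconv u A (Λ.restr u f))))
      = inner ℂ (Q.adjoint (Λ.rconv u A (Λ.restr u k))) (Λ.rconv u A (Λ.restr u f)) := by
    rw [ContinuousLinearMap.adjoint_inner_left, ← ContinuousLinearMap.adjoint_inner_left,
      ← ContinuousLinearMap.star_eq_adjoint, hA.star_eq]
  rw [h1, inner_rconv_restr]
  refine integral_congr_ae ?_
  filter_upwards [Λ.ae_mem_fiber u] with t ht
  rw [ContinuousLinearMap.adjoint_inner_left, ← inner_conj_symm, inner_rconv_restr,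
    ← integral_conj, ← integral_const_mul]
  refine integral_congr_ae ?_
  filter_upwards [Λ.ae_mem_fiber u] with x hx
  rw [hFQ t x ht hx, map_mul, inner_conj_symm]
  show f t * ((starRingEnd ℂ) (k x) * _) = f t * (starRingEnd ℂ) (k x) * _
  ring

theorem eLpNorm_mul_prod (u : X) (a b : C_c(G, ℂ)) :
    eLpNorm (fun p : G × G => a p.1 * b p.2) 2 ((Λ.measure u).prod (Λ.measure u))
      = ‖Λ.restr u a‖ₑ * ‖Λ.restr u b‖ₑ := by
  rw [enorm_restr, enorm_restr]
  simp only [eLpNorm_eq_lintegral_rpow_enorm_toReal (two_ne_zero) (ENNReal.ofNat_ne_top (n := 2))]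
  rw [← ENNReal.mul_rpow_of_nonneg _ _ (by positivity), ← lintegral_prod_mul]
  · simp only [enorm_mul]
    congr 1
    refine lintegral_congr fun p => ?_
    rw [ENNReal.mul_rpow_of_nonneg _ _ (by positivity)]
  · exact (a.continuous.enorm.measurable.pow_const _).aemeasurable
  · exact (b.continuous.enorm.measurable.pow_const _).aemeasurable

/-- Cauchy–Schwarz for a kernel that only depends on `t⁻¹ x`, localised to a set `S`. -/
theorem enorm_integral_kernel_le (u : X) (a b : C_c(G, ℂ)) {D : G → ℂ} (hD : Measurable D)
    {S : Set (G × G)} (hab : ∀ p ∉ S, a p.1 * b p.2 = 0) :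
    ‖∫ p, a p.1 * b p.2 * D (𝒢.ldiv p.1 p.2) ∂((Λ.measure u).prod (Λ.measure u))‖ₑ
      ≤ ‖Λ.restr u a‖ₑ * ‖Λ.restr u b‖ₑ * eLpNorm D 2
        ((((Λ.measure u).prod (Λ.measure u)).restrict S).map fun p => 𝒢.ldiv p.1 p.2) := by
  rw [← setIntegral_eq_integral_of_forall_compl_eq_zero (s := S)
    (fun p hp => by rw [hab p hp, zero_mul]), ← eLpNorm_mul_prod,
    eLpNorm_map_measure hD.aestronglyMeasurable 𝒢.measurable_ldiv.aemeasurable]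
  refine (enorm_integral_le_lintegral_enorm _).trans ?_
  rw [← eLpNorm_one_eq_lintegral_enorm]
  have hab2 : AEStronglyMeasurable (fun p : G × G => a p.1 * b p.2)
      (((Λ.measure u).prod (Λ.measure u)).restrict S) :=
    Continuous.aestronglyMeasurable (by fun_prop)
  refine (eLpNorm_smul_le_mul_eLpNorm (p := 2) (q := 2) (r := 1)
    (f := D ∘ fun p : G × G => 𝒢.ldiv p.1 p.2) (φ := fun p : G × G => a p.1 * b p.2)
    (hD.comp 𝒢.measurable_ldiv).aestronglyMeasurable hab2).trans ?_
  gcongr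
  exact Measure.restrict_le_self

theorem norm_le_of_inner_restr {u : X} {ξ : Λ.L2 u} {c : ℝ} (hc : 0 ≤ c)
    (h : ∀ k, ‖inner ℂ (Λ.restr u k) ξ‖ ≤ c * ‖Λ.restr u k‖) : ‖ξ‖ ≤ c := by
  have h1 : ∀ v : Λ.L2 u, ‖inner ℂ v ξ‖ ≤ c * ‖v‖ := fun v =>
    (Λ.denseRange_restr u).induction_on (p := fun v => ‖inner ℂ v ξ‖ ≤ c * ‖v‖) v
      (isClosed_le (by fun_prop) (by fun_prop)) h
  have h2 := h1 ξ
  rw [inner_self_eq_norm_sq_to_K] at h2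
  norm_num at h2
  by_contra! h3
  nlinarith

theorem lintegral_rpow_le_of_eLpNorm_le {μ : Measure G} {f : G → ℂ} {c : ℝ≥0∞}
    (h : eLpNorm f 2 μ ≤ c) :
    ∫⁻ x, ‖f x‖ₑ ^ (2 : ℝ≥0∞).toReal ∂μ ≤ c ^ (2 : ℝ≥0∞).toReal := by
  rwa [eLpNorm_eq_lintegral_rpow_enorm_toReal two_ne_zero (by simp),
    one_div, ENNReal.rpow_inv_le_iff (by norm_num)] at h

/-- On each of the two strips the unrestricted variable is integrated first. -/
theorem setLIntegral_prod_univ_le {μ : Measure G} [SFinite μ] (C : Set G) {g : G × G → ℝ≥0∞}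
    (hg : Measurable g) {c : ℝ≥0∞} (h1 : ∀ᵐ t ∂μ, ∫⁻ x, g (t, x) ∂μ ≤ c)
    (h2 : ∀ᵐ x ∂μ, ∫⁻ t, g (t, x) ∂μ ≤ c) :
    ∫⁻ p in C ×ˢ univ ∪ univ ×ˢ C, g p ∂(μ.prod μ) ≤ c * μ C + c * μ C := by
  refine (lintegral_union_le _ _ _).trans (add_le_add ?_ ?_)
  · rw [← Measure.prod_restrict, Measure.restrict_univ, lintegral_prod _ hg.aemeasurable,
      ← setLIntegral_const]
    exact lintegral_mono_ae (ae_restrict_of_ae h1)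
  · rw [← Measure.prod_restrict, Measure.restrict_univ, lintegral_prod_symm _ hg.aemeasurable,
      ← setLIntegral_const]
    exact lintegral_mono_ae (ae_restrict_of_ae h2)

/-- If t⁻¹x lies in K, then t in C puts x in CK, and x in C puts t in CK⁻¹; both products are
compact. Restricting to pairs with one coordinate in C makes the image measure one for which C_c(G)
is dense in L². -/
theorem isFiniteMeasureOnCompacts_map_ldiv (u : X) {C : Set G} (hC : IsCompact C) :
    IsFiniteMeasureOnCompacts ((((Λ.measure u).prod (Λ.measure u)).restrict
      (C ×ˢ univ ∪ univ ×ˢ C)).map fun p => 𝒢.ldiv p.1 p.2) := by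
  refine ⟨fun K hK => ?_⟩
  have hm := 𝒢.measurable_ldiv hK.measurableSet
  rw [Measure.map_apply 𝒢.measurable_ldiv hK.measurableSet, Measure.restrict_apply hm]
  have hK' : IsCompact (𝒢.inv '' K) := hK.image 𝒢.continuous_inv
  refine lt_of_le_of_lt (measure_mono_ae ?_)
    ((hC.prod (𝒢.isCompact_mul hC hK)).union
      ((𝒢.isCompact_mul hC hK').prod hC)).measure_lt_top
  filter_upwards [Λ.ae_prod_fiber u] with p hp
  have hr := hp.1.trans hp.2.symm
  rintro ⟨hpK, h | h⟩
  · exact Or.inl ⟨h.1, 𝒢.mem_mul_of_ldiv_mem h.1 hr hpK⟩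
  · refine Or.inr ⟨𝒢.mem_mul_of_ldiv_mem h.2 hr.symm ?_, h.2⟩
    exact ⟨_, hpK, 𝒢.inv_ldiv hr⟩

theorem continuousOn_kernel (u : X) (A : C_c(G, ℂ)) (Q : Λ.L2 u →L[ℂ] Λ.L2 u) :
    ContinuousOn (fun p : G × G =>
      inner ℂ (Λ.trans u p.2 (Λ.incl A)) (Q (Λ.trans u p.1 (Λ.incl A))))
      {p | 𝒢.r p.1 = u ∧ 𝒢.r p.2 = u} := by
  have h := Λ.continuousOn_trans u (Λ.incl A)
  have h1 := h.comp (f := fun p : G × G => p.1) (s := {p | 𝒢.r p.1 = u ∧ 𝒢.r p.2 = u})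
    (by fun_prop) fun p hp => hp.1
  have h2 := h.comp (f := fun p : G × G => p.2) (s := {p | 𝒢.r p.1 = u ∧ 𝒢.r p.2 = u})
    (by fun_prop) fun p hp => hp.2
  exact ContinuousOn.inner h2 (Q.continuous.comp_continuousOn h1)

/-- For an operator `Q` on a fibre that commutes with the left translations by the isotropy group,
the kernel of `E Q E` is a function of `t⁻¹ x`. -/
theorem exists_measurable_kernel {u : X} (A : C_c(G, ℂ)) {Q : Λ.L2 u →L[ℂ] Λ.L2 u}
    (hQ : ∀ γ, 𝒢.r γ = u → 𝒢.s γ = u → ∀ ξ, Q (Λ.V u u γ ξ) = Λ.V u u γ (Q ξ)) :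
    ∃ F : G → ℂ, Measurable F ∧ (∃ c, ∀ y, ‖F y‖ ≤ c) ∧ ∀ t x, 𝒢.r t = u → 𝒢.r x = u →
      F (𝒢.ldiv t x) = inner ℂ (Λ.trans u x (Λ.incl A)) (Q (Λ.trans u t (Λ.incl A))) := by
  obtain ⟨F, hF, hFκ, hF0⟩ := 𝒢.exists_measurable_kernel (Λ.continuousOn_kernel u A Q)
    fun γ t x hγr hγs ht hx => by
      show inner ℂ (Λ.trans u (𝒢.mul γ x) (Λ.incl A)) (Q (Λ.trans u (𝒢.mul γ t) (Λ.incl A))) = _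
      rw [← Λ.V_trans hγr hγs ht, ← Λ.V_trans hγr hγs hx, hQ γ hγr hγs, Λ.inner_V hγr hγs]
  refine ⟨F, hF, ⟨‖Λ.incl A‖ * (‖Q‖ * ‖Λ.incl A‖), fun y => ?_⟩, hFκ⟩
  rcases hF0 y with h | ⟨p, hp⟩
  · rw [h, norm_zero]
    positivity
  · rw [hp]
    refine (norm_inner_le_norm _ _).trans ?_
    gcongr
    · exact Λ.norm_trans_apply_le _ _ _
    · exact Q.le_opNorm_of_le (Λ.norm_trans_apply_le _ _ _)

/-- For fixed t, x ↦ F(t⁻¹x) has the modulus of a coefficient of Q(t·A), so its L² norm is bounded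
independently of t; for fixed x the same holds with Q*. It remains to integrate the other variable
over C. -/
theorem memLp_kernel {u : X} (A : C_c(G, ℂ)) (Q : Λ.L2 u →L[ℂ] Λ.L2 u) {F : G → ℂ}
    (hF : Measurable F) (hFQ : ∀ t x, 𝒢.r t = u → 𝒢.r x = u → F (𝒢.ldiv t x)
      = inner ℂ (Λ.trans u x (Λ.incl A)) (Q (Λ.trans u t (Λ.incl A)))) {C : Set G}
    (hC : IsCompact C) :
    MemLp F 2 ((((Λ.measure u).prod (Λ.measure u)).restrict
      (C ×ˢ univ ∪ univ ×ˢ C)).map fun p => 𝒢.ldiv p.1 p.2) := by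
  refine ⟨hF.aestronglyMeasurable, ?_⟩
  rw [eLpNorm_map_measure hF.aestronglyMeasurable 𝒢.measurable_ldiv.aemeasurable,
    eLpNorm_lt_top_iff_lintegral_rpow_enorm_lt_top two_ne_zero (by simp)]
  let c : ℝ≥0∞ := ‖Λ.rconv u (𝒢.invol A)‖ₑ * (‖Q‖ₑ * ‖Λ.incl A‖ₑ)
  let c' : ℝ≥0∞ := ‖Λ.rconv u (𝒢.invol A)‖ₑ * (‖Q.adjoint‖ₑ * ‖Λ.incl A‖ₑ)
  have hc : c ⊔ c' ≠ ⊤ := by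
    simp [c, c', ENNReal.mul_eq_top]
  have henorm : ∀ t, ‖Λ.trans u t (Λ.incl A)‖ₑ ≤ ‖Λ.incl A‖ₑ := fun t =>
    enorm_le_iff_norm_le.2 (Λ.norm_trans_apply_le _ _ _)
  refine lt_of_le_of_lt (setLIntegral_prod_univ_le C (c := (c ⊔ c') ^ (2 : ℝ≥0∞).toReal)
    (((hF.comp 𝒢.measurable_ldiv).enorm).pow_const _) ?_ ?_) ?_
  · filter_upwards [Λ.ae_mem_fiber u] with t ht
    have h1 := Λ.eLpNorm_inner_trans_le u A (Q (Λ.trans u t (Λ.incl A)))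
    have h2 : eLpNorm (fun x => F (𝒢.ldiv t x)) 2 (Λ.measure u) ≤ c := by
      refine le_trans (le_of_eq (eLpNorm_congr_norm_ae ?_)) (h1.trans ?_)
      · filter_upwards [Λ.ae_mem_fiber u] with x hx
        rw [hFQ t x ht hx, norm_inner_symm]
      · refine mul_le_mul' le_rfl ?_
        refine (Q.le_opENorm _).trans ?_
        gcongr
        exact henorm t
    exact (lintegral_rpow_le_of_eLpNorm_le h2).trans
      (ENNReal.rpow_le_rpow le_sup_left (by positivity))
  · filter_upwards [Λ.ae_mem_fiber u] with x hx
    have h1 := Λ.eLpNorm_inner_trans_le u A (Q.adjoint (Λ.trans u x (Λ.incl A)))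
    have h2 : eLpNorm (fun t => F (𝒢.ldiv t x)) 2 (Λ.measure u) ≤ c' := by
      refine le_trans (le_of_eq (eLpNorm_congr_norm_ae ?_)) (h1.trans ?_)
      · filter_upwards [Λ.ae_mem_fiber u] with t ht
        rw [hFQ t x ht hx, ContinuousLinearMap.adjoint_inner_left]
      · refine mul_le_mul' le_rfl ?_
        refine (Q.adjoint.le_opENorm _).trans ?_
        gcongr
        exact henorm x
    exact (lintegral_rpow_le_of_eLpNorm_le h2).trans
      (ENNReal.rpow_le_rpow le_sup_right (by positivity))
  · have := ENNReal.rpow_ne_top_of_nonneg (y := (2 : ℝ≥0∞).toReal) (by positivity) hc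
    exact ENNReal.add_lt_top.2 ⟨ENNReal.mul_lt_top this.lt_top hC.measure_lt_top,
      ENNReal.mul_lt_top this.lt_top hC.measure_lt_top⟩

theorem enorm_restr_conj (u : X) (k : C_c(G, ℂ)) : ‖Λ.restr u k.conj‖ₑ = ‖Λ.restr u k‖ₑ := by
  rw [enorm_restr, enorm_restr]
  exact eLpNorm_congr_norm_ae (Eventually.of_forall fun x => RCLike.norm_conj (k x))

/-- For an operator `Q` on a fibre that commutes with the isotropy group, `E Q E` is close to a
right convolution operator on functions supported in a compact set. -/
theorem exists_rconv_sub_le {u : X} {A : C_c(G, ℂ)} (hA : IsSelfAdjoint (Λ.rconv u A))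
    {Q : Λ.L2 u →L[ℂ] Λ.L2 u}
    (hQ : ∀ γ, 𝒢.r γ = u → 𝒢.s γ = u → ∀ ξ, Q (Λ.V u u γ ξ) = Λ.V u u γ (Q ξ)) {C : Set G}
    (hC : IsCompact C) {ε : ℝ} (hε : 0 < ε) :
    ∃ Φ : C_c(G, ℂ), ∀ f : C_c(G, ℂ), tsupport f ⊆ C →
      ‖Λ.rconv u Φ (Λ.restr u f) - Λ.rconv u A (Q (Λ.rconv u A (Λ.restr u f)))‖
        ≤ ε * ‖Λ.restr u f‖ ∧
      ‖(Λ.rconv u Φ).adjoint (Λ.restr u f) - Λ.rconv u A (Q.adjoint (Λ.rconv u A (Λ.restr u f)))‖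
        ≤ ε * ‖Λ.restr u f‖ := by
  obtain ⟨F, hF, ⟨c, hc⟩, hFQ⟩ := Λ.exists_measurable_kernel A hQ
  have hfin := Λ.isFiniteMeasureOnCompacts_map_ldiv u hC
  -- The symbol F of E Q E is replaced by a C_c function close to it in L² of the image measure;
  -- Cauchy–Schwarz turns this into closeness of the operators.
  obtain ⟨g, hg1, hg2, hg3, -⟩ := (Λ.memLp_kernel A Q hF hFQ hC).exists_hasCompactSupport_eLpNorm_sub_le
    (by norm_num : (2 : ℝ≥0∞) ≠ ⊤) (ε := ENNReal.ofReal ε) (by simpa using hε)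
  let Φ : C_c(G, ℂ) := ⟨⟨g, hg3⟩, hg1⟩
  have hD : Measurable (F - g) := hF.sub hg3.measurable
  -- Only one of f and k need be supported in C. With f it bounds the operator; with k, after
  -- exchanging the roles of f and k, it bounds the adjoint.
  have key : ∀ k f : C_c(G, ℂ), (tsupport f ⊆ C ∨ tsupport k ⊆ C) →
      ‖inner ℂ (Λ.restr u k) (Λ.rconv u Φ (Λ.restr u f) -
        Λ.rconv u A (Q (Λ.rconv u A (Λ.restr u f))))‖ ≤ ε * ‖Λ.restr u f‖ * ‖Λ.restr u k‖ := by
    intro k f hfk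
    have h1 : inner ℂ (Λ.restr u k) (Λ.rconv u A (Q (Λ.rconv u A (Λ.restr u f))) -
        Λ.rconv u Φ (Λ.restr u f)) = ∫ p, f p.1 * k.conj p.2 * (F - g) (𝒢.ldiv p.1 p.2)
          ∂((Λ.measure u).prod (Λ.measure u)) := by
      rw [inner_sub_right, Λ.inner_rconv_mul_rconv hA Q hF hc hFQ, rconv_restr, inner_restr_conv]
      have h2 := integral_prod _ (Λ.integrable_kernel_ldiv u f k.conj Φ)
      have h3 := Λ.integrable_kernel u f k.conj (g := fun p => F (𝒢.ldiv p.1 p.2))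
        (hF.comp 𝒢.measurable_ldiv) fun p => hc _
      refine (congrArg _ h2.symm).trans ?_
      rw [← integral_sub h3 (Λ.integrable_kernel_ldiv u f k.conj Φ)]
      exact integral_congr_ae (Eventually.of_forall fun p => (mul_sub _ _ _).symm)
    have h4 := Λ.enorm_integral_kernel_le u f k.conj hD (S := C ×ˢ univ ∪ univ ×ˢ C) fun p hp => by
      simp only [mem_union, mem_prod, mem_univ, and_true, true_and, not_or] at hp
      rcases hfk with h | h
      · rw [image_eq_zero_of_notMem_tsupport fun h' => hp.1 (h h'), zero_mul]
      · have : k.conj p.2 = (starRingEnd ℂ) (k p.2) := rfl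
        rw [this, image_eq_zero_of_notMem_tsupport fun h' => hp.2 (h h'), map_zero, mul_zero]
    rw [← h1, enorm_restr_conj] at h4
    have h5 := h4.trans (mul_le_mul' le_rfl hg2)
    have h6 : ‖inner ℂ (Λ.restr u k) (Λ.rconv u A (Q (Λ.rconv u A (Λ.restr u f))) -
        Λ.rconv u Φ (Λ.restr u f))‖ₑ ≤ ENNReal.ofReal (‖Λ.restr u f‖ * ‖Λ.restr u k‖ * ε) := by
      rwa [ENNReal.ofReal_mul (by positivity), ENNReal.ofReal_mul (by positivity), ofReal_norm,
        ofReal_norm]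
    rw [← ofReal_norm, ENNReal.ofReal_le_ofReal_iff (by positivity)] at h6
    rw [← neg_sub, inner_neg_right, norm_neg]
    linarith
  have hεf : ∀ f, 0 ≤ ε * ‖Λ.restr u f‖ := fun f => by positivity
  refine ⟨Φ, fun f hf => ⟨Λ.norm_le_of_inner_restr (hεf f) fun k => key k f (Or.inl hf),
    Λ.norm_le_of_inner_restr (hεf f) fun k => ?_⟩⟩
  have h6 := key f k (Or.inr hf)
  have h7 : inner ℂ (Λ.restr u k) ((Λ.rconv u Φ).adjoint (Λ.restr u f) -
      Λ.rconv u A (Q.adjoint (Λ.rconv u A (Λ.restr u f))))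
      = inner ℂ (Λ.rconv u Φ (Λ.restr u k) - Λ.rconv u A (Q (Λ.rconv u A (Λ.restr u k))))
        (Λ.restr u f) := by
    have hA' : (Λ.rconv u A).adjoint = Λ.rconv u A := hA.star_eq
    have e : ∀ a b, inner ℂ a (Λ.rconv u A b) = inner ℂ (Λ.rconv u A a) b := fun a b => by
      conv_lhs => rw [← hA']
      exact ContinuousLinearMap.adjoint_inner_right _ _ _
    rw [inner_sub_right, inner_sub_left, ContinuousLinearMap.adjoint_inner_right, e,
      ContinuousLinearMap.adjoint_inner_right, e]
  rw [h7, norm_inner_symm]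
  linarith

/-- Half of the commutation theorem: an operator on a fibre that commutes with the isotropy group is
a limit of right convolution operators, and so is its adjoint. -/
theorem exists_rconv_tendsto {u : X} {Q : Λ.L2 u →L[ℂ] Λ.L2 u}
    (hQ : ∀ γ, 𝒢.r γ = u → 𝒢.s γ = u → ∀ ξ, Q (Λ.V u u γ ξ) = Λ.V u u γ (Q ξ)) :
    ∃ Φ : ℕ → C_c(G, ℂ),
      (∀ f, Tendsto (fun n => Λ.rconv u (Φ n) (Λ.restr u f)) atTop (𝓝 (Q (Λ.restr u f)))) ∧
      (∀ f, Tendsto (fun n => (Λ.rconv u (Φ n)).adjoint (Λ.restr u f)) atTop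
        (𝓝 (Q.adjoint (Λ.restr u f)))) := by
  obtain ⟨A, hA, hlim⟩ := Λ.exists_rconv_selfAdjoint_tendsto_id u
  let C := CompactExhaustion.choice G
  have hpos : ∀ n : ℕ, (0 : ℝ) < 1 / ((n : ℝ) + 1) := fun n => by positivity
  choose Φ hΦ using fun n => Λ.exists_rconv_sub_le (hA n).1 hQ (C.isCompact n) (hpos n)
  have hsub : ∀ f : C_c(G, ℂ), ∀ᶠ n in atTop, tsupport f ⊆ C n := fun f => by
    obtain ⟨n, hn⟩ := C.exists_superset_of_isCompact f.hasCompactSupport.isCompact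
    filter_upwards [eventually_ge_atTop n] with m hm
    exact hn.trans (C.subset hm)
  have hz : ∀ f : C_c(G, ℂ), Tendsto (fun n : ℕ => 1 / ((n : ℝ) + 1) * ‖Λ.restr u f‖) atTop (𝓝 0) :=
    fun f => by
      simpa using tendsto_one_div_add_atTop_nhds_zero_nat.mul_const ‖Λ.restr u f‖
  -- The compressions E_n S E_n tend strongly to S because ‖E_n‖ ≤ 2 and E_n → 1.
  have hE : ∀ (S : Λ.L2 u →L[ℂ] Λ.L2 u) ξ,
      Tendsto (fun n => Λ.rconv u (A n) (S (Λ.rconv u (A n) ξ))) atTop (𝓝 (S ξ)) := by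
    intro S ξ
    have h1 : Tendsto (fun n => S (Λ.rconv u (A n) ξ) - S ξ) atTop (𝓝 0) := by
      simpa using ((S.continuous.tendsto _).comp (hlim ξ)).sub_const (S ξ)
    have h2 : Tendsto (fun n => Λ.rconv u (A n) (S (Λ.rconv u (A n) ξ) - S ξ)) atTop (𝓝 0) := by
      refine squeeze_zero_norm (fun n => ContinuousLinearMap.le_of_opNorm_le _ (hA n).2 _) ?_
      simpa using h1.norm.const_mul 2
    have h3 := h2.add (hlim (S ξ))
    rw [zero_add] at h3
    refine h3.congr fun n => ?_
    rw [← map_add, sub_add_cancel]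
  refine ⟨Φ, fun f => ?_, fun f => ?_⟩
  · have h1 : Tendsto (fun n => Λ.rconv u (Φ n) (Λ.restr u f) -
        Λ.rconv u (A n) (Q (Λ.rconv u (A n) (Λ.restr u f)))) atTop (𝓝 0) :=
      squeeze_zero_norm' ((hsub f).mono fun n hn => (hΦ n f hn).1) (hz f)
    simpa using h1.add (hE Q (Λ.restr u f))
  · have h1 : Tendsto (fun n => (Λ.rconv u (Φ n)).adjoint (Λ.restr u f) -
        Λ.rconv u (A n) (Q.adjoint (Λ.rconv u (A n) (Λ.restr u f)))) atTop (𝓝 0) :=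
      squeeze_zero_norm' ((hsub f).mono fun n hn => (hΦ n f hn).2) (hz f)
    simpa using h1.add (hE Q.adjoint (Λ.restr u f))

end HaarSystem

/-! ### Functionals on `E²` that are carried by an orbit -/

namespace HaarSystem

variable {X G : Type*} [TopologicalSpace X] [TopologicalSpace G] [T2Space G]
  [LocallyCompactSpace G] [SecondCountableTopology G] [MeasurableSpace G] [BorelSpace G]
  {𝒢 : TopGroupoid X G} (Λ : HaarSystem 𝒢)

/-- The function `v ↦ ‖ξ^v‖`. -/
noncomputable def normFun (ξ : Λ.E2) : BoundedContinuousFunction X ℝ :=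
  BoundedContinuousFunction.ofNormedAddCommGroup (fun v => ‖Λ.ev v ξ‖) (Λ.continuous_norm_ev ξ) ‖ξ‖
    fun v => by
      rw [norm_norm]
      exact Λ.norm_ev_le v ξ

theorem normFun_apply (ξ : Λ.E2) (v : X) : Λ.normFun ξ v = ‖Λ.ev v ξ‖ := rfl

theorem norm_mulE_le (φ : BoundedContinuousFunction X ℝ) {c : ℝ} (hc : 0 ≤ c) (ξ : Λ.E2)
    (h : ∀ v, |φ v| * ‖Λ.ev v ξ‖ ≤ c) : ‖Λ.mulE φ ξ‖ ≤ c :=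
  Λ.norm_le_of_forall_ev hc fun v => by
    rw [ev_mulE, norm_smul, Complex.norm_real]
    exact h v

/-- A functional `ψ` on `E²` nearly attains its norm at a unit vector `f`; then `ψ ξ` is
controlled by the multiple `‖ξ‖ f` of `f`. -/
theorem norm_le_add_norm_mulE (ψ : Λ.E2 →L[ℂ] ℂ) {f : Λ.E2} (hf : ‖f‖ ≤ 1) {δ : ℝ}
    (hδ : ‖ψ‖ - δ ≤ (ψ f).re) {ξ : Λ.E2} (hξ : ‖ξ‖ ≤ 1) :
    ‖ψ ξ‖ ≤ δ + ‖ψ (Λ.mulE (Λ.normFun ξ) f)‖ := by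
  obtain ⟨w, hw, hwψ⟩ := RCLike.exists_norm_eq_mul_self (ψ ξ)
  -- At each point v the section is wξ^v + (1 − ‖ξ^v‖) f^v, of norm at most ‖ξ^v‖ + (1 − ‖ξ^v‖) = 1.
  -- Comparing its value under ψ with ‖ψ‖, nearly attained at f, bounds |ψ(ξ)|.
  have h1 : ‖w • ξ + (f - Λ.mulE (Λ.normFun ξ) f)‖ ≤ 1 := by
    refine Λ.norm_le_of_forall_ev zero_le_one fun v => ?_
    have e1 : Λ.ev v (w • ξ + (f - Λ.mulE (Λ.normFun ξ) f))
        = w • Λ.ev v ξ + ((1 - ‖Λ.ev v ξ‖ : ℝ) : ℂ) • Λ.ev v f := by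
      rw [map_add, map_sub, map_smul, ev_mulE, normFun_apply, Complex.ofReal_sub, sub_smul,
        Complex.ofReal_one, one_smul]
    have h2 : ‖Λ.ev v ξ‖ ≤ 1 := (Λ.norm_ev_le v ξ).trans hξ
    have h3 : ‖Λ.ev v f‖ ≤ 1 := (Λ.norm_ev_le v f).trans hf
    rw [e1]
    refine (norm_add_le _ _).trans ?_
    rw [norm_smul, norm_smul, hw, Complex.norm_real, Real.norm_of_nonneg (by linarith)]
    nlinarith
  have h2 : ‖ψ (w • ξ + (f - Λ.mulE (Λ.normFun ξ) f))‖ ≤ ‖ψ‖ := ψ.unit_le_opNorm _ h1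
  have h3 := (Complex.re_le_norm _).trans h2
  have h4 : (ψ (w • ξ + (f - Λ.mulE (Λ.normFun ξ) f))).re
      = ‖ψ ξ‖ + ((ψ f).re - (ψ (Λ.mulE (Λ.normFun ξ) f)).re) := by
    rw [map_add, map_sub, map_smul, smul_eq_mul, ← hwψ, Complex.add_re, Complex.sub_re]
    rfl
  have h5 := Complex.re_le_norm (ψ (Λ.mulE (Λ.normFun ξ) f))
  linarith

/-- A functional on `E²` that is continuous for dominated pointwise convergence on `O` on multiples
of members of `C_c(G)` is so on all of `E²`. -/
theorem tendsto_zero_of_dominated (ψ : Λ.E2 →L[ℂ] ℂ) (O : Set X)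
    (hψ : ∀ (f : C_c(G, ℂ)) (φ : ℕ → BoundedContinuousFunction X ℝ), (∀ n v, |φ n v| ≤ 1) →
      (∀ v ∈ O, Tendsto (fun n => φ n v) atTop (𝓝 0)) →
      Tendsto (fun n => ψ (Λ.mulE (φ n) (Λ.incl f))) atTop (𝓝 0))
    (ξ : ℕ → Λ.E2) {c : ℝ} (hc : ∀ n, ∀ v ∈ O, ‖Λ.ev v (ξ n)‖ ≤ c)
    (hξ : ∀ v ∈ O, Tendsto (fun n => Λ.ev v (ξ n)) atTop (𝓝 0)) :
    Tendsto (fun n => ψ (ξ n)) atTop (𝓝 0) := by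
  -- The hypothesis on ψ concerns only multiples of members of C_c(G); by density a near-maximising
  -- vector can be taken there, and general sections of norm at most 1 are compared with it.
  have hatt : ∀ δ > 0, ∃ f : C_c(G, ℂ), ‖Λ.incl f‖ ≤ 1 ∧ ‖ψ‖ - δ ≤ (ψ (Λ.incl f)).re := by
    intro δ hδ
    obtain ⟨x, hx1, hx2⟩ := ψ.exists_lt_apply_of_lt_opNorm (sub_lt_self ‖ψ‖ hδ)
    obtain ⟨w, hw, hwψ⟩ := RCLike.exists_norm_eq_mul_self (ψ x)
    have ho : IsOpen {y : Λ.E2 | ‖y‖ < 1 ∧ ‖ψ‖ - δ < (ψ y).re} :=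
      (isOpen_lt continuous_norm continuous_const).inter
        (isOpen_lt continuous_const (Complex.continuous_re.comp ψ.continuous))
    obtain ⟨f, hf⟩ := Λ.denseRange_incl.exists_mem_open ho ⟨w • x, by
      rwa [norm_smul, hw, one_mul], by
      rw [map_smul, smul_eq_mul, ← hwψ]
      exact hx2⟩
    exact ⟨f, hf.1.le, hf.2.le⟩
  have hunit : ∀ ζ : ℕ → Λ.E2, (∀ n, ‖ζ n‖ ≤ 1) →
      (∀ v ∈ O, Tendsto (fun n => Λ.ev v (ζ n)) atTop (𝓝 0)) →
      Tendsto (fun n => ψ (ζ n)) atTop (𝓝 0) := by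
    intro ζ hζ1 hζ2
    rw [Metric.tendsto_nhds]
    intro ε hε
    obtain ⟨f, hf1, hf2⟩ := hatt (ε / 2) (half_pos hε)
    have h1 := hψ f (fun n => Λ.normFun (ζ n)) (fun n v => by
      rw [normFun_apply, abs_norm]
      exact (Λ.norm_ev_le v _).trans (hζ1 n)) fun v hv => by
        simpa only [normFun_apply, norm_zero] using (hζ2 v hv).norm
    filter_upwards [Metric.tendsto_nhds.1 h1 (ε / 2) (half_pos hε)] with n hn
    rw [dist_zero_right] at hn ⊢
    have := Λ.norm_le_add_norm_mulE ψ hf1 hf2 (hζ1 n)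
    linarith
  have hscale : ∀ (ζ : ℕ → Λ.E2) {C : ℝ}, 0 < C → (∀ n, ‖ζ n‖ ≤ C) →
      (∀ v ∈ O, Tendsto (fun n => Λ.ev v (ζ n)) atTop (𝓝 0)) →
      Tendsto (fun n => ψ (ζ n)) atTop (𝓝 0) := by
    intro ζ C hC hζ1 hζ2
    have hC0 : (C : ℂ) ≠ 0 := by exact_mod_cast hC.ne'
    have h1 := hunit (fun n => (C : ℂ)⁻¹ • ζ n) (fun n => by
      rw [norm_smul, norm_inv, Complex.norm_real, Real.norm_of_nonneg hC.le, inv_mul_le_iff₀ hC,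
        mul_one]
      exact hζ1 n) fun v hv => by simpa using (hζ2 v hv).const_smul (C : ℂ)⁻¹
    have h2 := h1.const_mul (C : ℂ)
    rw [mul_zero] at h2
    refine h2.congr fun n => ?_
    rw [map_smul, smul_eq_mul, mul_inv_cancel_left₀ hC0]
  -- The previous statement applied to a constant sequence: ψ sees only the values on O.
  have hvan : ∀ ζ : Λ.E2, (∀ v ∈ O, Λ.ev v ζ = 0) → ψ ζ = 0 := by
    intro ζ hζ
    refine tendsto_nhds_unique tendsto_const_nhds
      (hscale (fun _ => ζ) (C := ‖ζ‖ + 1) (by positivity) (fun _ => by simp) fun v hv => ?_)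
    rw [hζ v hv]
    exact tendsto_const_nhds
  let C : ℝ := |c| + 1
  have hC : 0 < C := by positivity
  have hmax : ∀ n v, 0 < max C ‖Λ.ev v (ξ n)‖ := fun n v => lt_max_of_lt_left hC
  -- The ξ_n are uniformly bounded on O only. The factor C / max(C, ‖ξ_n^v‖) truncates them
  -- everywhere and equals 1 on O, so ψ does not notice the change.
  let φ : ℕ → BoundedContinuousFunction X ℝ := fun n =>
    BoundedContinuousFunction.ofNormedAddCommGroup (fun v => C / max C ‖Λ.ev v (ξ n)‖)
      (continuous_const.div (continuous_const.max (Λ.continuous_norm_ev _)) fun v => (hmax n v).ne')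
      1 fun v => by
        rw [Real.norm_of_nonneg (div_nonneg hC.le (hmax n v).le), div_le_one (hmax n v)]
        exact le_max_left _ _
  have hφ : ∀ n, ∀ v ∈ O, φ n v = 1 := fun n v hv => by
    show C / max C ‖Λ.ev v (ξ n)‖ = 1
    rw [max_eq_left ((hc n v hv).trans ((le_abs_self c).trans (le_add_of_nonneg_right zero_le_one))),
      div_self hC.ne']
  have hφO : ∀ n, ∀ v ∈ O, Λ.ev v (Λ.mulE (φ n) (ξ n)) = Λ.ev v (ξ n) := fun n v hv => by
    rw [ev_mulE, hφ n v hv, Complex.ofReal_one, one_smul]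
  have h1 := hscale (fun n => Λ.mulE (φ n) (ξ n)) hC (fun n => Λ.norm_mulE_le _ hC.le _ fun v => by
    show |C / max C ‖Λ.ev v (ξ n)‖| * ‖Λ.ev v (ξ n)‖ ≤ C
    rw [abs_of_nonneg (div_nonneg hC.le (hmax n v).le), div_mul_eq_mul_div,
      div_le_iff₀ (hmax n v)]
    exact mul_le_mul_of_nonneg_left (le_max_right _ _) hC.le) fun v hv => by
      simp only [hφO _ v hv]
      exact hξ v hv
  refine h1.congr fun n => ?_
  rw [← sub_eq_zero, ← map_sub]
  exact hvan _ fun v hv => by rw [map_sub, hφO n v hv, sub_self]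

theorem normIr_mono {F f : C_c(G, ℂ)} (h : ∀ x, ‖F x‖ ≤ ‖f x‖) : Λ.normIr F ≤ Λ.normIr f := by
  refine Real.iSup_le (fun u => ?_) (Λ.normIr_nonneg f)
  refine le_trans (integral_mono (Λ.integrable_coe u F).norm (Λ.integrable_coe u f).norm h) ?_
  exact Λ.integral_norm_le_normIr f u

theorem norm_rconv_mulC_le (u : X) {φ : BoundedContinuousFunction X ℝ} (hφ : ∀ v, |φ v| ≤ 1)
    (f : C_c(G, ℂ)) : ‖Λ.rconv u (𝒢.mulC φ f)‖ ≤ Λ.rBound f := by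
  have h1 : ∀ x, ‖𝒢.mulC φ f x‖ ≤ ‖f x‖ := fun x => by
    rw [𝒢.mulC_apply, norm_mul, Complex.norm_real]
    exact mul_le_of_le_one_left (norm_nonneg _) (hφ _)
  refine (Λ.norm_rconv_le u _).trans ?_
  unfold rBound
  gcongr
  · exact Λ.normIr_mono h1
  · refine Λ.normIr_mono fun x => ?_
    rw [invol_apply, invol_apply, RCLike.norm_conj, RCLike.norm_conj]
    exact h1 _

theorem trans_mulE (u : X) (t : G) (φ : BoundedContinuousFunction X ℝ) (ξ : Λ.E2) :
    Λ.trans u t (Λ.mulE φ ξ) = (φ (𝒢.s t) : ℂ) • Λ.trans u t ξ := by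
  rw [trans_apply, ev_mulE, map_smul, trans_apply]

/-- Right convolution by a dominated sequence `φ_n f`, with `φ_n → 0` on the orbit of `u`. -/
theorem tendsto_rconv_mulC (u : X) (f : C_c(G, ℂ)) {φ : ℕ → BoundedContinuousFunction X ℝ}
    (hφ1 : ∀ n v, |φ n v| ≤ 1)
    (hφ : ∀ v ∈ 𝒢.s '' {t | 𝒢.r t = u}, Tendsto (fun n => φ n v) atTop (𝓝 0)) (ζ : Λ.L2 u) :
    Tendsto (fun n => Λ.rconv u (𝒢.mulC (φ n) f) ζ) atTop (𝓝 0) := by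
  refine ContinuousLinearMap.tendsto_of_denseRange (T₀ := (0 : Λ.L2 u →L[ℂ] Λ.L2 u))
    (fun n => Λ.norm_rconv_mulC_le u (hφ1 n) f) (Λ.denseRange_restr u) (fun g => ?_) ζ
  -- On a vector g the convolution is ∫ g(t) φ_n(s(t)) t·f dλ^u(t): φ_n is evaluated only on the
  -- orbit of u, and dominated convergence applies.
  have h1 : ∀ n, Λ.rconv u (𝒢.mulC (φ n) f) (Λ.restr u g)
      = ∫ t, g t • Λ.trans u t (Λ.mulE (φ n) (Λ.incl f)) ∂(Λ.measure u) := fun n => by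
    rw [rconv_restr, restr_conv_eq_integral, incl_mulC]
  simp only [h1]
  have h0 : ((0 : Λ.L2 u →L[ℂ] Λ.L2 u) (Λ.restr u g)) = ∫ _t, (0 : Λ.L2 u) ∂(Λ.measure u) := by
    simp
  rw [h0]
  refine tendsto_integral_of_dominated_convergence (fun t => ‖g t‖ * ‖Λ.incl f‖)
    (fun n => (Λ.integrable_smul_trans u g _).aestronglyMeasurable)
    ((Λ.integrable_coe u g).norm.mul_const _) (fun n => Eventually.of_forall fun t => ?_) ?_
  · rw [norm_smul, trans_mulE, norm_smul, Complex.norm_real]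
    refine mul_le_mul_of_nonneg_left ?_ (norm_nonneg _)
    exact (mul_le_of_le_one_left (norm_nonneg _) (hφ1 n _)).trans (Λ.norm_trans_apply_le _ _ _)
  · filter_upwards [Λ.ae_mem_fiber u] with t ht
    have h2 := (Complex.continuous_ofReal.tendsto 0).comp (hφ (𝒢.s t) ⟨t, ht, rfl⟩)
    have h3 := (h2.smul_const (Λ.trans u t (Λ.incl f))).const_smul (g t)
    simp only [Complex.ofReal_zero, zero_smul, smul_zero] at h3
    refine h3.congr fun n => ?_
    rw [trans_mulE]
    rfl

/-! ### Translating left convolution operators -/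

theorem integral_ldiv {u : X} {t : G} (hr : 𝒢.r t = u) {h : G → ℂ}
    (hh : AEStronglyMeasurable h (Λ.measure (𝒢.s t))) :
    ∫ y, h y ∂(Λ.measure (𝒢.s t)) = ∫ x, h (𝒢.ldiv t x) ∂(Λ.measure u) := by
  have hm := Λ.measurePreserving_ldiv t hr
  rw [← hm.map_eq] at hh ⊢
  exact integral_map hm.aemeasurable hh

/-- Substitution y = t⁻¹x in the integral formula for L_g, using t·((t⁻¹x)·ξ) = x·ξ. Translates of
left convolutions are again left convolutions, so the spans of the vectors L_g η are carried into
each other. -/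
theorem V_L {u v : X} {t : G} (hr : 𝒢.r t = u) (hs : 𝒢.s t = v) {g g' : C_c(G, ℂ)}
    (hg : ∀ x, 𝒢.r x = u → g' x = g (𝒢.ldiv t x)) (ξ : Λ.E2) :
    Λ.V u v t (Λ.ev v (Λ.L g ξ)) = Λ.ev u (Λ.L g' ξ) := by
  refine ext_inner_left ℂ fun k => ?_
  subst hs
  rw [inner_L, ← ContinuousLinearMap.adjoint_inner_left, inner_L, Λ.integral_ldiv hr]
  · refine integral_congr_ae ?_
    filter_upwards [Λ.ae_mem_fiber u] with x hx
    have hx' := hr.trans hx.symm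
    rw [hg x hx, ContinuousLinearMap.adjoint_inner_left,
      Λ.V_trans hr rfl (𝒢.r_ldiv hx'), 𝒢.mul_ldiv hx']
  · exact g.continuous.aestronglyMeasurable.mul
      ((innerSL ℂ _).continuous.comp_aestronglyMeasurable (Λ.aestronglyMeasurable_trans _ _))

/-- Stability of left convolutions under functions on the unit space is what allows the partition of
unity to glue fibrewise approximants. -/
theorem mulE_L (φ : BoundedContinuousFunction X ℝ) (g : C_c(G, ℂ)) (ξ : Λ.E2) :
    Λ.mulE φ (Λ.L g ξ) = Λ.L (𝒢.mulC φ g) ξ := by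
  refine Λ.ext_ev fun u => ext_inner_left ℂ fun k => ?_
  rw [ev_mulE, inner_smul_right, inner_L, inner_L, ← integral_const_mul]
  refine integral_congr_ae ?_
  filter_upwards [Λ.ae_mem_fiber u] with x hx
  rw [𝒢.mulC_apply, hx, mul_assoc]

end HaarSystem

/-! ### Finite direct sums of a Hilbert space -/

section DirectSum

variable {H : Type*} [NormedAddCommGroup H] [InnerProductSpace ℂ H] [CompleteSpace H]
  {ι : Type*} [Fintype ι]

/-- Coordinate projections on a finite direct sum of copies of a Hilbert space. -/
noncomputable abbrev coordProj (H : Type*) [NormedAddCommGroup H] [InnerProductSpace ℂ H]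
    {ι : Type*} (i : ι) : PiLp 2 (fun _ : ι => H) →L[ℂ] H :=
  PiLp.proj (𝕜 := ℂ) 2 (fun _ : ι => H) i

theorem adjoint_coordProj [DecidableEq ι] (i : ι) (x : H) :
    (coordProj H i).adjoint x = WithLp.toLp 2 (Pi.single i x) := by
  refine ext_inner_right ℂ fun y => ?_
  rw [ContinuousLinearMap.adjoint_inner_left, PiLp.inner_apply, Finset.sum_eq_single i]
  · simp
  · intro j _ hj
    simp [hj]
  · simp

theorem coordProj_adjoint [DecidableEq ι] (i j : ι) :
    coordProj H i ∘L (coordProj H j).adjoint = if i = j then 1 else 0 := by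
  ext x
  rw [ContinuousLinearMap.comp_apply, adjoint_coordProj]
  split_ifs with h
  · subst h
    simp
  · simp [h]

theorem sum_adjoint_coordProj [DecidableEq ι] :
    ∑ i : ι, (coordProj H i).adjoint ∘L coordProj H i = 1 := by
  ext x j
  simp [adjoint_coordProj, sum_apply]

theorem coordProj_apply_eq_sum [DecidableEq ι]
    (T : PiLp 2 (fun _ : ι => H) →L[ℂ] PiLp 2 (fun _ : ι => H)) (x : PiLp 2 (fun _ : ι => H))
    (i : ι) : T x i = ∑ j, (coordProj H i ∘L T ∘L (coordProj H j).adjoint) (x j) := by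
  have h := congrArg (fun A : PiLp 2 (fun _ : ι => H) →L[ℂ] _ => A x)
    (sum_adjoint_coordProj (H := H) (ι := ι))
  simp only [sum_apply] at h
  have hx : ∑ j, (coordProj H j).adjoint (x j) = x := h
  conv_lhs => rw [← hx, map_sum]
  exact map_sum (coordProj H i) _ _

/-- `exists_matrix_tendsto` for a finite direct sum of copies of `H`. -/
theorem exists_matrix_tendsto_directSum (𝒜 : NonUnitalStarSubalgebra ℂ (H →L[ℂ] H))
    {P : PiLp 2 (fun _ : ι => H) →L[ℂ] PiLp 2 (fun _ : ι => H)} (hP : IsSelfAdjoint P)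
    (hPP : IsIdempotentElem P) {α : Type*} {d : α → H} (hd : DenseRange d)
    (h : ∀ i j, ∃ a : ℕ → H →L[ℂ] H, (∀ n, a n ∈ 𝒜) ∧
      (∀ m, Tendsto (fun n => a n (d m)) atTop
        (𝓝 (coordProj H i (P ((coordProj H j).adjoint (d m)))))) ∧
      (∀ m, Tendsto (fun n => (a n).adjoint (d m)) atTop
        (𝓝 (coordProj H j (P ((coordProj H i).adjoint (d m))))))) :
    ∃ (Y : ℕ → PiLp 2 (fun _ : ι => H) →L[ℂ] PiLp 2 (fun _ : ι => H))
      (a : ℕ → ι → ι → H →L[ℂ] H), (∀ n i j, a n i j ∈ 𝒜) ∧ (∀ n, ‖Y n‖ ≤ 2) ∧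
      (∀ x, Tendsto (fun n => Y n x) atTop (𝓝 (P x))) ∧
      ∀ n x i, Y n x i = ∑ j, a n i j (x j) := by
  classical
  have h1 := sum_adjoint_coordProj (H := H) (ι := ι)
  have h2 := coordProj_adjoint (H := H) (ι := ι)
  obtain ⟨Y, hY1, hY2, hY3⟩ := exists_matrix_tendsto (K := PiLp 2 fun _ : ι => H)
    (p := fun i => coordProj H i) h1 h2 𝒜 hP hPP hd h
  exact ⟨Y, _, hY1, hY2, hY3, fun n x i => coordProj_apply_eq_sum (Y n) x i⟩

end DirectSum

/-! ### Local density of left convolution operators -/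

namespace HaarSystem

variable {X G : Type*} [TopologicalSpace X] [TopologicalSpace G] [T2Space G]
  [LocallyCompactSpace G] [SecondCountableTopology G] [MeasurableSpace G] [BorelSpace G]
  {𝒢 : TopGroupoid X G} (Λ : HaarSystem 𝒢) {ι : Type*} [Fintype ι]

/-- The values at `u` of a family of sections, as a vector in a finite direct sum. -/
noncomputable def evFamily (u : X) (η : ι → Λ.E2) : PiLp 2 (fun _ : ι => Λ.L2 u) :=
  WithLp.toLp 2 fun j => Λ.ev u (η j)

/-- The translate by `t` of the values at `s t` of a family of sections. -/
noncomputable def transFamily (u : X) (t : G) (η : ι → Λ.E2) : PiLp 2 (fun _ : ι => Λ.L2 u) :=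
  WithLp.toLp 2 fun j => Λ.trans u t (η j)

/-- The vectors `L_g η` at `u`. -/
noncomputable def spanL (u : X) (η : ι → Λ.E2) : Submodule ℂ (PiLp 2 (fun _ : ι => Λ.L2 u)) where
  carrier := range fun g => Λ.evFamily u fun j => Λ.L g (η j)
  zero_mem' := ⟨0, by simp only [L_zero]; ext j; simp [evFamily]⟩
  add_mem' := by
    rintro _ _ ⟨f, rfl⟩ ⟨g, rfl⟩
    exact ⟨f + g, by simp only [L_add]; ext j; simp [evFamily]⟩
  smul_mem' := by
    rintro c _ ⟨f, rfl⟩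
    exact ⟨c • f, by simp only [L_smul]; ext j; simp [evFamily]⟩

/-- The diagonal action of left translations on a finite direct sum. -/
noncomputable def diagV (ι : Type*) [Fintype ι] (u : X) (γ : G) :
    PiLp 2 (fun _ : ι => Λ.L2 u) →L[ℂ] PiLp 2 (fun _ : ι => Λ.L2 u) :=
  ∑ i, (coordProj (Λ.L2 u) i).adjoint ∘L Λ.V u u γ ∘L coordProj (Λ.L2 u) i

theorem diagV_apply (u : X) (γ : G) (x : PiLp 2 (fun _ : ι => Λ.L2 u)) (i : ι) :
    Λ.diagV ι u γ x i = Λ.V u u γ (x i) := by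
  classical
  simp [diagV, adjoint_coordProj, sum_apply]

theorem inner_diagV {u : X} {γ : G} (hr : 𝒢.r γ = u) (hs : 𝒢.s γ = u)
    (x y : PiLp 2 (fun _ : ι => Λ.L2 u)) :
    inner ℂ (Λ.diagV ι u γ x) (Λ.diagV ι u γ y) = inner ℂ x y := by
  simp only [PiLp.inner_apply, diagV_apply, Λ.inner_V hr hs]

theorem diagV_diagV_inv {u : X} {γ : G} (hr : 𝒢.r γ = u) (hs : 𝒢.s γ = u)
    (x : PiLp 2 (fun _ : ι => Λ.L2 u)) :
    Λ.diagV ι u γ (Λ.diagV ι u (𝒢.inv γ) x) = x := by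
  ext i : 1
  rw [diagV_apply, diagV_apply, Λ.V_V hr hs ((𝒢.r_inv γ).trans hs) ((𝒢.s_inv γ).trans hr),
    𝒢.mul_inv, hr, V_unit]

theorem diagV_mem_closure {u : X} {γ : G} (hr : 𝒢.r γ = u) (hs : 𝒢.s γ = u) (η : ι → Λ.E2)
    {x : PiLp 2 (fun _ : ι => Λ.L2 u)} (hx : x ∈ (Λ.spanL u η).topologicalClosure) :
    Λ.diagV ι u γ x ∈ (Λ.spanL u η).topologicalClosure := by
  refine map_mem_closure (Λ.diagV ι u γ).continuous hx ?_
  rintro _ ⟨g, rfl⟩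
  obtain ⟨g', hg'⟩ := 𝒢.exists_translate g γ
  refine ⟨g', ?_⟩
  ext i : 1
  rw [diagV_apply]
  exact (Λ.V_L hr hs (fun x hx => hg' x (hr.trans hx.symm)) (η i)).symm

/-- With an approximate identity F_n, t·(L_{F_n} η) tends to t·η, and by `V_L` it is the value at u
of another left convolution of η. -/
theorem transFamily_mem_closure {u : X} {t : G} (ht : 𝒢.r t = u) (η : ι → Λ.E2) :
    Λ.transFamily u t η ∈ (Λ.spanL u η).topologicalClosure := by
  obtain ⟨F, -, -, -, hF⟩ := Λ.exists_approximate_identity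
  have h1 : Tendsto (fun n => Λ.transFamily u t fun j => Λ.L (F n) (η j)) atTop
      (𝓝 (Λ.transFamily u t η)) :=
    ((PiLp.continuous_toLp 2 _).tendsto _).comp
      (tendsto_pi_nhds.2 fun j => ((Λ.trans u t).continuous.tendsto _).comp (hF (η j)))
  refine mem_closure_of_tendsto h1 (Eventually.of_forall fun n => ?_)
  obtain ⟨g', hg'⟩ := 𝒢.exists_translate (F n) t
  refine ⟨g', ?_⟩
  ext i : 1
  exact (Λ.V_L ht rfl (fun x hx => hg' x (ht.trans hx.symm)) (η i)).symm

/-- The projection on the closed span of the vectors `L_g η` at `u`. -/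
noncomputable def projL (u : X) (η : ι → Λ.E2) :
    PiLp 2 (fun _ : ι => Λ.L2 u) →L[ℂ] PiLp 2 (fun _ : ι => Λ.L2 u) :=
  (Λ.spanL u η).topologicalClosure.starProjection

/-- The isotropy group acts unitarily and both γ and γ⁻¹ preserve the closed span, hence also its
orthogonal complement. -/
theorem projL_diagV {u : X} {γ : G} (hr : 𝒢.r γ = u) (hs : 𝒢.s γ = u) (η : ι → Λ.E2)
    (x : PiLp 2 (fun _ : ι => Λ.L2 u)) :
    Λ.projL u η (Λ.diagV ι u γ x) = Λ.diagV ι u γ (Λ.projL u η x) := by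
  refine Submodule.eq_starProjection_of_mem_of_inner_eq_zero
    (Λ.diagV_mem_closure hr hs η (Submodule.starProjection_apply_mem _ x)) fun w hw => ?_
  rw [← Λ.diagV_diagV_inv hr hs w, ← map_sub, Λ.inner_diagV hr hs]
  exact Submodule.starProjection_inner_eq_zero _ _
    (Λ.diagV_mem_closure ((𝒢.r_inv γ).trans hs) ((𝒢.s_inv γ).trans hr) η hw)

theorem projL_transFamily {u : X} {t : G} (ht : 𝒢.r t = u) (η : ι → Λ.E2) :
    Λ.projL u η (Λ.transFamily u t η) = Λ.transFamily u t η :=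
  Submodule.starProjection_eq_self_iff.2 (Λ.transFamily_mem_closure ht η)

theorem norm_transFamily_le (u : X) (t : G) (η : ι → Λ.E2) :
    ‖Λ.transFamily u t η‖ ≤ √(∑ j, ‖η j‖ ^ 2) := by
  refine Real.le_sqrt_of_sq_le ?_
  rw [PiLp.norm_sq_eq_of_L2]
  refine Finset.sum_le_sum fun j _ => ?_
  exact pow_le_pow_left₀ (norm_nonneg _) (Λ.norm_trans_apply_le u t (η j)) 2

theorem adjoint_coordProj_V [DecidableEq ι] (u : X) (γ : G) (j : ι) (ξ : Λ.L2 u) :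
    (coordProj (Λ.L2 u) j).adjoint (Λ.V u u γ ξ)
      = Λ.diagV ι u γ ((coordProj (Λ.L2 u) j).adjoint ξ) := by
  ext i : 1
  rw [diagV_apply, adjoint_coordProj, adjoint_coordProj]
  by_cases h : i = j
  · subst h
    simp
  · simp [h]

/-- The matrix entries of the projection on the closed span of the vectors `L_g η` at `u`. -/
noncomputable def entryL (u : X) (η : ι → Λ.E2) (i j : ι) : Λ.L2 u →L[ℂ] Λ.L2 u :=
  coordProj (Λ.L2 u) i ∘L Λ.projL u η ∘L (coordProj (Λ.L2 u) j).adjoint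

theorem isSelfAdjoint_projL (u : X) (η : ι → Λ.E2) : IsSelfAdjoint (Λ.projL u η) :=
  isSelfAdjoint_starProjection _

theorem adjoint_entryL (u : X) (η : ι → Λ.E2) (i j : ι) :
    (Λ.entryL u η i j).adjoint = Λ.entryL u η j i := by
  have hP : (Λ.projL u η).adjoint = Λ.projL u η := (Λ.isSelfAdjoint_projL u η).star_eq
  rw [entryL, entryL, ContinuousLinearMap.adjoint_comp, ContinuousLinearMap.adjoint_comp,
    ContinuousLinearMap.adjoint_adjoint, hP, ContinuousLinearMap.comp_assoc]

theorem entryL_V {u : X} {γ : G} (hr : 𝒢.r γ = u) (hs : 𝒢.s γ = u) (η : ι → Λ.E2) (i j : ι)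
    (ξ : Λ.L2 u) : Λ.entryL u η i j (Λ.V u u γ ξ) = Λ.V u u γ (Λ.entryL u η i j ξ) := by
  classical
  simp only [entryL, ContinuousLinearMap.comp_apply]
  rw [adjoint_coordProj_V, Λ.projL_diagV hr hs]
  exact Λ.diagV_apply u γ _ i

theorem exists_entryL_tendsto (u : X) (η : ι → Λ.E2) (i j : ι) :
    ∃ a : ℕ → Λ.L2 u →L[ℂ] Λ.L2 u, (∀ n, a n ∈ Λ.rconvAlgebra u) ∧
      (∀ f, Tendsto (fun n => a n (Λ.restr u f)) atTop
        (𝓝 (coordProj (Λ.L2 u) i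
          (Λ.projL u η ((coordProj (Λ.L2 u) j).adjoint (Λ.restr u f)))))) ∧
      (∀ f, Tendsto (fun n => (a n).adjoint (Λ.restr u f)) atTop
        (𝓝 (coordProj (Λ.L2 u) j
          (Λ.projL u η ((coordProj (Λ.L2 u) i).adjoint (Λ.restr u f)))))) := by
  obtain ⟨Φ, h1, h2⟩ := Λ.exists_rconv_tendsto
    (Q := Λ.entryL u η i j) fun γ hr hs => Λ.entryL_V hr hs η i j
  rw [adjoint_entryL] at h2
  exact ⟨fun n => Λ.rconv u (Φ n), fun n => ⟨Φ n, rfl⟩, h1, h2⟩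

/-- The projection on the closed span of the vectors `L_g η` at `u` is a strong limit of a bounded
sequence of matrices of right convolution operators. -/
theorem exists_matrix_rconv_tendsto (u : X) (η : ι → Λ.E2) :
    ∃ (Y : ℕ → PiLp 2 (fun _ : ι => Λ.L2 u) →L[ℂ] PiLp 2 (fun _ : ι => Λ.L2 u))
      (Φ : ℕ → ι → ι → C_c(G, ℂ)), (∀ n, ‖Y n‖ ≤ 2) ∧
      (∀ x, Tendsto (fun n => Y n x) atTop (𝓝 (Λ.projL u η x))) ∧
      ∀ n x i, Y n x i = ∑ j, Λ.rconv u (Φ n i j) (x j) := by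
  obtain ⟨Y, a, ha, hY2, hY3, hY⟩ := exists_matrix_tendsto_directSum (Λ.rconvAlgebra u)
    (Λ.isSelfAdjoint_projL u η) (Submodule.isIdempotentElem_starProjection _)
    (Λ.denseRange_restr u) (Λ.exists_entryL_tendsto u η)
  choose Φ hΦ using ha
  refine ⟨Y, Φ, hY2, hY3, fun n x i => ?_⟩
  simp only [hΦ]
  exact hY n x i

/-- Fibrewise, an operator that commutes with right convolutions and is itself given by right
convolution with a fixed vector is approximated by left convolution operators. -/
theorem exists_norm_ev_L_sub_lt {S : Λ.E2 →L[ℂ] Λ.E2} {u : X} {ζ : Λ.L2 u}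
    (hSζ : ∀ f, Λ.ev u (S (Λ.incl f)) = Λ.rconv u f ζ)
    (hS : S ∈ Λ.VN) (η : ι → Λ.E2) {ε : ℝ} (hε : 0 < ε) :
    ∃ g, ∀ j, ‖Λ.ev u (Λ.L g (η j)) - Λ.ev u (S (η j))‖ < ε := by
  suffices h : Λ.evFamily u (fun j => S (η j)) ∈ (Λ.spanL u η).topologicalClosure by
    obtain ⟨_, ⟨g, rfl⟩, hg⟩ := Metric.mem_closure_iff.1 h ε hε
    refine ⟨g, fun j => ?_⟩
    rw [dist_comm, dist_eq_norm] at hg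
    exact (PiLp.norm_apply_le _ j).trans_lt hg
  -- Membership in the closure is tested against vectors k orthogonal to the span, that is with P k
  -- = 0.
  rw [← Submodule.orthogonal_orthogonal_eq_closure]
  intro k hk
  have hPk : Λ.projL u η k = 0 := by
    rw [projL, Submodule.starProjection_apply_eq_zero_iff, Submodule.orthogonal_closure]
    exact hk
  obtain ⟨Y, Φ, hY2, hY3, hY⟩ := Λ.exists_matrix_rconv_tendsto u η
  -- The global sections (Y_n − 1)η, with the operators R in place of the fibre operators. Right
  -- convolution commutes with translation, so moving them by t to the fibre u gives (Y_n − 1)(t·η),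
  -- which tends to (P − 1)(t·η) = 0.
  let ξ : ℕ → ι → Λ.E2 := fun n i => ∑ j, Λ.R (Φ n i j) (η j) - η i
  have hξt : ∀ n i t, 𝒢.r t = u → Λ.trans u t (ξ n i)
      = (Y n (Λ.transFamily u t η) - Λ.transFamily u t η) i := by
    intro n i t ht
    rw [PiLp.sub_apply, hY, map_sub, map_sum]
    simp only [Λ.trans_R ht]
    rfl
  -- On f in C_c(G) this functional is ζ ↦ ⟨k_i, rconv f ζ⟩ at the fixed ζ, so multiplying f by φ_n
  -- → 0 on the orbit makes it tend to 0.
  have hψ : ∀ i, Tendsto (fun n => inner ℂ (k i) (Λ.ev u (S (ξ n i)))) atTop (𝓝 0) := by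
    intro i
    refine Λ.tendsto_zero_of_dominated (innerSL ℂ (k i) ∘L Λ.ev u ∘L S) (𝒢.s '' {t | 𝒢.r t = u})
      (fun f φ hφ1 hφ => ?_) (fun n => ξ n i) (c := 3 * √(∑ j, ‖η j‖ ^ 2)) ?_ ?_
    · have h1 := (innerSL ℂ (k i)).continuous.tendsto 0 |>.comp (Λ.tendsto_rconv_mulC u f hφ1 hφ ζ)
      rw [map_zero] at h1
      refine h1.congr fun n => ?_
      rw [Function.comp_apply, ← hSζ, incl_mulC]
      rfl
    · rintro n _ ⟨t, ht, rfl⟩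
      rw [← Λ.norm_trans_apply ht, hξt n i t ht]
      refine (PiLp.norm_apply_le _ i).trans ((norm_sub_le _ _).trans ?_)
      have h1 := (Y n).le_of_opNorm_le (hY2 n) (Λ.transFamily u t η)
      have h2 := Λ.norm_transFamily_le u t η
      linarith
    · rintro _ ⟨t, ht, rfl⟩
      rw [tendsto_zero_iff_norm_tendsto_zero]
      have h1 := (hY3 (Λ.transFamily u t η)).sub_const (Λ.transFamily u t η)
      rw [Λ.projL_transFamily ht, sub_self] at h1
      refine squeeze_zero (fun _ => norm_nonneg _) (fun n => ?_)
        (tendsto_zero_iff_norm_tendsto_zero.1 h1)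
      rw [← Λ.norm_trans_apply ht, hξt n i t ht]
      exact PiLp.norm_apply_le _ i
  have h1 := tendsto_finsetSum Finset.univ fun i _ => hψ i
  rw [Finset.sum_const_zero] at h1
  let y := Λ.evFamily u fun j => S (η j)
  -- Since S commutes with every R, the same quantities are the effect of Y_n − 1 on y itself.
  have h2 : ∀ n, ∑ i, inner ℂ (k i) (Λ.ev u (S (ξ n i))) = inner ℂ k (Y n y - y) := by
    intro n
    rw [PiLp.inner_apply]
    refine Finset.sum_congr rfl fun i _ => ?_
    congr 1
    rw [PiLp.sub_apply, hY, map_sub, map_sub, map_sum, map_sum]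
    have h3 : ∀ j, Λ.ev u (S (Λ.R (Φ n i j) (η j))) = Λ.rconv u (Φ n i j) (y j) := fun j => by
      have h4 := congrArg (fun A : Λ.E2 →L[ℂ] Λ.E2 => Λ.ev u (A (η j))) (hS (Φ n i j))
      simp only [ContinuousLinearMap.comp_apply, ev_R] at h4
      exact h4
    simp only [h3]
    rfl
  simp only [h2] at h1
  have h5 : Tendsto (fun n => inner ℂ k (Y n y - y)) atTop
      (𝓝 (inner ℂ k (Λ.projL u η y - y))) :=
    tendsto_const_nhds.inner ((hY3 y).sub_const y)
  have h6 := tendsto_nhds_unique h1 h5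
  have hP : (Λ.projL u η).adjoint = Λ.projL u η := (Λ.isSelfAdjoint_projL u η).star_eq
  rw [inner_sub_right, ← ContinuousLinearMap.adjoint_inner_left, hP, hPk, inner_zero_left,
    zero_sub, eq_comm, neg_eq_zero] at h6
  exact h6

end HaarSystem

/-! ### The strong operator closure -/

/-- A net indexed by finite sets of vectors and tolerances 1/(n+1) converges pointwise to T. -/
theorem mem_sotClosure_of_forall {E : Type*} [NormedAddCommGroup E] [NormedSpace ℂ E]
    {S : Set (E →L[ℂ] E)} {T : E →L[ℂ] E}
    (h : ∀ s : Finset E, ∀ ε > 0, ∃ A ∈ S, ∀ x ∈ s, ‖A x - T x‖ ≤ ε) : T ∈ sotClosure S := by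
  have hpos : ∀ p : Finset E × ℕ, (0 : ℝ) < 1 / ((p.2 : ℝ) + 1) := fun p => by positivity
  choose A hA1 hA2 using fun p : Finset E × ℕ => h p.1 _ (hpos p)
  let B : Finset E × ℕ → PointwiseConvergenceCLM (RingHom.id ℂ) E E := fun p =>
    ContinuousLinearMap.toPointwiseConvergenceCLM ℂ (RingHom.id ℂ) E E (A p)
  let T' : PointwiseConvergenceCLM (RingHom.id ℂ) E E :=
    ContinuousLinearMap.toPointwiseConvergenceCLM ℂ (RingHom.id ℂ) E E T
  have hB : Tendsto B (atTop ×ˢ atTop) (𝓝 T') := by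
    rw [PointwiseConvergenceCLM.tendsto_iff_forall_tendsto]
    intro x
    show Tendsto (fun p => A p x) _ (𝓝 (T x))
    rw [tendsto_iff_norm_sub_tendsto_zero]
    refine squeeze_zero' (Eventually.of_forall fun _ => norm_nonneg _) ?_
      (tendsto_one_div_add_atTop_nhds_zero_nat.comp tendsto_snd)
    filter_upwards [tendsto_fst.eventually (eventually_ge_atTop {x})] with p hp
    exact hA2 p x (hp (Finset.mem_singleton_self x))
  have hT : T' ∈ closure (ContinuousLinearMap.toPointwiseConvergenceCLM ℂ (RingHom.id ℂ) E E '' S) :=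
    mem_closure_of_tendsto hB (Eventually.of_forall fun p => mem_image_of_mem _ (hA1 p))
  exact hT

theorem exists_tendsto_of_mem_sotClosure {E : Type*} [NormedAddCommGroup E] [NormedSpace ℂ E]
    {S : Set (E →L[ℂ] E)} {T : E →L[ℂ] E} (hT : T ∈ sotClosure S) :
    ∃ l : Filter (E →L[ℂ] E), l.NeBot ∧ (∀ᶠ A in l, A ∈ S) ∧
      ∀ x, Tendsto (fun A => A x) l (𝓝 (T x)) := by
  let j := ContinuousLinearMap.toPointwiseConvergenceCLM ℂ (RingHom.id ℂ) E E
  have h1 : (𝓝 (j T) ⊓ map j (𝓟 S)).NeBot := by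
    rw [map_principal]
    exact mem_closure_iff_clusterPt.1 hT
  rw [← Filter.push_pull', map_neBot_iff] at h1
  refine ⟨_, h1, mem_inf_of_right (mem_principal_self S), fun x => ?_⟩
  have h2 : Tendsto j (comap j (𝓝 (j T)) ⊓ 𝓟 S) (𝓝 (j T)) := tendsto_comap.mono_left inf_le_left
  exact PointwiseConvergenceCLM.tendsto_iff_forall_tendsto.1 h2 x

/-! ### The two inclusions between VN(G) and the strong closure of 𝔏. -/

namespace HaarSystem

variable {X G : Type*} [TopologicalSpace X] [TopologicalSpace G] [T2Space G]
  [LocallyCompactSpace G] [SecondCountableTopology G] [MeasurableSpace G] [BorelSpace G]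
  {𝒢 : TopGroupoid X G} (Λ : HaarSystem 𝒢)

theorem comp_L_mem_VN {T : Λ.E2 →L[ℂ] Λ.E2} (hT : T ∈ Λ.VN) (F : C_c(G, ℂ)) :
    T ∘L Λ.L F ∈ Λ.VN := fun f => by
  rw [ContinuousLinearMap.comp_assoc, L_comp_R, ← ContinuousLinearMap.comp_assoc, hT f,
    ContinuousLinearMap.comp_assoc]

/-- T(F * f) = T R_f F = R_f T F: on C_c(G), T L_F is determined at u by the single vector (T F)^u.
This is the reason for passing from T to T L_F. -/
theorem ev_comp_L {T : Λ.E2 →L[ℂ] Λ.E2} (hT : T ∈ Λ.VN) (F f : C_c(G, ℂ)) (u : X) :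
    Λ.ev u ((T ∘L Λ.L F) (Λ.incl f)) = Λ.rconv u f (Λ.ev u (T (Λ.incl F))) := by
  have h := congrArg (fun A : Λ.E2 →L[ℂ] Λ.E2 => A (Λ.incl F)) (hT f)
  simp only [ContinuousLinearMap.comp_apply] at h
  rw [ContinuousLinearMap.comp_apply, L_incl, ← R_incl, h, ev_R]

theorem VN_subset_sotClosure : Λ.VN ⊆ sotClosure (range Λ.L) := by
  intro T hT
  refine mem_sotClosure_of_forall fun s ε hε => ?_
  obtain ⟨F, -, -, -, hF⟩ := Λ.exists_approximate_identity
  obtain ⟨n, hn⟩ : ∃ n, ∀ x ∈ s, ‖T (Λ.L (F n) x) - T x‖ < ε / 2 := by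
    refine ((Filter.eventually_all_finset s).2 fun x _ => ?_).exists (f := atTop)
    have h := (T.continuous.tendsto _).comp (hF x)
    filter_upwards [Metric.tendsto_nhds.1 h (ε / 2) (half_pos hε)] with n hn
    rwa [dist_eq_norm] at hn
  let M : AddSubmonoid (s → Λ.E2) :=
    { carrier := {a | ∃ g, a = fun j : s => Λ.L g (j : Λ.E2)}
      zero_mem' := ⟨0, by rw [L_zero]; rfl⟩
      add_mem' := by
        rintro _ _ ⟨f, rfl⟩ ⟨g, rfl⟩
        exact ⟨f + g, by rw [L_add]; rfl⟩ }
  obtain ⟨_, ⟨g, rfl⟩, hg⟩ := Λ.exists_norm_sub_le_of_fiberwise M (by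
      rintro φ _ ⟨g, rfl⟩
      exact ⟨𝒢.mulC φ g, by simp only [mulE_L]⟩)
    (fun j : s => (T ∘L Λ.L (F n)) (j : Λ.E2)) (fun u δ hδ => by
      obtain ⟨g, hg⟩ := Λ.exists_norm_ev_L_sub_lt (fun f => Λ.ev_comp_L hT (F n) f u)
        (Λ.comp_L_mem_VN hT (F n)) (fun j : s => (j : Λ.E2)) hδ
      exact ⟨_, ⟨g, rfl⟩, hg⟩) (half_pos hε)
  refine ⟨Λ.L g, ⟨g, rfl⟩, fun x hx => ?_⟩
  have h1 := hg ⟨x, hx⟩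
  have h2 := hn x hx
  have h3 := norm_sub_le_norm_sub_add_norm_sub (Λ.L g x) (T (Λ.L (F n) x)) (T x)
  rw [ContinuousLinearMap.comp_apply] at h1
  linarith

/-- Commuting with a fixed bounded operator is preserved under pointwise limits, and each L_F
commutes with each R_f. -/
theorem sotClosure_subset_VN : sotClosure (range Λ.L) ⊆ Λ.VN := by
  intro T hT f
  obtain ⟨l, hl, hlL, hlT⟩ := exists_tendsto_of_mem_sotClosure hT
  ext1 ξ
  refine tendsto_nhds_unique_of_eventuallyEq (hlT (Λ.R f ξ))
    (((Λ.R f).continuous.tendsto _).comp (hlT ξ)) ?_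
  filter_upwards [hlL] with A hA
  obtain ⟨F, rfl⟩ := hA
  exact congrArg (fun B : Λ.E2 →L[ℂ] Λ.E2 => B ξ) (Λ.L_comp_R F f)

/-- The algebra of left convolution operators. -/
noncomputable def LAlgebra : NonUnitalSubalgebra ℂ (Λ.E2 →L[ℂ] Λ.E2) where
  carrier := range Λ.L
  zero_mem' := ⟨0, Λ.L_zero⟩
  add_mem' := by
    rintro _ _ ⟨F, rfl⟩ ⟨f, rfl⟩
    exact ⟨F + f, Λ.L_add F f⟩
  smul_mem' := by
    rintro c _ ⟨F, rfl⟩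
    exact ⟨c • F, Λ.L_smul c F⟩
  mul_mem' := by
    rintro _ _ ⟨F, rfl⟩ ⟨f, rfl⟩
    exact ⟨Λ.conv F f, (Λ.L_comp_L F f).symm⟩

end HaarSystem

theorem mainTheorem9 {X G : Type*} [TopologicalSpace X] [TopologicalSpace G] [T2Space G]
    [LocallyCompactSpace G] [SecondCountableTopology G] [MeasurableSpace G] [BorelSpace G]
    (𝒢 : TopGroupoid X G) (Λ : HaarSystem 𝒢) :
    -- `L_F` and `R_F` are the unique bounded extensions to `E²` of left and right convolution by `F`
    (∀ F : C_c(G, ℂ),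
      (∀ T : Λ.E2 →L[ℂ] Λ.E2, T = Λ.L F ↔ ∀ f, T (Λ.incl f) = Λ.incl (Λ.conv F f)) ∧
      (∀ T : Λ.E2 →L[ℂ] Λ.E2, T = Λ.R F ↔ ∀ f, T (Λ.incl f) = Λ.incl (Λ.conv f F))) ∧
    -- a bounded nonnegative left approximate identity with `L_{F_n} → I` strongly
    (∃ F : ℕ → C_c(G, ℂ),
      (∃ M : ℝ, ∀ n, Λ.normIr (F n) ≤ M) ∧
      (∀ n x, 0 ≤ F n x) ∧
      (∀ f : C_c(G, ℂ), Tendsto (fun n => Λ.normIr (Λ.conv (F n) f - f)) atTop (𝓝 0)) ∧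
      (∀ ξ : Λ.E2, Tendsto (fun n => Λ.L (F n) ξ) atTop (𝓝 ξ))) ∧
    -- the left convolution operators form a subalgebra, with strong operator closure `VN(G)`
    (∃ 𝔏 : NonUnitalSubalgebra ℂ (Λ.E2 →L[ℂ] Λ.E2),
      (𝔏 : Set (Λ.E2 →L[ℂ] Λ.E2)) = Set.range Λ.L ∧ Λ.VN = sotClosure (𝔏 : Set _)) := by
  refine ⟨fun F => ⟨fun T => ⟨?_, fun h => ?_⟩, fun T => ⟨?_, fun h => ?_⟩⟩, ?_, Λ.LAlgebra, rfl,
    Λ.VN_subset_sotClosure.antisymm Λ.sotClosure_subset_VN⟩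
  · rintro rfl f
    exact Λ.L_incl F f
  · exact Λ.eq_of_incl fun f => by rw [h, Λ.L_incl]
  · rintro rfl f
    exact Λ.R_incl F f
  · exact Λ.eq_of_incl fun f => by rw [h, Λ.R_incl]
  · obtain ⟨F, h1, h2, h3, h4⟩ := Λ.exists_approximate_identity
    exact ⟨F, ⟨1, h1⟩, h2, h3, h4⟩
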